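/- Let $b,c,\rho>0$ and let $r:[0,\infty)\to\mathbb R$ be a non-decreasing function in $C^1([0,\infty))\cap C^2((0,\infty))$ such that $r(0)=0$, $r(x)\le (b+\rho)x$ for $x\ge 0$ close to $0$, $a:=\lim_{x\to\infty}r(x)$ exists and is finite, $\lim_{x\to\infty}(a-r(x))x$ exists and is finite, and $\lim_{x\to\infty}r'(x)=0$. An admissible control is a locally integrable function $u:[0,\infty)\to(0,\infty)$ with $\int_0^\infty e^{-\rho t}\ln u(t)\,dt<\infty$ (the value $-\infty$ is allowed). For $x_0\ge 0$ let $x(\cdot)\ge 0$ be the solution of $$\dot x(t)=u(t)-bx(t)+r(x(t)),\qquad x(0)=x_0,$$ and define the total benefit and the value function of the deterministic shallow lake problem by $$J(x_0;u)=\int_0^\infty e^{-\rho t}\bigl(\ln u(t)-c\,x(t)^2\bigr)\,dt,\qquad V(x_0)=\sup_{u\ \mathrm{admissible}}J(x_0;u).$$ The shallow lake system is $\dot x=u-bx+r(x)$, $\dot u=-(\rho+b-r'(x))u+2cxu^2$ on $\{x\ge 0,\ u>0\}$; a saddle point is a steady state of it whose linearisation has one negative and one positive eigenvalue. A point $x_*>0$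 is called a Skiba point if the system has a leftmost (oligotrophic) steady state $(x_-,u_-)$ and a rightmost (eutrophic) steady state $(x_+,u_+)$, both saddle points, with $x_-<x_*<x_+$, and there are two optimal controls for the initial state $x_*$, one whose trajectory converges to $x_-$ and one whose trajectory converges to $x_+$ as $t\to\infty$. If $x_*$ is a Skiba point, then $V$ is finite on $[0,\infty)$ and $V\in C^2\bigl((0,\infty)\setminus\{x_*\}\bigr)$. -/

import Mathlib

open Set Filter Topology MeasureTheory

noncomputable section

namespace ShallowLake

/-- Standing assumptions on the recycling rate `r` (only its values on `[0, ∞)` matter). -/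
structure IsRecyclingRate (b ρ : ℝ) (r : ℝ → ℝ) : Prop where
  contDiffOn_one : ContDiffOn ℝ 1 r (Ici 0)
  contDiffOn_two : ContDiffOn ℝ 2 r (Ioi 0)
  monotoneOn : MonotoneOn r (Ici 0)
  map_zero : r 0 = 0
  le_near_zero : ∀ᶠ x in 𝓝[≥] (0 : ℝ), r x ≤ (b + ρ) * x
  limits : ∃ a C : ℝ, Tendsto r atTop (𝓝 a) ∧ Tendsto (fun x => (a - r x) * x) atTop (𝓝 C)
  deriv_tendsto : Tendsto (deriv r) atTop (𝓝 0)

/-- Admissible controls: locally integrable `u : [0, ∞) → (0, ∞)` with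
`∫₀^∞ e^{-ρ t} ln u(t) dt < ∞`, i.e. the positive part of the integrand has finite integral
(the value `-∞` is allowed). -/
def IsAdmissible (ρ : ℝ) (u : ℝ → ℝ) : Prop :=
  (∀ t, 0 ≤ t → 0 < u t) ∧ LocallyIntegrableOn u (Ici 0) ∧
    ∫⁻ t in Ioi (0 : ℝ), ENNReal.ofReal (Real.exp (-ρ * t) * Real.log (u t)) < ⊤

/-- `x : [0, ∞) → [0, ∞)` is the (Carathéodory) solution of `x' = u - b x + r(x)`, `x(0) = x₀`. -/
def IsTrajectory (b : ℝ) (r : ℝ → ℝ) (x₀ : ℝ) (u x : ℝ → ℝ) : Prop :=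
  ContinuousOn x (Ici 0) ∧ ∀ t, 0 ≤ t →
    0 ≤ x t ∧ x t = x₀ + ∫ s in (0 : ℝ)..t, (u s - b * x s + r (x s))

/-- The discounted running benefit `e^{-ρ t} (ln u(t) - c x(t)²)`. -/
def benefit (c ρ : ℝ) (u x : ℝ → ℝ) (t : ℝ) : ℝ :=
  Real.exp (-ρ * t) * (Real.log (u t) - c * x t ^ 2)

/-- The total benefit `∫₀^∞ e^{-ρ t} (ln u(t) - c x(t)²) dt`, as the difference of the integrals of
the positive and the negative part. For admissible controls the former is finite, so the total
benefit lies in `[-∞, ∞)`. -/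
def totalBenefit (c ρ : ℝ) (u x : ℝ → ℝ) : EReal :=
  ((∫⁻ t in Ioi (0 : ℝ), ENNReal.ofReal (benefit c ρ u x t) : ENNReal) : EReal) -
    ((∫⁻ t in Ioi (0 : ℝ), ENNReal.ofReal (-benefit c ρ u x t) : ENNReal) : EReal)

/-- The value function `V(x₀) = sup_u J(x₀; u)` of the deterministic problem. -/
def value (b c ρ : ℝ) (r : ℝ → ℝ) (x₀ : ℝ) : EReal :=
  sSup {J : EReal | ∃ u x : ℝ → ℝ,
    IsAdmissible ρ u ∧ IsTrajectory b r x₀ u x ∧ J = totalBenefit c ρ u x}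

/-- `u` is an optimal control for the initial state `x₀`, with optimal trajectory `x`. -/
def IsOptimal (b c ρ : ℝ) (r : ℝ → ℝ) (x₀ : ℝ) (u x : ℝ → ℝ) : Prop :=
  IsAdmissible ρ u ∧ IsTrajectory b r x₀ u x ∧ totalBenefit c ρ u x = value b c ρ r x₀

/-- The vector field of the shallow lake system in the variables `z = (x, u)`:
`x' = u - b x + r(x)`, `u' = -(ρ + b - r'(x)) u + 2 c x u²`. -/
def lakeField (b c ρ : ℝ) (r : ℝ → ℝ) (z : ℝ × ℝ) : ℝ × ℝ :=
  (z.2 - b * z.1 + r z.1,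
    -(ρ + b - deriv r z.1) * z.2 + 2 * c * z.1 * z.2 ^ 2)

/-- Steady states of the shallow lake system (necessarily with `x ≠ 0`, since `r 0 = 0 < u`). -/
def IsSteadyState (b c ρ : ℝ) (r : ℝ → ℝ) (z : ℝ × ℝ) : Prop :=
  0 ≤ z.1 ∧ 0 < z.2 ∧ lakeField b c ρ r z = 0

/-- A saddle point: a steady state at which the linearisation has a negative and a positive
eigenvalue. -/
def IsSaddlePoint (b c ρ : ℝ) (r : ℝ → ℝ) (z : ℝ × ℝ) : Prop :=
  IsSteadyState b c ρ r z ∧ ∃ l₁ l₂ : ℝ, l₁ < 0 ∧ 0 < l₂ ∧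
    Module.End.HasEigenvalue (fderiv ℝ (lakeField b c ρ r) z : ℝ × ℝ →ₗ[ℝ] ℝ × ℝ) l₁ ∧
    Module.End.HasEigenvalue (fderiv ℝ (lakeField b c ρ r) z : ℝ × ℝ →ₗ[ℝ] ℝ × ℝ) l₂

/-- `xs` is a Skiba point: it lies strictly between the oligotrophic (leftmost) and the eutrophic
(rightmost) steady state, both saddle points, and there are two optimal controls with initial
state `xs`, one steering the lake to the oligotrophic, the other to the eutrophic steady state. -/
def IsSkibaPoint (b c ρ : ℝ) (r : ℝ → ℝ) (xs : ℝ) : Prop :=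
  ∃ zm zp : ℝ × ℝ, IsSaddlePoint b c ρ r zm ∧ IsSaddlePoint b c ρ r zp ∧
    (∀ z, IsSteadyState b c ρ r z → zm.1 ≤ z.1 ∧ z.1 ≤ zp.1) ∧
    zm.1 < xs ∧ xs < zp.1 ∧
    (∃ u x, IsOptimal b c ρ r xs u x ∧ Tendsto x atTop (𝓝 zm.1)) ∧
    (∃ u x, IsOptimal b c ρ r xs u x ∧ Tendsto x atTop (𝓝 zp.1))

end ShallowLake

end

noncomputable section

namespace ShallowLake

/-! ### Monotonicity criteria -/

/-! Write g(x) = r(x) - bx and H(x,p) = -ln(-p) - 1 - cx² + p g(x) for p < 0. The bound ln u ≤ u -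
1, integrated along the state equation, shows V < ∞; an exponentially growing trajectory shows V >
-∞. V is decreasing and continuous and solves ρV = H(x,V') in the viscosity sense: short moves at
constant velocity give one inequality (`Standing.eventually_move`), a verification argument the
other (`Standing.le_ham_of_touched`).

H is strictly convex in p, and its p-derivative is the speed -1/p + g(x) under the feedback u =
-1/p. A solution p of H(x,p) = ρV(x) therefore lies on a right-moving or on a left-moving branch,
unless g(x) < 0 and ρV(x) is the minimum of H(x,·). In that exceptional case staying at x is
optimal, and x is the first coordinate of a steady state (`Standing.defect_eq_zero_of_isRest`).

Away from rest points some M < 0 satisfies H(·,M) < ρV nearby. Then V - My has no local maximum, so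
it first decreases and then increases. Where it decreases, V is strictly differentiable with slope
on the left-moving branch; where it increases, on the right-moving one. As x grows, the feedback can
thus switch from left to right at a kink, but from right to left only at a rest point
(`Standing.exists_local_dichotomy`, `Standing.movesRightAt_of_not_movesLeftAt`).

Let x_* be a Skiba point. An optimal trajectory cannot cross an interval against the feedback
(`Standing.not_crossing`), nor leave a rest point to a side where V is classical
(`Standing.not_departing`). The two optimal trajectories from x_* hence force left motion on
(x_-,x_*) and right motion on (x_*,x_+). Outside [x_-,x_+] there are no rest points. Left motion
near 0 would make V blow up logarithmically at 0, and right motion near infinity would contradict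
the quadratic decay of V, so the motion is to the right on (0,x_-) and to the left on (x_+,∞).

Where the speed is nonzero, implicit differentiation of ρV = H(x,V') gives V ∈ C²
(`Standing.hasDerivAt_costate`). At x_± the speed vanishes. There s = V'g - 1, taken with the
appropriate sign as a function of the distance y to the saddle, is positive, tends to 0 and solves
s' = a(y) + k(y) y/s. Its slope at 0 is the positive root of a quadratic whose constant term is
positive by the saddle property (`IsSaddlePoint.exists_hasDerivAt_defect`). The root is the same on
both sides, so V'' extends continuously across x_±. -/

theorem le_left_of_eventually_right_le {f : ℝ → ℝ} {a b : ℝ} (hab : a ≤ b)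
    (hf : ContinuousOn f (Icc a b)) (h : ∀ x ∈ Ico a b, ∀ᶠ y in 𝓝[>] x, f y ≤ f x) :
    f b ≤ f a := by
  have hs : IsClosed ({x | f x ≤ f a} ∩ Icc a b) := by
    rw [inter_comm]
    exact hf.preimage_isClosed_of_isClosed isClosed_Icc isClosed_Iic
  have := hs.Icc_subset_of_forall_mem_nhdsWithin (by simp : a ∈ {x | f x ≤ f a}) ?_
  · exact this (right_mem_Icc.2 hab)
  · rintro x ⟨hx, hx'⟩
    filter_upwards [h x hx'] with y hy
    simp only [mem_ofPred_eq] at hx ⊢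
    exact le_trans hy hx

theorem tendsto_neg_nhdsGT (x : ℝ) : Tendsto (fun y : ℝ => -y) (𝓝[>] x) (𝓝[<] (-x)) := by
  refine tendsto_nhdsWithin_iff.2 ⟨(continuous_neg.tendsto x).mono_left nhdsWithin_le_nhds, ?_⟩
  filter_upwards [self_mem_nhdsWithin] with y hy
  simpa using hy

theorem le_right_of_eventually_left_le {f : ℝ → ℝ} {a b : ℝ} (hab : a ≤ b)
    (hf : ContinuousOn f (Icc a b)) (h : ∀ x ∈ Ioc a b, ∀ᶠ y in 𝓝[<] x, f y ≤ f x) :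
    f a ≤ f b := by
  have h1 : ContinuousOn (fun x => f (-x)) (Icc (-b) (-a)) :=
    hf.comp continuous_neg.continuousOn (fun x hx => ⟨by linarith [hx.2], by linarith [hx.1]⟩)
  have := le_left_of_eventually_right_le (f := fun x => f (-x)) (neg_le_neg hab) h1 ?_
  · simpa using this
  · intro x hx
    exact (tendsto_neg_nhdsGT x).eventually
      (h (-x) ⟨by linarith [hx.2], by linarith [hx.1]⟩)

/-- `f` is touched from above at `ξ` by a parabola of slope `p`. -/
def TouchedAbove (f : ℝ → ℝ) (ξ p : ℝ) : Prop :=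
  ∃ K : ℝ, ∀ᶠ x in 𝓝 ξ, f x ≤ f ξ + p * (x - ξ) + K * (x - ξ) ^ 2

theorem TouchedAbove.neg_comp {f : ℝ → ℝ} {ξ p : ℝ}
    (h : TouchedAbove (fun x => f (-x)) ξ p) : TouchedAbove f (-ξ) (-p) := by
  obtain ⟨K, hK⟩ := h
  refine ⟨K, ?_⟩
  have : Tendsto (fun y : ℝ => -y) (𝓝 (-ξ)) (𝓝 ξ) := by
    simpa using continuous_neg.tendsto (-ξ)
  filter_upwards [this.eventually hK] with x hx
  simp only [neg_neg] at hx
  nlinarith [hx]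

theorem TouchedAbove.add_linear {f : ℝ → ℝ} {ξ p q : ℝ}
    (h : TouchedAbove (fun x => f x - q * x) ξ p) : TouchedAbove f ξ (p + q) := by
  obtain ⟨K, hK⟩ := h
  refine ⟨K, ?_⟩
  filter_upwards [hK] with x hx
  nlinarith [hx]

/-- Quadratic majorant for the barrier below. The difference of the two sides is h²(a + 2h)/(a³(a +
h)), hence the range of h. -/
theorem inv_le_quadratic {a h : ℝ} (ha : 0 < a) (hh : -(a / 2) ≤ h) :
    1 / (a + h) ≤ 1 / a - h / a ^ 2 + 2 * h ^ 2 / a ^ 3 := by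
  have h1 : 0 < a + h := by linarith
  have : 1 / a - h / a ^ 2 + 2 * h ^ 2 / a ^ 3 - 1 / (a + h) =
      h ^ 2 * (a + 2 * h) / (a ^ 3 * (a + h)) := by
    field_simp
    ring
  have : 0 ≤ h ^ 2 * (a + 2 * h) / (a ^ 3 * (a + h)) := by
    have : 0 ≤ a + 2 * h := by linarith
    positivity
  linarith

/-- If e a > e b, subtract a barrier η/(x - a) with small η. The difference tends to -∞ at a and
exceeds its value at b somewhere, so it has an interior maximum ξ, where e is touched from above by
a parabola of negative slope -η/(ξ - a)². -/
theorem le_of_touchedAbove_nonneg {e : ℝ → ℝ} {a b : ℝ} (hab : a < b)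
    (he : ContinuousOn e (Icc a b))
    (h : ∀ ξ ∈ Ioo a b, ∀ p, TouchedAbove e ξ p → 0 ≤ p) : e a ≤ e b := by
  by_contra! hlt
  set l := e a - e b with hl
  have hlpos : 0 < l := by simp only [hl]; linarith
  have hca : ∀ᶠ x in 𝓝[>] a, e a - l / 2 < e x := by
    have h1 : Tendsto e (𝓝[>] a) (𝓝 (e a)) :=
      (he a (left_mem_Icc.2 hab.le)).mono_left (by
        rw [← nhdsWithin_Ioc_eq_nhdsGT hab]
        exact nhdsWithin_mono _ Ioc_subset_Icc_self)
    exact h1.eventually (lt_mem_nhds (by linarith))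
  obtain ⟨x', hx'e, hx'⟩ :=
    (hca.and (Ioo_mem_nhdsGT hab)).exists
  -- The barrier then costs exactly l/4 at x', where e has dropped by less than l/2, so the maximum
  -- cannot sit at b, where e has dropped by l.
  set η := (x' - a) * (l / 4) with hη
  have hx'a : 0 < x' - a := by linarith [hx'.1]
  have hηpos : 0 < η := by positivity
  obtain ⟨a', haa', ha'x, ha'big⟩ : ∃ a', a < a' ∧ a' < x' ∧
      ∀ x ∈ Icc a b, e x - η / (a' - a) < e x' - l / 4 := by
    obtain ⟨C, hC⟩ := isCompact_Icc.bddAbove_image he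
    have : Tendsto (fun x => η / (x - a)) (𝓝[>] a) atTop := by
      have h0 : Tendsto (fun x => x - a) (𝓝[>] a) (𝓝[>] 0) := by
        refine tendsto_nhdsWithin_iff.2 ⟨?_, ?_⟩
        · have : Tendsto (fun x => x - a) (𝓝 a) (𝓝 (a - a)) := by
            exact (continuous_id.sub continuous_const).tendsto a
          rw [sub_self] at this
          exact this.mono_left nhdsWithin_le_nhds
        · filter_upwards [self_mem_nhdsWithin] with y hy
          simpa using hy
      simp only [div_eq_mul_inv]
      exact (tendsto_inv_nhdsGT_zero.comp h0).const_mul_atTop hηpos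
    obtain ⟨a', h1, h2⟩ := ((this.eventually (eventually_gt_atTop (C - (e x' - l / 4)))).and
      (Ioo_mem_nhdsGT hx'.1)).exists
    refine ⟨a', h2.1, h2.2, fun x hx => ?_⟩
    have := hC (mem_image_of_mem e hx)
    linarith
  have ha'b : a' ≤ b := by linarith [hx'.2]
  have hcont : ContinuousOn (fun x => e x - η / (x - a)) (Icc a' b) := by
    refine (he.mono (Icc_subset_Icc_left haa'.le)).sub (continuousOn_const.div
      (continuousOn_id.sub continuousOn_const) ?_)
    intro x hx
    linarith [hx.1]
  obtain ⟨ξ, hξ, hmax⟩ := isCompact_Icc.exists_isMaxOn (nonempty_Icc.2 ha'b) hcont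
  have hmax' : ∀ x ∈ Icc a' b, e x - η / (x - a) ≤ e ξ - η / (ξ - a) := fun x hx => hmax hx
  have hval : e x' - l / 4 ≤ e ξ - η / (ξ - a) := by
    have := hmax' x' ⟨ha'x.le, hx'.2.le⟩
    have h2 : η / (x' - a) = l / 4 := by rw [hη]; field_simp
    linarith
  have hξa : a' < ξ := by
    rcases hξ.1.eq_or_lt with h1 | h1
    · have := ha'big ξ ⟨by linarith [hξ.1], hξ.2⟩
      rw [h1] at this
      linarith
    · exact h1
  have hξb : ξ < b := by
    rcases hξ.2.eq_or_lt with h1 | h1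
    · rw [h1] at hval
      have : 0 < η / (b - a) := div_pos hηpos (by linarith)
      linarith
    · exact h1
  have hpos : 0 < ξ - a := by linarith
  have := h ξ ⟨by linarith, hξb⟩ (-(η / (ξ - a) ^ 2)) ⟨η * (2 / (ξ - a) ^ 3), ?_⟩
  · have : 0 < η / (ξ - a) ^ 2 := by positivity
    linarith
  · filter_upwards [Ioo_mem_nhds hξa hξb,
      Ioi_mem_nhds (show ξ - (ξ - a) / 2 < ξ by linarith)] with x hx hx2
    have h1 := hmax' x ⟨hx.1.le, hx.2.le⟩
    have h2 := inv_le_quadratic (a := ξ - a) (h := x - ξ) hpos (by linarith [mem_Ioi.1 hx2])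
    have h3 : ξ - a + (x - ξ) = x - a := by ring
    rw [h3] at h2
    have h4 := mul_le_mul_of_nonneg_left h2 hηpos.le
    have e1 : η * (1 / (x - a)) = η / (x - a) := by ring
    have e2 : η * (1 / (ξ - a) - (x - ξ) / (ξ - a) ^ 2 + 2 * (x - ξ) ^ 2 / (ξ - a) ^ 3) =
        η / (ξ - a) - η / (ξ - a) ^ 2 * (x - ξ) + η * (2 / (ξ - a) ^ 3) * (x - ξ) ^ 2 := by ring
    rw [e1, e2] at h4
    linarith

theorem le_of_touchedAbove_nonpos {e : ℝ → ℝ} {a b : ℝ} (hab : a < b)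
    (he : ContinuousOn e (Icc a b))
    (h : ∀ ξ ∈ Ioo a b, ∀ p, TouchedAbove e ξ p → p ≤ 0) : e b ≤ e a := by
  have h1 : ContinuousOn (fun x => e (-x)) (Icc (-b) (-a)) :=
    he.comp continuous_neg.continuousOn (fun x hx => ⟨by linarith [hx.2], by linarith [hx.1]⟩)
  have := le_of_touchedAbove_nonneg (e := fun x => e (-x)) (neg_lt_neg hab) h1 ?_
  · simpa using this
  · intro ξ hξ p hp
    have := h (-ξ) ⟨by linarith [hξ.2], by linarith [hξ.1]⟩ (-p) hp.neg_comp
    linarith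

/-- A continuous function without interior local maxima first decreases, then increases. -/
theorem antitoneOn_or_monotoneOn_of_no_localMax {f : ℝ → ℝ} {a b : ℝ}
    (hf : ContinuousOn f (Ioo a b)) (h : ∀ ξ ∈ Ioo a b, ¬ IsLocalMax f ξ) (x : ℝ) :
    AntitoneOn f (Ioo a b ∩ Iic x) ∨ MonotoneOn f (Ioo a b ∩ Ici x) := by
  -- After one strict increase f keeps increasing strictly; otherwise the maximum over [u, w] is
  -- attained inside, if necessary at v.
  have key : ∀ u v w, u ∈ Ioo a b → w ∈ Ioo a b → u < v → v < w → f u < f v → f v < f w := by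
    intro u v w hu hw huv hvw hlt
    by_contra! hle
    have hsub : Icc u w ⊆ Ioo a b := fun y hy => ⟨hu.1.trans_le hy.1, hy.2.trans_lt hw.2⟩
    obtain ⟨ξ, hξ, hmax⟩ := isCompact_Icc.exists_isMaxOn
      (nonempty_Icc.2 (huv.trans hvw).le) (hf.mono hsub)
    have hloc : ∀ ζ ∈ Ioo u w, (∀ y ∈ Icc u w, f y ≤ f ζ) → False := by
      intro ζ hζ hm
      refine h ζ (hsub (Ioo_subset_Icc_self hζ)) ?_
      filter_upwards [Icc_mem_nhds hζ.1 hζ.2] with y hy using hm y hy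
    have hmax' : ∀ y ∈ Icc u w, f y ≤ f ξ := fun y hy => hmax hy
    have hv := hmax' v ⟨huv.le, hvw.le⟩
    rcases hξ.1.eq_or_lt with h1 | h1
    · rw [← h1] at hv; linarith
    rcases hξ.2.eq_or_lt with h2 | h2
    · refine hloc v ⟨huv, hvw⟩ (fun y hy => (hmax' y hy).trans ?_)
      rw [h2]; exact hle
    · exact hloc ξ ⟨h1, h2⟩ hmax'
  by_cases hA : AntitoneOn f (Ioo a b ∩ Iic x)
  · exact Or.inl hA
  · right
    simp only [AntitoneOn, not_forall, not_le] at hA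
    obtain ⟨u, hu, v, hv, huv, hlt⟩ := hA
    have huv' : u < v := lt_of_le_of_ne huv (fun h => by rw [h] at hlt; exact lt_irrefl _ hlt)
    intro y hy z hz hyz
    rcases hyz.eq_or_lt with h1 | h1
    · rw [h1]
    have hvy : v ≤ y := (mem_Iic.1 hv.2).trans (mem_Ici.1 hy.2)
    rcases hvy.eq_or_lt with h2 | h2
    · rw [← h2] at h1 ⊢
      exact (key u v z hu.1 hz.1 huv' h1 hlt).le
    · have h3 := key u v y hu.1 hy.1 huv' h2 hlt
      exact (key v y z hv.1 hz.1 h2 h1 h3).le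

/-- Two-sided slope bounds at all scales give strict differentiability. -/
theorem hasStrictDerivAt_of_monotone_antitone {f : ℝ → ℝ} {x p : ℝ}
    (h : ∀ ε > 0, ∃ δ > 0, MonotoneOn (fun y => f y - (p - ε) * y) (Ioo (x - δ) (x + δ)) ∧
      AntitoneOn (fun y => f y - (p + ε) * y) (Ioo (x - δ) (x + δ))) :
    HasStrictDerivAt f p x := by
  rw [hasStrictDerivAt_iff_hasStrictFDerivAt]
  refine HasStrictFDerivAt.of_isLittleO ?_
  rw [Asymptotics.isLittleO_iff]
  intro ε hε
  obtain ⟨δ, hδ, hm, ha⟩ := h ε hε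
  have hI : Ioo (x - δ) (x + δ) ∈ 𝓝 x := Ioo_mem_nhds (by linarith) (by linarith)
  have : ∀ᶠ z : ℝ × ℝ in 𝓝 (x, x), z.1 ∈ Ioo (x - δ) (x + δ) ∧ z.2 ∈ Ioo (x - δ) (x + δ) := by
    rw [nhds_prod_eq]
    exact (eventually_mem_set.2 hI).prod_mk (eventually_mem_set.2 hI)
  filter_upwards [this] with z hz
  obtain ⟨h1, h2⟩ := hz
  simp only [Real.norm_eq_abs]
  have e : (ContinuousLinearMap.toSpanSingleton ℝ p) (z.1 - z.2) = p * (z.1 - z.2) := by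
    simp [mul_comm]
  rw [e]
  rcases le_total z.1 z.2 with h3 | h3
  · have a1 := hm h1 h2 h3
    have a2 := ha h1 h2 h3
    simp only at a1 a2
    rw [abs_of_nonpos (sub_nonpos.2 h3), abs_le]
    constructor <;> nlinarith
  · have a1 := hm h2 h1 h3
    have a2 := ha h2 h1 h3
    simp only at a1 a2
    rw [abs_of_nonneg (sub_nonneg.2 h3), abs_le]
    constructor <;> nlinarith

/-! ### Differential inequalities -/

/-- F starts below any level ε > 0 and cannot cross it upwards, its derivative being negative there;
then ε → 0. -/
theorem nonpos_of_tendsto_zero_of_deriv_neg {F F' : ℝ → ℝ} {b : ℝ}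
    (hF : ∀ y ∈ Ioo 0 b, HasDerivAt F (F' y) y) (h0 : Tendsto F (𝓝[>] 0) (𝓝 0))
    (h : ∀ y ∈ Ioo 0 b, 0 ≤ F y → F' y < 0) : ∀ y ∈ Ioo 0 b, F y ≤ 0 := by
  intro y hy
  refine le_of_forall_pos_le_add fun ε hε => ?_
  rw [zero_add]
  obtain ⟨z, hz1, hz2⟩ := ((h0.eventually (gt_mem_nhds hε)).and (Ioo_mem_nhdsGT hy.1)).exists
  have hsub : ∀ w ∈ Icc z y, w ∈ Ioo 0 b := fun w hw =>
    ⟨hz2.1.trans_le hw.1, hw.2.trans_lt hy.2⟩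
  refine image_le_of_deriv_right_lt_deriv_boundary (f := F) (f' := F') (B := fun _ => ε)
    (B' := fun _ => 0) (a := z) (b := y)
    (fun w hw => (hF w (hsub w hw)).continuousAt.continuousWithinAt)
    (fun w hw => (hF w (hsub w (Ico_subset_Icc_self hw))).hasDerivWithinAt) hz1.le
    (fun w => hasDerivAt_const w ε) (fun w hw hwe => ?_) (right_mem_Icc.2 hz2.2.le)
  exact h w (hsub w (Ico_subset_Icc_self hw)) (by rw [hwe]; exact hε.le)

/-- Comparison with the strict supersolutions N²(y + η)². The shift η > 0 is needed because
equations with a square root are not uniquely solvable from 0; it gives room at the start and is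
removed at the end. -/
theorem le_quadratic_of_deriv_le_sqrt {E E' : ℝ → ℝ} {δ C₁ C₂ : ℝ} (hC₁ : 0 ≤ C₁) (hC₂ : 0 ≤ C₂)
    (hE0 : Tendsto E (𝓝[>] 0) (𝓝 0))
    (hE : ∀ y ∈ Ioo 0 δ, HasDerivAt E (E' y) y)
    (h : ∀ y ∈ Ioo 0 δ, E' y ≤ C₁ * √(E y) + C₂ * y) :
    ∀ y ∈ Ioo 0 δ, E y ≤ (C₁ + C₂ + 1) ^ 2 * y ^ 2 := by
  intro y hy
  set N := C₁ + C₂ + 1 with hN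
  have hNpos : 1 ≤ N := by linarith
  have key : ∀ η > 0, E y ≤ N ^ 2 * (y + η) ^ 2 := by
    intro η hη
    have hpos : 0 < N ^ 2 * η ^ 2 := by positivity
    obtain ⟨z, hz1, hz2⟩ :=
      ((hE0.eventually (gt_mem_nhds hpos)).and (Ioo_mem_nhdsGT hy.1)).exists
    have hsub : ∀ w ∈ Icc z y, w ∈ Ioo 0 δ := fun w hw =>
      ⟨hz2.1.trans_le hw.1, hw.2.trans_lt hy.2⟩
    refine image_le_of_deriv_right_lt_deriv_boundary (f := E) (f' := E')
      (B := fun w => N ^ 2 * (w + η) ^ 2)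
      (B' := fun w => N ^ 2 * (2 * (w + η))) (a := z) (b := y)
      (fun w hw => (hE w (hsub w hw)).continuousAt.continuousWithinAt)
      (fun w hw => (hE w (hsub w (Ico_subset_Icc_self hw))).hasDerivWithinAt) ?_
      (fun w => ?_) (fun w hw hwe => ?_) (right_mem_Icc.2 hz2.2.le)
    · refine hz1.le.trans ?_
      have : η ^ 2 ≤ (z + η) ^ 2 := by nlinarith [hz2.1]
      nlinarith [sq_nonneg N]
    · have := (((hasDerivAt_id w).add_const η).pow 2).const_mul (N ^ 2)
      simpa using this
    · have hw0 := (hsub w (Ico_subset_Icc_self hw)).1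
      refine (h w (hsub w (Ico_subset_Icc_self hw))).trans_lt ?_
      rw [hwe, show N ^ 2 * (w + η) ^ 2 = (N * (w + η)) ^ 2 by ring,
        Real.sqrt_sq (by positivity)]
      have h1 : C₁ * N ≤ N ^ 2 := by nlinarith
      have h2 : C₂ < N ^ 2 := by nlinarith
      have h3 : C₁ * (N * (w + η)) ≤ N ^ 2 * (w + η) := by nlinarith
      have h4 : C₂ * w ≤ N ^ 2 * w := by nlinarith
      have h5 : 0 < N ^ 2 * η := by positivity
      nlinarith
  have hlim : Tendsto (fun η : ℝ => N ^ 2 * (y + η) ^ 2) (𝓝[>] 0) (𝓝 (N ^ 2 * (y + 0) ^ 2)) := by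
    have : Continuous (fun η : ℝ => N ^ 2 * (y + η) ^ 2) := by fun_prop
    exact (this.tendsto 0).mono_left nhdsWithin_le_nhds
  rw [add_zero] at hlim
  refine ge_of_tendsto hlim ?_
  filter_upwards [self_mem_nhdsWithin] with η hη using key η hη

/-- Near a saddle, a positive solution of `s' = a(y) + k(y) y / s` with `s(0+) = 0` has slope the
positive root of `σ² = a₀ σ + κ`. -/
theorem tendsto_slope_of_deriv_eq {s a k : ℝ → ℝ} {δ a₀ κ σ : ℝ} (hδ : 0 < δ)
    (hs : ∀ y ∈ Ioo 0 δ, HasDerivAt s (a y + k y * y / s y) y)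
    (hpos : ∀ y ∈ Ioo 0 δ, 0 < s y) (hs0 : Tendsto s (𝓝[>] 0) (𝓝 0))
    (ha : Tendsto a (𝓝[>] 0) (𝓝 a₀)) (hk : Tendsto k (𝓝[>] 0) (𝓝 κ))
    (hκ : 0 < κ) (hσ : 0 < σ) (hroot : σ ^ 2 = a₀ * σ + κ) :
    Tendsto (fun y => s y / y) (𝓝[>] 0) (𝓝 σ) := by
  have hlin : ∀ m : ℝ, Tendsto (fun y => s y - m * y) (𝓝[>] 0) (𝓝 0) := by
    intro m
    have : Tendsto (fun y : ℝ => m * y) (𝓝[>] 0) (𝓝 (m * 0)) :=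
      ((continuous_const.mul continuous_id).tendsto 0).mono_left nhdsWithin_le_nhds
    simpa using hs0.sub this
  have hroot' : a₀ + κ / σ = σ := by field_simp; linarith
  -- The map m ↦ a₀ + κ/m - m is strictly decreasing on (0, ∞) and vanishes at σ. Hence s - σ₁y
  -- decreases wherever it is nonnegative if σ₁ > σ, and s - σ₂y increases wherever it is
  -- nonpositive if 0 < σ₂ < σ.
  have upper : ∀ σ₁ > σ, ∀ᶠ y in 𝓝[>] (0 : ℝ), s y ≤ σ₁ * y := by
    intro σ₁ h1
    have hσ₁ : 0 < σ₁ := hσ.trans h1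
    have h2 : a₀ + κ / σ₁ < σ₁ := by
      have : κ / σ₁ < κ / σ := div_lt_div_of_pos_left hκ hσ h1
      linarith
    have h3 := (ha.add (hk.div_const σ₁)).eventually (gt_mem_nhds h2)
    have h4 := hk.eventually (lt_mem_nhds hκ)
    obtain ⟨u, hu, hu'⟩ := mem_nhdsGT_iff_exists_Ioo_subset.1
      (inter_mem (h3.and h4) (Ioo_mem_nhdsGT hδ))
    have hu0 : 0 < u := hu
    have := nonpos_of_tendsto_zero_of_deriv_neg (F := fun y => s y - σ₁ * y)
      (F' := fun y => a y + k y * y / s y - σ₁) (b := u)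
      (fun y hy => by
        have := (hs y (hu' hy).2).fun_sub ((hasDerivAt_id y).const_mul σ₁)
        simpa using this) (hlin σ₁) ?_
    · filter_upwards [Ioo_mem_nhdsGT hu0] with y hy
      linarith [this y hy]
    · intro y hy hge
      obtain ⟨⟨h5, h6⟩, h7⟩ := hu' hy
      have hsp := hpos y h7
      have : k y * y / s y ≤ k y / σ₁ := by
        rw [div_le_div_iff₀ hsp hσ₁]
        nlinarith
      linarith
  have lower : ∀ σ₂, 0 < σ₂ → σ₂ < σ → ∀ᶠ y in 𝓝[>] (0 : ℝ), σ₂ * y ≤ s y := by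
    intro σ₂ hσ₂ h1
    have h2 : σ₂ < a₀ + κ / σ₂ := by
      have : κ / σ < κ / σ₂ := div_lt_div_of_pos_left hκ hσ₂ h1
      linarith
    have h3 := (ha.add (hk.div_const σ₂)).eventually (lt_mem_nhds h2)
    have h4 := hk.eventually (lt_mem_nhds hκ)
    obtain ⟨u, hu, hu'⟩ := mem_nhdsGT_iff_exists_Ioo_subset.1
      (inter_mem (h3.and h4) (Ioo_mem_nhdsGT hδ))
    have hu0 : 0 < u := hu
    have := nonpos_of_tendsto_zero_of_deriv_neg (F := fun y => -(s y - σ₂ * y))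
      (F' := fun y => -(a y + k y * y / s y - σ₂)) (b := u)
      (fun y hy => by
        have := ((hs y (hu' hy).2).fun_sub ((hasDerivAt_id y).const_mul σ₂)).fun_neg
        simpa only [mul_one, id] using this)
        (by simpa using (hlin σ₂).neg) ?_
    · filter_upwards [Ioo_mem_nhdsGT hu0] with y hy
      linarith [this y hy]
    · intro y hy hge
      obtain ⟨⟨h5, h6⟩, h7⟩ := hu' hy
      have hsp := hpos y h7
      have : k y / σ₂ ≤ k y * y / s y := by
        rw [div_le_div_iff₀ hσ₂ hsp]
        nlinarith
      linarith
  rw [tendsto_order]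
  constructor
  · intro m hm
    obtain ⟨σ₂, h1, h2⟩ := exists_between (max_lt hm hσ)
    filter_upwards [lower σ₂ ((le_max_right _ _).trans_lt h1) h2, self_mem_nhdsWithin] with y hy hy0
    have hy0' : 0 < y := hy0
    exact ((le_max_left _ _).trans_lt h1).trans_le ((le_div_iff₀ hy0').2 hy)
  · intro m hm
    obtain ⟨σ₁, h1, h2⟩ := exists_between hm
    filter_upwards [upper σ₁ h1, self_mem_nhdsWithin] with y hy hy0
    have hy0' : 0 < y := hy0
    exact ((div_le_iff₀ hy0').2 hy).trans_lt h2

/-- Integral form of Grönwall's lemma with zero initial value. -/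
theorem nonpos_of_le_integral {y : ℝ → ℝ} {t₁ t₂ C : ℝ} (hy : ContinuousOn y (Icc t₁ t₂))
    (hC : 0 ≤ C) (h : ∀ t ∈ Icc t₁ t₂, y t ≤ C * ∫ s in t₁..t, y s) :
    ∀ t ∈ Icc t₁ t₂, y t ≤ 0 := by
  intro t ht
  have h12 : t₁ ≤ t₂ := ht.1.trans ht.2
  have hint : IntervalIntegrable y volume t₁ t₂ := by
    apply ContinuousOn.intervalIntegrable
    rwa [uIcc_of_le h12]
  set Y := fun t => ∫ s in t₁..t, y s with hY
  have hYc : ContinuousOn Y (Icc t₁ t₂) := by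
    have := intervalIntegral.continuousOn_primitive_interval' hint left_mem_uIcc
    rwa [uIcc_of_le h12] at this
  have hYd : ∀ u ∈ Ioo t₁ t₂, HasDerivAt Y (y u) u := by
    intro u hu
    refine intervalIntegral.integral_hasDerivAt_right ?_ ?_ ?_
    · exact hint.mono_set (by
        rw [uIcc_of_le h12, uIcc_of_le hu.1.le]; exact Icc_subset_Icc_right hu.2.le)
    · exact ContinuousOn.stronglyMeasurableAtFilter_nhdsWithin (hy.mono Ioo_subset_Icc_self)
        measurableSet_Ioo u |>.filter_mono (by rw [isOpen_Ioo.nhdsWithin_eq hu])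
    · exact hy.continuousAt (Icc_mem_nhds hu.1 hu.2)
  have hanti : AntitoneOn (fun t => Y t * Real.exp (-C * t)) (Icc t₁ t₂) := by
    refine antitoneOn_of_hasDerivWithinAt_nonpos (f' := fun u =>
      y u * Real.exp (-C * u) + Y u * (Real.exp (-C * u) * (-C))) (convex_Icc _ _)
      (hYc.mul (by fun_prop)) ?_ ?_
    · intro u hu
      rw [interior_Icc] at hu
      have he : HasDerivAt (fun t : ℝ => Real.exp (-C * t)) (Real.exp (-C * u) * (-C)) u := by
        simpa using ((hasDerivAt_id u).const_mul (-C)).exp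
      exact ((hYd u hu).mul he).hasDerivWithinAt
    · intro u hu
      rw [interior_Icc] at hu
      have := h u (Ioo_subset_Icc_self hu)
      have he := Real.exp_pos (-C * u)
      simp only [hY]
      nlinarith [mul_le_mul_of_nonneg_right this he.le]
  have h1 := hanti (left_mem_Icc.2 h12) ht ht.1
  have h0 : Y t₁ = 0 := by simp [hY]
  simp only [h0, zero_mul] at h1
  have h2 : Y t ≤ 0 := by
    by_contra! hc
    have := mul_pos hc (Real.exp_pos (-C * t))
    linarith
  have := h t ht
  nlinarith

/-! ### Calculus along absolutely continuous curves -/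

/-- Trajectories are only absolutely continuous. The Lipschitz bound makes φ ∘ x absolutely
continuous, the chain rule holds almost everywhere, and the fundamental theorem applies. No
continuity of φ' is required, so φ may be the value function itself before it is known to be C¹. -/
theorem discounted_chain_rule {ρ t₁ t₂ : ℝ} {x w φ φ' : ℝ → ℝ} {S : Set ℝ} {K : NNReal}
    (h12 : t₁ ≤ t₂) (hw : IntervalIntegrable w volume t₁ t₂)
    (hx : ∀ t ∈ Icc t₁ t₂, x t = x t₁ + ∫ s in t₁..t, w s)
    (hS : ∀ t ∈ Icc t₁ t₂, x t ∈ S) (hL : LipschitzOnWith K φ S)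
    (hφ : ∀ y ∈ S, HasDerivAt φ (φ' y) y) :
    IntervalIntegrable (fun t => Real.exp (-ρ * t) * (φ' (x t) * w t - ρ * φ (x t)))
      volume t₁ t₂ ∧
    ∫ t in t₁..t₂, Real.exp (-ρ * t) * (φ' (x t) * w t - ρ * φ (x t)) =
      Real.exp (-ρ * t₂) * φ (x t₂) - Real.exp (-ρ * t₁) * φ (x t₁) := by
  have huIcc : uIcc t₁ t₂ = Icc t₁ t₂ := uIcc_of_le h12
  have hX : AbsolutelyContinuousOnInterval (fun t => ∫ s in t₁..t, w s) t₁ t₂ :=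
    hw.absolutelyContinuousOnInterval_intervalIntegral left_mem_uIcc
  have hF : AbsolutelyContinuousOnInterval (fun t => φ (x t)) t₁ t₂ := by
    rw [absolutelyContinuousOnInterval_iff] at hX ⊢
    intro ε hε
    obtain ⟨δ, hδ, h⟩ := hX (ε / (K + 1)) (by positivity)
    refine ⟨δ, hδ, fun E hE hlen => ?_⟩
    have h1 := h E hE hlen
    calc ∑ i ∈ Finset.range E.1, dist (φ (x (E.2 i).1)) (φ (x (E.2 i).2))
        ≤ ∑ i ∈ Finset.range E.1, K * dist (∫ s in t₁..(E.2 i).1, w s)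
            (∫ s in t₁..(E.2 i).2, w s) := by
          refine Finset.sum_le_sum fun i hi => ?_
          have hm := hE.1 i hi
          rw [huIcc] at hm
          have := hL.dist_le_mul _ (hS _ hm.1) _ (hS _ hm.2)
          have e : dist (x (E.2 i).1) (x (E.2 i).2) = dist (∫ s in t₁..(E.2 i).1, w s)
              (∫ s in t₁..(E.2 i).2, w s) := by
            rw [hx _ hm.1, hx _ hm.2, dist_add_left]
          rwa [e] at this
      _ = K * ∑ i ∈ Finset.range E.1, dist (∫ s in t₁..(E.2 i).1, w s)
            (∫ s in t₁..(E.2 i).2, w s) := by rw [Finset.mul_sum]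
      _ ≤ K * (ε / (K + 1)) := by gcongr
      _ < (K + 1) * (ε / (K + 1)) := by gcongr; linarith
      _ = ε := by field_simp
  have hexp : AbsolutelyContinuousOnInterval (fun t => Real.exp (-ρ * t)) t₁ t₂ := by
    apply ContDiffOn.absolutelyContinuousOnInterval
    fun_prop
  have hG := hexp.fun_mul hF
  have hder : ∀ᵐ t, t ∈ uIoc t₁ t₂ →
      deriv (fun t => Real.exp (-ρ * t) * φ (x t)) t =
        Real.exp (-ρ * t) * (φ' (x t) * w t - ρ * φ (x t)) := by
    have h2 : ∀ᵐ t : ℝ, t ≠ t₂ := by simp [ae_iff, measure_singleton]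
    filter_upwards [hw.ae_hasDerivAt_integral, h2] with t ht ht2 hmem
    rw [uIoc_of_le h12] at hmem
    have hIoo : t ∈ Ioo t₁ t₂ := ⟨hmem.1, lt_of_le_of_ne hmem.2 ht2⟩
    have hIcc : t ∈ Icc t₁ t₂ := Ioo_subset_Icc_self hIoo
    have h3 := ht (by rw [huIcc]; exact hIcc) t₁ left_mem_uIcc
    have h4 : HasDerivAt x (w t) t := by
      refine (h3.const_add (x t₁)).congr_of_eventuallyEq ?_
      filter_upwards [Icc_mem_nhds hIoo.1 hIoo.2] with s hs using hx s hs
    have h5 := (hφ (x t) (hS t hIcc)).comp t h4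
    have he : HasDerivAt (fun t : ℝ => Real.exp (-ρ * t)) (Real.exp (-ρ * t) * (-ρ)) t := by
      simpa using ((hasDerivAt_id t).const_mul (-ρ)).exp
    have h6 := (he.mul h5).deriv
    refine Eq.trans ?_ (h6.trans ?_)
    · rfl
    · simp only [Function.comp]; ring
  constructor
  · exact (hG.intervalIntegrable_deriv).congr_ae
      ((ae_restrict_iff' measurableSet_uIoc).2 hder)
  · rw [← hG.integral_deriv_eq_sub]
    exact (intervalIntegral.integral_congr_ae hder).symm

theorem discounted_chain_rule_Icc {ρ t₁ t₂ α β : ℝ} {x w φ φ' : ℝ → ℝ}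
    (h12 : t₁ ≤ t₂) (hw : IntervalIntegrable w volume t₁ t₂)
    (hx : ∀ t ∈ Icc t₁ t₂, x t = x t₁ + ∫ s in t₁..t, w s)
    (hS : ∀ t ∈ Icc t₁ t₂, x t ∈ Icc α β)
    (hφ : ∀ y ∈ Icc α β, HasDerivAt φ (φ' y) y) (hφ' : ContinuousOn φ' (Icc α β)) :
    IntervalIntegrable (fun t => Real.exp (-ρ * t) * (φ' (x t) * w t - ρ * φ (x t)))
      volume t₁ t₂ ∧
    ∫ t in t₁..t₂, Real.exp (-ρ * t) * (φ' (x t) * w t - ρ * φ (x t)) =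
      Real.exp (-ρ * t₂) * φ (x t₂) - Real.exp (-ρ * t₁) * φ (x t₁) := by
  obtain ⟨C, hC⟩ := isCompact_Icc.exists_bound_of_continuousOn hφ'
  refine discounted_chain_rule (K := Real.toNNReal C) h12 hw hx hS ?_ hφ
  refine (convex_Icc α β).lipschitzOnWith_of_nnnorm_hasDerivWithin_le
    (fun y hy => (hφ y hy).hasDerivWithinAt) fun y hy => ?_
  rw [← NNReal.coe_le_coe, coe_nnnorm]
  exact (hC y hy).trans (Real.le_coe_toNNReal C)

theorem exists_last_time {f : ℝ → ℝ} {a b c : ℝ} (hab : a ≤ b) (hf : ContinuousOn f (Icc a b))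
    (ha : c ≤ f a) (hb : f b < c) :
    ∃ t ∈ Ico a b, f t = c ∧ ∀ s ∈ Ioc t b, f s < c := by
  have hcl : IsCompact (Icc a b ∩ f ⁻¹' Ici c) :=
    isCompact_Icc.of_isClosed_subset (hf.preimage_isClosed_of_isClosed isClosed_Icc isClosed_Ici)
      inter_subset_left
  obtain ⟨t, ht, hgr⟩ := hcl.exists_isGreatest ⟨a, left_mem_Icc.2 hab, ha⟩
  have hlast : ∀ s ∈ Ioc t b, f s < c := by
    intro s hs
    by_contra! hc
    exact absurd (hgr ⟨⟨ht.1.1.trans hs.1.le, hs.2⟩, hc⟩) (not_le.2 hs.1)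
  have htb : t < b := lt_of_le_of_ne ht.1.2 (fun h => by
    have := ht.2; rw [h] at this; exact absurd hb (not_lt.2 this))
  refine ⟨t, ⟨ht.1.1, htb⟩, le_antisymm ?_ ht.2, hlast⟩
  have h1 : Tendsto f (𝓝[Ioc t b] t) (𝓝 (f t)) :=
    (hf t ht.1).mono_left (nhdsWithin_mono _ fun s hs => ⟨ht.1.1.trans hs.1.le, hs.2⟩)
  have : (𝓝[Ioc t b] t).NeBot := by
    rw [nhdsWithin_Ioc_eq_nhdsGT htb]; infer_instance
  refine le_of_tendsto h1 ?_
  filter_upwards [self_mem_nhdsWithin] with s hs using (hlast s hs).le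

theorem exists_first_time {f : ℝ → ℝ} {a b c : ℝ} (hab : a ≤ b) (hf : ContinuousOn f (Icc a b))
    (ha : f a < c) (hb : c ≤ f b) :
    ∃ t ∈ Ioc a b, f t = c ∧ ∀ s ∈ Ico a t, f s < c := by
  have hf1 : ContinuousOn (fun s => f (-s)) (Icc (-b) (-a)) :=
    hf.comp continuous_neg.continuousOn fun s hs => ⟨by linarith [hs.2], by linarith [hs.1]⟩
  obtain ⟨s, hs, hfs, hlast⟩ := exists_last_time (f := fun s => f (-s)) (c := c)
    (neg_le_neg hab) hf1 (by simpa using hb) (by simpa using ha)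
  refine ⟨-s, ⟨by linarith [hs.2], by linarith [hs.1]⟩, hfs, fun w hw => ?_⟩
  have := hlast (-w) ⟨by linarith [hw.2], by linarith [hw.1]⟩
  simpa using this

/-- Take the last time at level x₂ and, after it, the first time at level x₁. -/
theorem exists_crossing {f : ℝ → ℝ} {a b x₁ x₂ : ℝ} (hab : a ≤ b) (hf : ContinuousOn f (Icc a b))
    (h12 : x₁ < x₂) (ha : x₂ ≤ f a) (hb : f b ≤ x₁) :
    ∃ t₁ t₂, a ≤ t₁ ∧ t₁ < t₂ ∧ t₂ ≤ b ∧ f t₁ = x₂ ∧ f t₂ = x₁ ∧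
      ∀ t ∈ Icc t₁ t₂, f t ∈ Icc x₁ x₂ := by
  obtain ⟨t₁, ht₁, hft₁, hlast⟩ := exists_last_time hab hf ha (hb.trans_lt h12)
  have hf1 : ContinuousOn (fun s => -f (-s)) (Icc (-b) (-t₁)) := by
    refine (hf.comp continuous_neg.continuousOn ?_).neg
    intro s hs
    exact ⟨by linarith [ht₁.1, hs.2], by linarith [hs.1]⟩
  obtain ⟨s, hs, hfs, hfirst⟩ := exists_last_time (f := fun s => -f (-s)) (c := -x₁)
    (neg_le_neg ht₁.2.le) hf1 (by simpa using hb) (by simp only [neg_neg, hft₁]; linarith)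
  refine ⟨t₁, -s, ht₁.1, by linarith [hs.2], by linarith [hs.1], hft₁, by linarith, ?_⟩
  intro t ht
  constructor
  · rcases ht.2.eq_or_lt with h | h
    · rw [h]; linarith
    · have := hfirst (-t) ⟨by linarith, by linarith [ht.1]⟩
      simp only [neg_neg] at this
      linarith
  · rcases ht.1.eq_or_lt with h | h
    · rw [← h, hft₁]
    · exact (hlast t ⟨h, by linarith [ht.2, hs.1]⟩).le

/-- A curve whose speed is at least `-C (x₀ - x)` below `x₀` cannot leave `x₀` downwards. -/
theorem not_lt_of_speed_ge {x w : ℝ → ℝ} {t₁ t₂ x₀ C : ℝ} (h12 : t₁ ≤ t₂)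
    (hC : 0 ≤ C) (hw : IntervalIntegrable w volume t₁ t₂)
    (hx : ∀ t ∈ Icc t₁ t₂, x t = x t₁ + ∫ s in t₁..t, w s)
    (h0 : x t₁ = x₀)
    (hsp : ∀ᵐ t, t ∈ Ioc t₁ t₂ → -(C * (x₀ - x t)) ≤ w t) : x₀ ≤ x t₂ := by
  have hc : ContinuousOn x (Icc t₁ t₂) := by
    have := intervalIntegral.continuousOn_primitive_interval' hw left_mem_uIcc
    rw [uIcc_of_le h12] at this
    exact (continuousOn_const.add this).congr hx
  have := nonpos_of_le_integral (y := fun t => x₀ - x t) (t₁ := t₁) (t₂ := t₂) (C := C)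
    (continuousOn_const.sub hc) hC ?_ t₂ (right_mem_Icc.2 h12)
  · linarith
  · intro t ht
    have hsub : uIcc t₁ t ⊆ uIcc t₁ t₂ := by
      rw [uIcc_of_le h12, uIcc_of_le ht.1]; exact Icc_subset_Icc_right ht.2
    have hi1 : IntervalIntegrable (fun s => C * (x₀ - x s)) volume t₁ t := by
      apply ContinuousOn.intervalIntegrable
      refine continuousOn_const.mul (continuousOn_const.sub (hc.mono ?_))
      rw [uIcc_of_le ht.1]; exact Icc_subset_Icc_right ht.2
    have hmono := intervalIntegral.integral_mono_ae_restrict (μ := volume)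
      ht.1 hi1.neg (hw.mono_set hsub) ?_
    · rw [hx t ht, h0]
      have h3 : ∫ s in t₁..t, (-fun s => C * (x₀ - x s)) s =
          -(C * ∫ s in t₁..t, (x₀ - x s)) := by
        simp only [Pi.neg_apply]
        rw [intervalIntegral.integral_neg, intervalIntegral.integral_const_mul]
      rw [h3] at hmono
      linarith
    · have h4 : ∀ᵐ s : ℝ, s ≠ t₁ := by simp [ae_iff, measure_singleton]
      refine (ae_restrict_iff' measurableSet_Icc).2 ?_
      filter_upwards [hsp, h4] with s hs hs4 hmem
      exact hs ⟨lt_of_le_of_ne hmem.1 (Ne.symm hs4), hmem.2.trans ht.2⟩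

/-! ### Elementary estimates for the logarithm -/

/-- Legendre duality for the logarithm, from ln s ≤ s - 1 at s = -pu. Strictness away from s = 1
makes the maximiser u = -1/p unique, which later identifies optimal controls. -/
theorem log_add_mul_le {p u : ℝ} (hp : p < 0) (hu : 0 < u) :
    Real.log u + p * u ≤ -Real.log (-p) - 1 := by
  have h := Real.log_le_sub_one_of_pos (mul_pos (neg_pos.2 hp) hu)
  rw [Real.log_mul (neg_pos.2 hp).ne' hu.ne'] at h
  linarith

theorem eq_of_log_add_mul_eq {p u : ℝ} (hp : p < 0) (hu : 0 < u)
    (h : Real.log u + p * u = -Real.log (-p) - 1) : u = -1 / p := by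
  by_contra hne
  have h1 : -p * u ≠ 1 := by
    intro h2
    apply hne
    rw [eq_div_iff hp.ne]
    linarith
  have h := Real.log_lt_sub_one_of_pos (mul_pos (neg_pos.2 hp) hu) h1
  rw [Real.log_mul (neg_pos.2 hp).ne' hu.ne'] at h
  linarith

/-- With a = √(1 + s), ln(1 + s) = 2 ln a ≤ 2(a - 1), so s - ln(1 + s) ≥ (a - 1)². -/
theorem sq_div_le_sub_log {s : ℝ} (hs : -1 < s) :
    s ^ 2 / (2 * (2 + s)) ≤ s - Real.log (1 + s) := by
  have h1 : 0 < 1 + s := by linarith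
  set a := √(1 + s) with ha
  have ha0 : 0 < a := Real.sqrt_pos.2 h1
  have ha2 : a ^ 2 = 1 + s := Real.sq_sqrt h1.le
  have hlog : Real.log (1 + s) = 2 * Real.log a := by
    rw [← ha2, Real.log_pow]; norm_num
  have h2 := Real.log_le_sub_one_of_pos ha0
  have hs' : s = a ^ 2 - 1 := by linarith
  have h3 : s ^ 2 / (2 * (2 + s)) ≤ (a - 1) ^ 2 := by
    rw [div_le_iff₀ (by linarith), hs']
    have : (a + 1) ^ 2 ≤ 2 * (2 + (a ^ 2 - 1)) := by nlinarith [sq_nonneg (a - 1)]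
    calc (a ^ 2 - 1) ^ 2 = (a - 1) ^ 2 * (a + 1) ^ 2 := by ring
      _ ≤ _ := mul_le_mul_of_nonneg_left this (sq_nonneg _)
  nlinarith

theorem sq_le_of_sub_log_eq {s D : ℝ} (hs : -1 < s) (h : s - Real.log (1 + s) = D) (hD : D ≤ 1) :
    s ^ 2 ≤ 12 * D := by
  have h1 := sq_div_le_sub_log hs
  rw [h, div_le_iff₀ (by linarith)] at h1
  have hD0 : 0 ≤ D := by
    by_contra! hc
    nlinarith [sq_nonneg s]
  -- From s² ≤ 4D + 2Ds, 2Ds ≤ s²/2 + 2D² and D² ≤ D.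
  nlinarith [sq_nonneg (s - 2 * D)]

/-! ### Discounted integrals -/

theorem frequently_lt_of_integrableOn_Ioi {f : ℝ → ℝ} (hf : IntegrableOn f (Ioi 0))
    {ε : ℝ} (hε : 0 < ε) : ∃ᶠ t in atTop, f t < ε := by
  intro hc
  simp only [not_lt] at hc
  obtain ⟨T, hT⟩ := eventually_atTop.1 hc
  have h1 : IntegrableOn f (Ioi (max T 0)) := hf.mono_set (Ioi_subset_Ioi (le_max_right _ _))
  have h2 : IntegrableOn (fun _ : ℝ => ε) (Ioi (max T 0)) := by
    refine Integrable.mono' h1 aestronglyMeasurable_const ?_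
    refine (ae_restrict_iff' measurableSet_Ioi).2 (Eventually.of_forall fun t ht => ?_)
    rw [Real.norm_of_nonneg hε.le]
    exact hT t ((le_max_left _ _).trans (mem_Ioi.1 ht).le)
  rw [integrableOn_const_iff] at h2
  · simp [hε.ne'] at h2

theorem integral_exp_interval {ρ : ℝ} (hρ : 0 < ρ) (t₁ t₂ : ℝ) :
    ∫ t in t₁..t₂, Real.exp (-ρ * t) = (Real.exp (-ρ * t₁) - Real.exp (-ρ * t₂)) / ρ := by
  rw [intervalIntegral.integral_eq_sub_of_hasDerivAt (f := fun t => -(Real.exp (-ρ * t) / ρ))]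
  · ring
  · intro t _
    have he : HasDerivAt (fun t : ℝ => Real.exp (-ρ * t)) (Real.exp (-ρ * t) * (-ρ)) t := by
      simpa using ((hasDerivAt_id t).const_mul (-ρ)).exp
    have := (he.div_const ρ).neg
    convert! this using 1
    field_simp
  · apply Continuous.intervalIntegrable; fun_prop

variable {b c ρ : ℝ} {r : ℝ → ℝ}

theorem intervalIntegrable_of_integrableOn_Ioi {f : ℝ → ℝ} (hf : IntegrableOn f (Ioi 0))
    {t₁ t₂ : ℝ} (h1 : 0 ≤ t₁) (h2 : 0 ≤ t₂) : IntervalIntegrable f volume t₁ t₂ :=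
  intervalIntegrable_iff.2 (hf.mono_set fun _ ht => (le_inf h1 h2).trans_lt ht.1)

/-! ### The recycling rate -/

/-- The autonomous part `r(x) - b x` of the state equation. -/
def drift (b : ℝ) (r : ℝ → ℝ) (x : ℝ) : ℝ := r x - b * x

/-- The maximised Hamiltonian `sup_u (ln u - c x² + p (u + r(x) - b x))` for `p < 0`. -/
def ham (b c : ℝ) (r : ℝ → ℝ) (x p : ℝ) : ℝ :=
  -Real.log (-p) - 1 - c * x ^ 2 + p * drift b r x

/-- The real-valued value function. -/
def valueReal (b c ρ : ℝ) (r : ℝ → ℝ) (x : ℝ) : ℝ := (value b c ρ r x).toReal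

namespace IsRecyclingRate

theorem continuousOn (hr : IsRecyclingRate b ρ r) : ContinuousOn r (Ici 0) :=
  hr.contDiffOn_one.continuousOn

theorem nonneg (hr : IsRecyclingRate b ρ r) {x : ℝ} (hx : 0 ≤ x) : 0 ≤ r x := by
  have := hr.monotoneOn (mem_Ici.2 le_rfl) (mem_Ici.2 hx) hx
  rwa [hr.map_zero] at this

theorem exists_bound (hr : IsRecyclingRate b ρ r) : ∃ a, 0 < a ∧ ∀ x, 0 ≤ x → r x ≤ a := by
  obtain ⟨a, -, ha, -⟩ := hr.limits
  refine ⟨max a 1, by positivity, fun x hx => le_max_of_le_left (ge_of_tendsto ha ?_)⟩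
  filter_upwards [eventually_ge_atTop x] with y hy
  exact hr.monotoneOn (mem_Ici.2 hx) (mem_Ici.2 (hx.trans hy)) hy

theorem contDiffAt (hr : IsRecyclingRate b ρ r) {x : ℝ} (hx : 0 < x) : ContDiffAt ℝ 2 r x :=
  hr.contDiffOn_two.contDiffAt (Ioi_mem_nhds hx)

theorem hasDerivAt (hr : IsRecyclingRate b ρ r) {x : ℝ} (hx : 0 < x) :
    HasDerivAt r (deriv r x) x :=
  ((hr.contDiffAt hx).differentiableAt (by norm_num)).hasDerivAt

theorem contDiffAt_deriv (hr : IsRecyclingRate b ρ r) {x : ℝ} (hx : 0 < x) :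
    ContDiffAt ℝ 1 (deriv r) x := by
  have h1 : ContDiffOn ℝ 1 (deriv r) (Ioi 0) :=
    ((contDiffOn_succ_iff_deriv_of_isOpen (n := 1) isOpen_Ioi).1
      (by simpa [one_add_one_eq_two] using hr.contDiffOn_two)).2.2
  exact h1.contDiffAt (Ioi_mem_nhds hx)

/-- The derivative is bounded: continuous on compact intervals, one-sided at 0, and tending to 0 at
infinity. -/
theorem exists_lipschitz (hr : IsRecyclingRate b ρ r) :
    ∃ L, 0 < L ∧ ∀ x y, 0 ≤ x → 0 ≤ y → |r x - r y| ≤ L * |x - y| := by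
  have hc : ContinuousOn (derivWithin r (Ici 0)) (Ici 0) :=
    hr.contDiffOn_one.continuousOn_derivWithin (uniqueDiffOn_Ici 0) le_rfl
  obtain ⟨M, hM⟩ := eventually_atTop.1
    (hr.deriv_tendsto.eventually (Metric.ball_mem_nhds 0 one_pos))
  obtain ⟨C, hC⟩ := (isCompact_Icc (a := 0) (b := max M 1)).exists_bound_of_continuousOn
    (hc.mono Icc_subset_Ici_self)
  have hbd : ∀ x ∈ Ici (0 : ℝ), ‖derivWithin r (Ici 0) x‖ ≤ max C 1 := by
    intro x hx
    rcases le_total x (max M 1) with h | h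
    · exact (hC x ⟨hx, h⟩).trans (le_max_left _ _)
    · have hx0 : 0 < x := lt_of_lt_of_le (by positivity) h
      rw [derivWithin_of_mem_nhds (Ici_mem_nhds hx0)]
      have := hM x ((le_max_left _ _).trans h)
      rw [dist_zero_right] at this
      exact this.le.trans (le_max_right _ _)
  refine ⟨max C 1, by positivity, fun x y hx hy => ?_⟩
  have := (convex_Ici (0 : ℝ)).norm_image_sub_le_of_norm_hasDerivWithin_le (f := r)
    (f' := derivWithin r (Ici 0)) (C := max C 1) (x := y) (y := x)
    (fun z hz => ((hr.contDiffOn_one.differentiableOn one_ne_zero) z hz).hasDerivWithinAt)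
    hbd hy hx
  simpa only [Real.norm_eq_abs] using this

theorem continuousOn_drift (hr : IsRecyclingRate b ρ r) : ContinuousOn (drift b r) (Ici 0) :=
  hr.continuousOn.sub (by fun_prop)

theorem hasDerivAt_drift (hr : IsRecyclingRate b ρ r) {x : ℝ} (hx : 0 < x) :
    HasDerivAt (drift b r) (deriv r x - b) x := by
  have := (hr.hasDerivAt hx).fun_sub ((hasDerivAt_id x).const_mul b)
  simp only [mul_one] at this
  exact this

theorem neg_le_drift (hr : IsRecyclingRate b ρ r) {x : ℝ} (hx : 0 ≤ x) :
    -(b * x) ≤ drift b r x := by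
  have := hr.nonneg hx
  simp only [drift]; linarith

theorem exists_lipschitz_drift (hb : 0 < b) (hr : IsRecyclingRate b ρ r) :
    ∃ L, 0 < L ∧ ∀ x y, 0 ≤ x → 0 ≤ y → |drift b r x - drift b r y| ≤ L * |x - y| := by
  obtain ⟨L, hL, h⟩ := hr.exists_lipschitz
  refine ⟨L + b, by positivity, fun x y hx hy => ?_⟩
  have h1 := h x y hx hy
  have : drift b r x - drift b r y = (r x - r y) - b * (x - y) := by simp only [drift]; ring
  rw [this]
  refine (abs_sub _ _).trans ?_
  rw [abs_mul, abs_of_pos hb]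
  linarith

end IsRecyclingRate

/-! ### Controls with integrable benefit -/

/-- A control `u` and its trajectory `x` from `x₀` for which all integrals are finite. -/
structure Run (b c ρ : ℝ) (r : ℝ → ℝ) (x₀ : ℝ) (u x : ℝ → ℝ) : Prop where
  pos : ∀ t, 0 ≤ t → 0 < u t
  locallyIntegrableOn : LocallyIntegrableOn u (Ici 0)
  trajectory : IsTrajectory b r x₀ u x
  integrableOn_log : IntegrableOn (fun t => Real.exp (-ρ * t) * Real.log (u t)) (Ioi 0)
  integrableOn_benefit : IntegrableOn (benefit c ρ u x) (Ioi 0)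

/-- The total benefit of a run. -/
def gain (c ρ : ℝ) (u x : ℝ → ℝ) : ℝ := ∫ t in Ioi 0, benefit c ρ u x t

/-- The velocity of a trajectory. -/
def velocity (b : ℝ) (r : ℝ → ℝ) (u x : ℝ → ℝ) (t : ℝ) : ℝ := u t - b * x t + r (x t)

theorem velocity_eq (b : ℝ) (r : ℝ → ℝ) (u x : ℝ → ℝ) (t : ℝ) :
    velocity b r u x t = u t + drift b r (x t) := by
  simp only [velocity, drift]; ring

theorem IsTrajectory.intervalIntegrable (hr : IsRecyclingRate b ρ r) {x₀ : ℝ} {u x : ℝ → ℝ}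
    (hu : LocallyIntegrableOn u (Ici 0)) (hx : IsTrajectory b r x₀ u x) {t₁ t₂ : ℝ}
    (h1 : 0 ≤ t₁) (h2 : 0 ≤ t₂) : IntervalIntegrable (velocity b r u x) volume t₁ t₂ := by
  have hsub : uIcc t₁ t₂ ⊆ Ici 0 := fun t ht => (le_inf h1 h2).trans ht.1
  have hu' : IntervalIntegrable u volume t₁ t₂ :=
    (hu.integrableOn_compact_subset hsub isCompact_uIcc).intervalIntegrable
  refine (hu'.sub ?_).add ?_
  · exact ((continuousOn_const.mul hx.1).mono hsub).intervalIntegrable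
  · refine ContinuousOn.intervalIntegrable ?_
    exact (hr.continuousOn.comp hx.1 (fun t ht => (hx.2 t ht).1)).mono hsub

theorem IsTrajectory.eq_add_integral (hr : IsRecyclingRate b ρ r) {x₀ : ℝ} {u x : ℝ → ℝ}
    (hu : LocallyIntegrableOn u (Ici 0)) (hx : IsTrajectory b r x₀ u x) {t₁ t : ℝ}
    (h1 : 0 ≤ t₁) (h2 : 0 ≤ t) : x t = x t₁ + ∫ s in t₁..t, velocity b r u x s := by
  rw [(hx.2 t h2).2, (hx.2 t₁ h1).2]
  have := intervalIntegral.integral_add_adjacent_intervals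
    (hx.intervalIntegrable hr hu le_rfl h1) (hx.intervalIntegrable hr hu h1 h2)
  simp only [velocity] at this ⊢
  linarith

theorem IsTrajectory.initial {x₀ : ℝ} {u x : ℝ → ℝ} (hx : IsTrajectory b r x₀ u x) :
    x 0 = x₀ := by
  have := (hx.2 0 le_rfl).2
  simpa using this

theorem aestronglyMeasurable_benefit {x₀ : ℝ} {u x : ℝ → ℝ}
    (hu : LocallyIntegrableOn u (Ici 0)) (hx : IsTrajectory b r x₀ u x) :
    AEStronglyMeasurable (benefit c ρ u x) (volume.restrict (Ioi 0)) := by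
  have h1 : AEStronglyMeasurable u (volume.restrict (Ioi 0)) :=
    hu.aestronglyMeasurable.mono_set Ioi_subset_Ici_self
  have h2 : AEStronglyMeasurable x (volume.restrict (Ioi 0)) :=
    (hx.1.mono Ioi_subset_Ici_self).aestronglyMeasurable measurableSet_Ioi
  have h3 : AEStronglyMeasurable (fun t : ℝ => Real.exp (-ρ * t)) (volume.restrict (Ioi 0)) :=
    (by fun_prop : Continuous fun t : ℝ => Real.exp (-ρ * t)).aestronglyMeasurable
  have h4 : AEStronglyMeasurable (fun t => Real.log (u t)) (volume.restrict (Ioi 0)) :=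
    (Real.measurable_log.comp_aemeasurable h1.aemeasurable).aestronglyMeasurable
  exact h3.mul (h4.sub ((h2.pow 2).const_mul c))

theorem aestronglyMeasurable_log {u : ℝ → ℝ} (hu : LocallyIntegrableOn u (Ici 0)) :
    AEStronglyMeasurable (fun t => Real.exp (-ρ * t) * Real.log (u t))
      (volume.restrict (Ioi 0)) := by
  have h1 : AEStronglyMeasurable u (volume.restrict (Ioi 0)) :=
    hu.aestronglyMeasurable.mono_set Ioi_subset_Ici_self
  have h3 : AEStronglyMeasurable (fun t : ℝ => Real.exp (-ρ * t)) (volume.restrict (Ioi 0)) :=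
    (by fun_prop : Continuous fun t : ℝ => Real.exp (-ρ * t)).aestronglyMeasurable
  exact h3.mul (Real.measurable_log.comp_aemeasurable h1.aemeasurable).aestronglyMeasurable

namespace Run

variable {x₀ : ℝ} {u x : ℝ → ℝ}

theorem isAdmissible (h : Run b c ρ r x₀ u x) : IsAdmissible ρ u := by
  refine ⟨h.pos, h.locallyIntegrableOn, ?_⟩
  refine lt_of_le_of_lt (lintegral_mono fun t => ?_) h.integrableOn_log.2
  exact Real.ofReal_le_enorm _

theorem totalBenefit_eq (h : Run b c ρ r x₀ u x) :
    totalBenefit c ρ u x = (gain c ρ u x : EReal) := by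
  have h1 := h.integrableOn_benefit
  have hp : ∫⁻ t in Ioi (0 : ℝ), ENNReal.ofReal (benefit c ρ u x t) ≠ ⊤ :=
    ((lintegral_mono fun t => Real.ofReal_le_enorm _).trans_lt h1.2).ne
  have hn : ∫⁻ t in Ioi (0 : ℝ), ENNReal.ofReal (-benefit c ρ u x t) ≠ ⊤ :=
    ((lintegral_mono fun t => Real.ofReal_le_enorm _).trans_lt h1.neg.2).ne
  rw [gain, integral_eq_lintegral_pos_part_sub_lintegral_neg_part h1, totalBenefit,
    EReal.coe_sub, EReal.coe_ennreal_toReal hp, EReal.coe_ennreal_toReal hn]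

theorem integrableOn_sq (hc : 0 < c) (h : Run b c ρ r x₀ u x) :
    IntegrableOn (fun t => Real.exp (-ρ * t) * x t ^ 2) (Ioi 0) := by
  refine ((h.integrableOn_log.sub h.integrableOn_benefit).const_mul (c⁻¹)).congr ?_
  refine Eventually.of_forall fun t => ?_
  simp only [benefit, Pi.sub_apply]
  field_simp
  ring

theorem continuousOn (h : Run b c ρ r x₀ u x) : ContinuousOn x (Ici 0) := h.trajectory.1

theorem nonneg (h : Run b c ρ r x₀ u x) {t : ℝ} (ht : 0 ≤ t) : 0 ≤ x t := (h.trajectory.2 t ht).1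

theorem initial (h : Run b c ρ r x₀ u x) : x 0 = x₀ := h.trajectory.initial

theorem intervalIntegrable_benefit (h : Run b c ρ r x₀ u x) {t₁ t₂ : ℝ} (h1 : 0 ≤ t₁)
    (h2 : 0 ≤ t₂) : IntervalIntegrable (benefit c ρ u x) volume t₁ t₂ :=
  intervalIntegrable_of_integrableOn_Ioi h.integrableOn_benefit h1 h2

theorem intervalIntegrable_velocity (hr : IsRecyclingRate b ρ r) (h : Run b c ρ r x₀ u x)
    {t₁ t₂ : ℝ} (h1 : 0 ≤ t₁) (h2 : 0 ≤ t₂) :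
    IntervalIntegrable (velocity b r u x) volume t₁ t₂ :=
  h.trajectory.intervalIntegrable hr h.locallyIntegrableOn h1 h2

theorem eq_add_integral (hr : IsRecyclingRate b ρ r) (h : Run b c ρ r x₀ u x)
    {t₁ t : ℝ} (h1 : 0 ≤ t₁) (h2 : 0 ≤ t) : x t = x t₁ + ∫ s in t₁..t, velocity b r u x s :=
  h.trajectory.eq_add_integral hr h.locallyIntegrableOn h1 h2

/-- Stands in for a transversality condition: integrability of e^{-ρt}(1 + x²) makes boundary terms
vanish along a sequence of times. -/
theorem frequently_small (hc : 0 < c) (hρ : 0 < ρ) (h : Run b c ρ r x₀ u x) {ε : ℝ} (hε : 0 < ε) :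
    ∃ᶠ T in atTop, Real.exp (-ρ * T) * (1 + x T ^ 2) < ε := by
  refine frequently_lt_of_integrableOn_Ioi ?_ hε
  have h1 : IntegrableOn (fun t : ℝ => Real.exp (-ρ * t)) (Ioi 0) := exp_neg_integrableOn_Ioi 0 hρ
  refine (h1.add (h.integrableOn_sq hc)).congr (Eventually.of_forall fun t => ?_)
  simp only [Pi.add_apply]; ring

/-- Since ln u ≤ u - 1 and u ≤ x' + bx, the benefit is controlled by e^{-ρt}(x' - ρx), a total
derivative, plus e^{-ρt}((ρ + b)x - cx²). Half of cx² absorbs the linear term, whose maximum is K;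
the other half stays on the left and bounds the total pollution of good runs. -/
theorem gain_add_le (hc : 0 < c) (hρ : 0 < ρ) (hr : IsRecyclingRate b ρ r)
    (h : Run b c ρ r x₀ u x) :
    gain c ρ u x + c / 2 * ∫ t in Ioi 0, Real.exp (-ρ * t) * x t ^ 2 ≤
      (ρ + b) ^ 2 / (2 * c) / ρ - x₀ := by
  set K := (ρ + b) ^ 2 / (2 * c) with hK
  have hsq := h.integrableOn_sq hc
  set f := fun t => benefit c ρ u x t + c / 2 * (Real.exp (-ρ * t) * x t ^ 2) with hf
  have hfi : IntegrableOn f (Ioi 0) := h.integrableOn_benefit.add (hsq.const_mul _)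
  have hint : ∫ t in Ioi 0, f t =
      gain c ρ u x + c / 2 * ∫ t in Ioi 0, Real.exp (-ρ * t) * x t ^ 2 := by
    rw [hf, integral_add h.integrableOn_benefit (hsq.const_mul _), integral_const_mul]
    rfl
  rw [← hint]
  have hfin : ∀ T, 0 ≤ T → ∫ t in (0 : ℝ)..T, f t ≤
      Real.exp (-ρ * T) * (1 + x T ^ 2) - x₀ + K / ρ := by
    intro T hT
    have hvi := h.intervalIntegrable_velocity hr le_rfl hT
    obtain ⟨hi, he⟩ := discounted_chain_rule (ρ := ρ) (S := univ) (φ := fun y => y)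
      (φ' := fun _ => 1) (K := 1) hT hvi
      (fun t ht => h.eq_add_integral hr le_rfl ht.1) (fun _ _ => mem_univ _)
      LipschitzWith.id.lipschitzOnWith (fun y _ => hasDerivAt_id y)
    have hexp : IntervalIntegrable (fun t => K * Real.exp (-ρ * t)) volume 0 T := by
      apply Continuous.intervalIntegrable; fun_prop
    have hle : ∫ t in (0 : ℝ)..T, f t ≤ ∫ t in (0 : ℝ)..T,
        (Real.exp (-ρ * t) * (1 * velocity b r u x t - ρ * x t) + K * Real.exp (-ρ * t)) := by
      refine intervalIntegral.integral_mono_on hT ?_ (hi.add hexp) fun t ht => ?_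
      · exact intervalIntegrable_of_integrableOn_Ioi hfi le_rfl hT
      · have hu := h.pos t ht.1
        have hl := Real.log_le_sub_one_of_pos hu
        have hr0 := hr.nonneg (h.nonneg ht.1)
        have hq : (ρ + b) * x t - c / 2 * x t ^ 2 ≤ K := by
          rw [hK, le_div_iff₀ (by positivity)]
          nlinarith [sq_nonneg (ρ + b - c * x t)]
        have hE := Real.exp_pos (-ρ * t)
        have : Real.log (u t) - c / 2 * x t ^ 2 ≤ velocity b r u x t - ρ * x t + K := by
          simp only [velocity]; linarith
        have := mul_le_mul_of_nonneg_left this hE.le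
        simp only [hf, benefit]
        nlinarith
    rw [intervalIntegral.integral_add hi hexp, he, intervalIntegral.integral_const_mul,
      integral_exp_interval hρ, h.initial] at hle
    refine hle.trans ?_
    have hE := Real.exp_pos (-ρ * T)
    have h1 : x T ≤ 1 + x T ^ 2 := by nlinarith [sq_nonneg (x T - 1)]
    have h2 := mul_le_mul_of_nonneg_left h1 hE.le
    have hKpos : 0 ≤ K := by rw [hK]; positivity
    have h3 : K * ((Real.exp (-ρ * 0) - Real.exp (-ρ * T)) / ρ) ≤ K / ρ := by
      rw [mul_div_assoc']
      apply div_le_div_of_nonneg_right _ hρ.le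
      simp only [mul_zero, Real.exp_zero]
      nlinarith
    simp only [mul_zero, Real.exp_zero] at h3 ⊢
    linarith
  refine le_of_forall_pos_le_add fun ε hε => ?_
  have hlim := intervalIntegral_tendsto_integral_Ioi 0 hfi tendsto_id
  obtain ⟨T, h1, h2, h3⟩ := ((h.frequently_small hc hρ (half_pos hε)).and_eventually
    ((hlim.eventually (lt_mem_nhds (sub_lt_self _ (half_pos hε)))).and
      (eventually_ge_atTop 0))).exists
  have := hfin T h3
  simp only [id] at h2
  linarith

/-- Pollution decays at rate at most b, so the derivative of e^{-ρt}x² is at least -(ρ +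
2b)e^{-ρt}x². This is the source of the quadratic decay of V. -/
theorem sq_le (hc : 0 < c) (hb : 0 < b) (hρ : 0 < ρ) (hr : IsRecyclingRate b ρ r)
    (h : Run b c ρ r x₀ u x) :
    x₀ ^ 2 ≤ (ρ + 2 * b) * ∫ t in Ioi 0, Real.exp (-ρ * t) * x t ^ 2 := by
  have hsq := h.integrableOn_sq hc
  have hfin : ∀ T, 0 ≤ T → x₀ ^ 2 ≤ Real.exp (-ρ * T) * (1 + x T ^ 2) +
      (ρ + 2 * b) * ∫ t in Ioi 0, Real.exp (-ρ * t) * x t ^ 2 := by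
    intro T hT
    have hvi := h.intervalIntegrable_velocity hr le_rfl hT
    obtain ⟨M, hM⟩ := (isCompact_Icc (a := 0) (b := T)).bddAbove_image
      (h.continuousOn.mono Icc_subset_Ici_self)
    obtain ⟨hi, he⟩ := discounted_chain_rule_Icc (ρ := ρ) (φ := fun y => y ^ 2)
      (φ' := fun y => 2 * y) (α := 0) (β := M) hT hvi
      (fun t ht => h.eq_add_integral hr le_rfl ht.1)
      (fun t ht => ⟨h.nonneg ht.1, hM (mem_image_of_mem x ht)⟩)
      (fun y _ => by simpa using hasDerivAt_pow 2 y) (by fun_prop)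
    have hi2 : IntervalIntegrable (fun t => -(ρ + 2 * b) * (Real.exp (-ρ * t) * x t ^ 2))
        volume 0 T := by
      exact intervalIntegrable_of_integrableOn_Ioi (hsq.const_mul (-(ρ + 2 * b))) le_rfl hT
    have hle := intervalIntegral.integral_mono_on hT hi2 hi fun t ht => by
      have hx0 := h.nonneg ht.1
      have hv : -(b * x t) ≤ velocity b r u x t := by
        rw [velocity_eq]
        linarith [hr.neg_le_drift hx0, h.pos t ht.1]
      have hE := Real.exp_pos (-ρ * t)
      have : -(ρ + 2 * b) * x t ^ 2 ≤ 2 * x t * velocity b r u x t - ρ * x t ^ 2 := by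
        nlinarith
      have := mul_le_mul_of_nonneg_left this hE.le
      linarith
    rw [he, intervalIntegral.integral_const_mul, h.initial] at hle
    have hmono : ∫ t in (0 : ℝ)..T, Real.exp (-ρ * t) * x t ^ 2 ≤
        ∫ t in Ioi 0, Real.exp (-ρ * t) * x t ^ 2 := by
      rw [intervalIntegral.integral_of_le hT]
      refine setIntegral_mono_set hsq (Eventually.of_forall fun t => by positivity)
        (Eventually.of_forall fun t ht => ht.1)
    have hE := Real.exp_pos (-ρ * T)
    simp only [mul_zero, Real.exp_zero] at hle
    nlinarith
  refine le_of_forall_pos_le_add fun ε hε => ?_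
  obtain ⟨T, h1, h3⟩ := ((h.frequently_small hc hρ hε).and_eventually
    (eventually_ge_atTop 0)).exists
  linarith [hfin T h3]

theorem gain_le (hc : 0 < c) (hρ : 0 < ρ) (hr : IsRecyclingRate b ρ r)
    (h : Run b c ρ r x₀ u x) : gain c ρ u x ≤ (ρ + b) ^ 2 / (2 * c) / ρ - x₀ := by
  have h1 := h.gain_add_le hc hρ hr
  have : 0 ≤ ∫ t in Ioi 0, Real.exp (-ρ * t) * x t ^ 2 := by
    apply integral_nonneg; intro t; positivity
  nlinarith

theorem gain_le_sub_sq (hc : 0 < c) (hb : 0 < b) (hρ : 0 < ρ) (hr : IsRecyclingRate b ρ r)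
    (hx₀ : 0 ≤ x₀) (h : Run b c ρ r x₀ u x) :
    gain c ρ u x ≤ (ρ + b) ^ 2 / (2 * c) / ρ - c / (2 * (ρ + 2 * b)) * x₀ ^ 2 := by
  have h1 := h.gain_add_le hc hρ hr
  have h2 := h.sq_le hc hb hρ hr
  have h3 : c / (2 * (ρ + 2 * b)) * x₀ ^ 2 ≤
      c / 2 * ∫ t in Ioi 0, Real.exp (-ρ * t) * x t ^ 2 := by
    calc c / (2 * (ρ + 2 * b)) * x₀ ^ 2 ≤ c / (2 * (ρ + 2 * b)) *
          ((ρ + 2 * b) * ∫ t in Ioi 0, Real.exp (-ρ * t) * x t ^ 2) := by gcongr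
      _ = _ := by field_simp
  linarith

end Run

/-! ### Shifting time -/

theorem integrableOn_Ioi_comp_add {f : ℝ → ℝ} {T : ℝ} :
    IntegrableOn (fun t => f (T + t)) (Ioi 0) ↔ IntegrableOn f (Ioi T) := by
  have h := (measurePreserving_add_left (volume : Measure ℝ) T).integrableOn_comp_preimage
    (f := f) (s := Ioi T) (measurableEmbedding_addLeft T)
  have e : (fun t : ℝ => T + t) ⁻¹' Ioi T = Ioi 0 := by ext t; simp
  rw [e] at h
  exact h

theorem setIntegral_Ioi_comp_add (f : ℝ → ℝ) (T : ℝ) :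
    ∫ t in Ioi 0, f (T + t) = ∫ t in Ioi T, f t := by
  have h := (measurePreserving_add_left (volume : Measure ℝ) T).setIntegral_preimage_emb
    (measurableEmbedding_addLeft T) f (Ioi T)
  have e : (fun t : ℝ => T + t) ⁻¹' Ioi T = Ioi 0 := by ext t; simp
  rw [e] at h
  exact h

theorem locallyIntegrableOn_Ici_iff {f : ℝ → ℝ} :
    LocallyIntegrableOn f (Ici 0) ↔ ∀ T, 0 ≤ T → IntegrableOn f (Ioc 0 T) := by
  constructor
  · intro h T hT
    exact (h.integrableOn_compact_subset Icc_subset_Ici_self isCompact_Icc).mono_set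
      Ioc_subset_Icc_self
  · intro h
    rw [locallyIntegrableOn_iff isClosed_Ici.isLocallyClosed]
    intro k hk hkc
    obtain ⟨M, hM⟩ := hkc.bddAbove
    have := h (max M 0) (le_max_right _ _)
    rw [← integrableOn_Icc_iff_integrableOn_Ioc] at this
    exact this.mono_set fun t ht => ⟨hk ht, (hM ht).trans (le_max_left _ _)⟩

theorem integral_Ioi_eq_add {f : ℝ → ℝ} {T : ℝ} (hT : 0 ≤ T) (hf : IntegrableOn f (Ioi 0)) :
    ∫ t in Ioi 0, f t = (∫ t in (0 : ℝ)..T, f t) + ∫ t in Ioi T, f t := by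
  rw [intervalIntegral.integral_of_le hT, ← setIntegral_union Ioc_disjoint_Ioi_same
    measurableSet_Ioi (hf.mono_set Ioc_subset_Ioi_self) (hf.mono_set (Ioi_subset_Ioi hT)),
    Ioc_union_Ioi_eq_Ioi hT]

theorem benefit_shift (u x : ℝ → ℝ) (T t : ℝ) :
    benefit c ρ (fun s => u (T + s)) (fun s => x (T + s)) t =
      Real.exp (ρ * T) * benefit c ρ u x (T + t) := by
  simp only [benefit]
  rw [← mul_assoc, ← Real.exp_add]
  ring_nf

namespace Run

variable {x₀ : ℝ} {u x : ℝ → ℝ}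

theorem tail (hr : IsRecyclingRate b ρ r) (h : Run b c ρ r x₀ u x) {T : ℝ} (hT : 0 ≤ T) :
    Run b c ρ r (x T) (fun t => u (T + t)) (fun t => x (T + t)) where
  pos t ht := h.pos _ (add_nonneg hT ht)
  locallyIntegrableOn := by
    rw [locallyIntegrableOn_Ici_iff]
    intro S hS
    have h1 : IntervalIntegrable u volume T (T + S) :=
      (h.locallyIntegrableOn.integrableOn_compact_subset
        (fun t ht => (le_inf hT (by linarith)).trans ht.1) isCompact_uIcc).intervalIntegrable
    have h2 := h1.comp_add_left T
    simp only [sub_self, add_sub_cancel_left] at h2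
    exact (intervalIntegrable_iff_integrableOn_Ioc_of_le hS).1 h2
  trajectory := by
    refine ⟨h.continuousOn.comp (by fun_prop) (fun t ht => add_nonneg hT ht), fun t ht => ?_⟩
    refine ⟨h.nonneg (add_nonneg hT ht), ?_⟩
    have := h.eq_add_integral hr hT (add_nonneg hT ht)
    have e := intervalIntegral.integral_comp_add_left (a := 0) (b := t) (velocity b r u x) T
    rw [add_zero] at e
    change x (T + t) = _
    rw [this, ← e]
    rfl
  integrableOn_log := by
    have h1 : IntegrableOn (fun t => Real.exp (ρ * T) *
        (Real.exp (-ρ * (T + t)) * Real.log (u (T + t)))) (Ioi 0) :=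
      ((integrableOn_Ioi_comp_add (f := fun t => Real.exp (-ρ * t) * Real.log (u t))).2
        (h.integrableOn_log.mono_set (Ioi_subset_Ioi hT))).const_mul _
    refine h1.congr (Eventually.of_forall fun t => ?_)
    simp only
    rw [← mul_assoc, ← Real.exp_add]
    ring_nf
  integrableOn_benefit := by
    have h1 := ((integrableOn_Ioi_comp_add (f := benefit c ρ u x)).2
        (h.integrableOn_benefit.mono_set (Ioi_subset_Ioi hT))).const_mul (Real.exp (ρ * T))
    exact h1.congr (Eventually.of_forall fun t => (benefit_shift u x T t).symm)

theorem gain_eq_add_tail (h : Run b c ρ r x₀ u x) {T : ℝ} (hT : 0 ≤ T) :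
    gain c ρ u x = (∫ t in (0 : ℝ)..T, benefit c ρ u x t) +
      Real.exp (-ρ * T) * gain c ρ (fun t => u (T + t)) (fun t => x (T + t)) := by
  rw [gain, integral_Ioi_eq_add hT h.integrableOn_benefit, gain,
    ← setIntegral_Ioi_comp_add, ← integral_const_mul]
  congr 1
  refine integral_congr_ae (Eventually.of_forall fun t => ?_)
  simp only [benefit_shift]
  rw [← mul_assoc, ← Real.exp_add]
  simp

end Run

/-! ### The value function is real -/

/-- Prescribe x and solve the state equation for u. The velocity (a + 1)e^{εt} exceeds r by at least
1, so ln u ≥ 0. The rate ε = ρ/4 leaves e^{-ρt}(e^{εt})² = e^{-ρt/2}, which is integrable. -/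
theorem exists_run (hb : 0 < b) (hρ : 0 < ρ) (hr : IsRecyclingRate b ρ r)
    {x₀ : ℝ} (hx₀ : 0 ≤ x₀) : ∃ u x, Run b c ρ r x₀ u x := by
  obtain ⟨a, ha, hra⟩ := hr.exists_bound
  set ε := ρ / 4 with hε
  have hεpos : 0 < ε := by positivity
  set A := (a + 1) / ε with hA
  have hApos : 0 < A := by positivity
  have hεA : ε * A = a + 1 := by rw [hA]; field_simp
  set x := fun t : ℝ => x₀ + A * (Real.exp (ε * t) - 1) with hx
  set u := fun t : ℝ => (a + 1) * Real.exp (ε * t) - drift b r (x t) with hu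
  have hexp1 : ∀ t : ℝ, 0 ≤ t → 1 ≤ Real.exp (ε * t) := fun t ht =>
    Real.one_le_exp (by positivity)
  have hx0 : ∀ t, 0 ≤ t → 0 ≤ x t := fun t ht => by
    have := hexp1 t ht
    have : 0 ≤ A * (Real.exp (ε * t) - 1) := mul_nonneg hApos.le (by linarith)
    simp only [hx]; linarith
  have hxle : ∀ t, 0 ≤ t → x t ≤ (x₀ + A) * Real.exp (ε * t) := fun t ht => by
    have := hexp1 t ht
    simp only [hx]; nlinarith
  have hu1 : ∀ t, 0 ≤ t → 1 ≤ u t := fun t ht => by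
    have h1 := hexp1 t ht
    have h2 := hra (x t) (hx0 t ht)
    have h3 := mul_nonneg hb.le (hx0 t ht)
    simp only [hu, drift]
    nlinarith
  have hule : ∀ t, 0 ≤ t → u t ≤ (a + 1 + b * (x₀ + A)) * Real.exp (ε * t) := fun t ht => by
    have h2 := hr.neg_le_drift (hx0 t ht)
    have h3 := mul_le_mul_of_nonneg_left (hxle t ht) hb.le
    simp only [hu]
    nlinarith
  have hxc : Continuous x := by simp only [hx]; fun_prop
  have huc : ContinuousOn u (Ici 0) := by
    refine ContinuousOn.sub (by fun_prop) (hr.continuousOn_drift.comp hxc.continuousOn ?_)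
    exact fun t ht => hx0 t ht
  have hder : ∀ t, HasDerivAt x ((a + 1) * Real.exp (ε * t)) t := fun t => by
    have he : HasDerivAt (fun t : ℝ => Real.exp (ε * t)) (Real.exp (ε * t) * ε) t := by
      simpa using ((hasDerivAt_id t).const_mul ε).exp
    have := ((he.sub_const 1).const_mul A).const_add x₀
    convert! this using 1
    rw [← hεA]; ring
  have htraj : IsTrajectory b r x₀ u x := by
    refine ⟨hxc.continuousOn, fun t ht => ⟨hx0 t ht, ?_⟩⟩
    have h1 : ∫ s in (0 : ℝ)..t, (u s - b * x s + r (x s)) =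
        ∫ s in (0 : ℝ)..t, (a + 1) * Real.exp (ε * s) := by
      congr 1; ext s; simp only [hu, drift]; ring
    rw [h1, intervalIntegral.integral_eq_sub_of_hasDerivAt (fun s _ => hder s)
      (Continuous.intervalIntegrable (by fun_prop) _ _)]
    simp [hx]
  have hloc : LocallyIntegrableOn u (Ici 0) := huc.locallyIntegrableOn measurableSet_Ici
  have hdom : IntegrableOn (fun t : ℝ => Real.exp (-(ρ / 2) * t)) (Ioi 0) :=
    exp_neg_integrableOn_Ioi 0 (by positivity)
  have hee : ∀ t : ℝ, Real.exp (-ρ * t) * (Real.exp (ε * t)) ^ 2 = Real.exp (-(ρ / 2) * t) := by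
    intro t
    rw [sq, ← Real.exp_add, ← Real.exp_add]
    congr 1; rw [hε]; ring
  have hlogle : ∀ t, 0 ≤ t → Real.log (u t) ≤ (a + 1 + b * (x₀ + A)) * (Real.exp (ε * t)) ^ 2 := by
    intro t ht
    have h1 := Real.log_le_sub_one_of_pos (one_pos.trans_le (hu1 t ht))
    have h2 := hule t ht
    have h3 := hexp1 t ht
    have h4 : 0 ≤ a + 1 + b * (x₀ + A) := by positivity
    nlinarith [mul_nonneg h4 (mul_nonneg (by linarith : (0 : ℝ) ≤ Real.exp (ε * t))
      (by linarith : (0 : ℝ) ≤ Real.exp (ε * t) - 1))]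
  have hlogi : IntegrableOn (fun t => Real.exp (-ρ * t) * Real.log (u t)) (Ioi 0) := by
    refine Integrable.mono' (hdom.const_mul (a + 1 + b * (x₀ + A)))
      (aestronglyMeasurable_log hloc) ?_
    refine (ae_restrict_iff' measurableSet_Ioi).2 (Eventually.of_forall fun t ht => ?_)
    have ht0 : 0 ≤ t := (mem_Ioi.1 ht).le
    have hl0 := Real.log_nonneg (hu1 t ht0)
    rw [Real.norm_of_nonneg (by positivity), ← hee]
    have := mul_le_mul_of_nonneg_left (hlogle t ht0) (Real.exp_pos (-ρ * t)).le
    linarith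
  have hsqi : IntegrableOn (fun t => Real.exp (-ρ * t) * (c * x t ^ 2)) (Ioi 0) := by
    refine Integrable.mono' (hdom.const_mul (|c| * (x₀ + A) ^ 2)) ?_ ?_
    · exact (by fun_prop : Continuous fun t : ℝ =>
        Real.exp (-ρ * t) * (c * x t ^ 2)).aestronglyMeasurable
    refine (ae_restrict_iff' measurableSet_Ioi).2 (Eventually.of_forall fun t ht => ?_)
    have ht0 : 0 ≤ t := (mem_Ioi.1 ht).le
    rw [norm_mul, norm_mul, Real.norm_of_nonneg (Real.exp_pos _).le, Real.norm_eq_abs,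
      Real.norm_of_nonneg (sq_nonneg _), ← hee]
    have h1 : x t ^ 2 ≤ ((x₀ + A) * Real.exp (ε * t)) ^ 2 :=
      pow_le_pow_left₀ (hx0 t ht0) (hxle t ht0) 2
    calc Real.exp (-ρ * t) * (|c| * x t ^ 2)
        ≤ Real.exp (-ρ * t) * (|c| * ((x₀ + A) * Real.exp (ε * t)) ^ 2) := by gcongr
      _ = _ := by ring
  refine ⟨u, x, fun t ht => one_pos.trans_le (hu1 t ht), hloc, htraj, hlogi, ?_⟩
  refine (hlogi.sub hsqi).congr (Eventually.of_forall fun t => ?_)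
  simp only [benefit, Pi.sub_apply]; ring

/-- The benefit is at most the discounted logarithm, so admissibility bounds its positive part. If
the negative part is finite too, it also dominates the negative part of the logarithm. -/
theorem IsAdmissible.run_or_totalBenefit_eq_bot (hc : 0 < c) {x₀ : ℝ}
    {u x : ℝ → ℝ} (hu : IsAdmissible ρ u) (hx : IsTrajectory b r x₀ u x) :
    Run b c ρ r x₀ u x ∨ totalBenefit c ρ u x = ⊥ := by
  have hle : ∀ t, benefit c ρ u x t ≤ Real.exp (-ρ * t) * Real.log (u t) := fun t => by
    have := mul_nonneg (Real.exp_pos (-ρ * t)).le (mul_nonneg hc.le (sq_nonneg (x t)))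
    simp only [benefit]; linarith
  have hpos : ∫⁻ t in Ioi (0 : ℝ), ENNReal.ofReal (benefit c ρ u x t) ≠ ⊤ :=
    ((lintegral_mono fun t => ENNReal.ofReal_le_ofReal (hle t)).trans_lt hu.2.2).ne
  by_cases hn : ∫⁻ t in Ioi (0 : ℝ), ENNReal.ofReal (-benefit c ρ u x t) = ⊤
  · right
    rw [totalBenefit, hn, EReal.coe_ennreal_top]
    exact EReal.sub_top _
  · left
    have hm := aestronglyMeasurable_benefit (c := c) (ρ := ρ) hu.2.1 hx
    have hB : IntegrableOn (benefit c ρ u x) (Ioi 0) := by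
      refine ⟨hm, ?_⟩
      rw [hasFiniteIntegral_iff_norm]
      have : ∀ t, ENNReal.ofReal ‖benefit c ρ u x t‖ ≤
          ENNReal.ofReal (benefit c ρ u x t) + ENNReal.ofReal (-benefit c ρ u x t) := by
        intro t
        rw [Real.norm_eq_abs]
        rcases abs_choice (benefit c ρ u x t) with h | h <;> rw [h]
        · exact le_self_add
        · exact le_add_self
      refine (lintegral_mono this).trans_lt ?_
      rw [lintegral_add_left' hm.aemeasurable.ennreal_ofReal]
      exact ENNReal.add_lt_top.2 ⟨hpos.lt_top, lt_top_iff_ne_top.2 hn⟩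
    refine ⟨hu.1, hu.2.1, hx, ⟨aestronglyMeasurable_log hu.2.1, ?_⟩, hB⟩
    rw [hasFiniteIntegral_iff_norm]
    have : ∀ t, ENNReal.ofReal ‖Real.exp (-ρ * t) * Real.log (u t)‖ ≤
        ENNReal.ofReal (Real.exp (-ρ * t) * Real.log (u t)) +
          ENNReal.ofReal (-benefit c ρ u x t) := by
      intro t
      rw [Real.norm_eq_abs]
      rcases abs_choice (Real.exp (-ρ * t) * Real.log (u t)) with h | h <;> rw [h]
      · exact le_self_add
      · exact le_add_left (ENNReal.ofReal_le_ofReal (neg_le_neg (hle t)))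
    refine (lintegral_mono this).trans_lt ?_
    have hm' : AEMeasurable (fun t => -benefit c ρ u x t) (volume.restrict (Ioi 0)) :=
      hm.aemeasurable.neg
    rw [lintegral_add_right' _ hm'.ennreal_ofReal]
    exact ENNReal.add_lt_top.2 ⟨hu.2.2, lt_top_iff_ne_top.2 hn⟩

theorem value_le (hc : 0 < c) (hρ : 0 < ρ) (hr : IsRecyclingRate b ρ r) {x₀ : ℝ} :
    value b c ρ r x₀ ≤ (((ρ + b) ^ 2 / (2 * c) / ρ - x₀ : ℝ) : EReal) := by
  refine sSup_le ?_
  rintro J ⟨u, x, hu, hx, rfl⟩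
  rcases hu.run_or_totalBenefit_eq_bot (c := c) hc hx with h | h
  · rw [h.totalBenefit_eq]
    exact EReal.coe_le_coe_iff.2 (h.gain_le hc hρ hr)
  · rw [h]; exact bot_le

theorem value_ne_top (hc : 0 < c) (hρ : 0 < ρ) (hr : IsRecyclingRate b ρ r) (x₀ : ℝ) :
    value b c ρ r x₀ ≠ ⊤ :=
  ((value_le hc hρ hr).trans_lt (EReal.coe_lt_top _)).ne

theorem Run.le_value {x₀ : ℝ} {u x : ℝ → ℝ} (h : Run b c ρ r x₀ u x) :
    (gain c ρ u x : EReal) ≤ value b c ρ r x₀ :=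
  le_sSup ⟨u, x, h.isAdmissible, h.trajectory, h.totalBenefit_eq.symm⟩

theorem value_ne_bot (hb : 0 < b) (hρ : 0 < ρ) (hr : IsRecyclingRate b ρ r) {x₀ : ℝ}
    (hx₀ : 0 ≤ x₀) : value b c ρ r x₀ ≠ ⊥ := by
  obtain ⟨u, x, h⟩ := exists_run (c := c) hb hρ hr hx₀
  exact ((EReal.bot_lt_coe _).trans_le h.le_value).ne'

theorem coe_valueReal (hb : 0 < b) (hc : 0 < c) (hρ : 0 < ρ) (hr : IsRecyclingRate b ρ r) {x₀ : ℝ}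
    (hx₀ : 0 ≤ x₀) : (valueReal b c ρ r x₀ : EReal) = value b c ρ r x₀ :=
  EReal.coe_toReal (value_ne_top hc hρ hr x₀) (value_ne_bot hb hρ hr hx₀)

theorem Run.gain_le_valueReal (hb : 0 < b) (hc : 0 < c) (hρ : 0 < ρ) (hr : IsRecyclingRate b ρ r)
    {x₀ : ℝ} {u x : ℝ → ℝ} (h : Run b c ρ r x₀ u x) : gain c ρ u x ≤ valueReal b c ρ r x₀ := by
  have hx₀ : 0 ≤ x₀ := by
    rw [← h.initial]; exact h.nonneg le_rfl
  have := h.le_value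
  rw [← coe_valueReal hb hc hρ hr hx₀] at this
  exact EReal.coe_le_coe_iff.1 this

theorem exists_run_gain_gt (hb : 0 < b) (hc : 0 < c) (hρ : 0 < ρ) (hr : IsRecyclingRate b ρ r)
    {x₀ m : ℝ} (hx₀ : 0 ≤ x₀) (hm : m < valueReal b c ρ r x₀) :
    ∃ u x, Run b c ρ r x₀ u x ∧ m < gain c ρ u x := by
  have h : (m : EReal) < value b c ρ r x₀ := by
    rw [← coe_valueReal hb hc hρ hr hx₀]; exact EReal.coe_lt_coe_iff.2 hm
  obtain ⟨J, ⟨u, x, hu, hx, rfl⟩, hJ⟩ := lt_sSup_iff.1 h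
  rcases hu.run_or_totalBenefit_eq_bot (c := c) hc hx with h | h
  · exact ⟨u, x, h, by rw [h.totalBenefit_eq] at hJ; exact EReal.coe_lt_coe_iff.1 hJ⟩
  · rw [h] at hJ; exact absurd hJ not_lt_bot

theorem IsOptimal.run_and_gain_eq (hb : 0 < b) (hc : 0 < c) (hρ : 0 < ρ)
    (hr : IsRecyclingRate b ρ r) {x₀ : ℝ} (hx₀ : 0 ≤ x₀) {u x : ℝ → ℝ}
    (h : IsOptimal b c ρ r x₀ u x) :
    Run b c ρ r x₀ u x ∧ gain c ρ u x = valueReal b c ρ r x₀ := by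
  obtain ⟨hu, hx, hv⟩ := h
  rcases hu.run_or_totalBenefit_eq_bot (c := c) hc hx with h | h
  · refine ⟨h, ?_⟩
    rw [h.totalBenefit_eq, ← coe_valueReal hb hc hρ hr hx₀] at hv
    exact EReal.coe_eq_coe_iff.1 hv
  · rw [h] at hv; exact absurd hv.symm (value_ne_bot hb hρ hr hx₀)

theorem valueReal_le_sub_sq (hb : 0 < b) (hc : 0 < c) (hρ : 0 < ρ) (hr : IsRecyclingRate b ρ r)
    {x₀ : ℝ} (hx₀ : 0 ≤ x₀) :
    valueReal b c ρ r x₀ ≤ (ρ + b) ^ 2 / (2 * c) / ρ - c / (2 * (ρ + 2 * b)) * x₀ ^ 2 := by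
  by_contra! hlt
  obtain ⟨u, x, h, h1⟩ := exists_run_gain_gt hb hc hρ hr hx₀ hlt
  linarith [h.gain_le_sub_sq hc hb hρ hr hx₀]

/-! ### Dynamic programming -/

/-- A control `u` and its trajectory `x` from `x₀` on the time interval `[0, T]`. -/
structure RunOn (b c ρ : ℝ) (r : ℝ → ℝ) (x₀ T : ℝ) (u x : ℝ → ℝ) : Prop where
  pos : ∀ t ∈ Icc 0 T, 0 < u t
  integrableOn : IntegrableOn u (Ioc 0 T)
  continuousOn : ContinuousOn x (Icc 0 T)
  nonneg : ∀ t ∈ Icc 0 T, 0 ≤ x t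
  eq_add_integral : ∀ t ∈ Icc 0 T, x t = x₀ + ∫ s in (0 : ℝ)..t, (u s - b * x s + r (x s))
  integrableOn_log : IntegrableOn (fun t => Real.exp (-ρ * t) * Real.log (u t)) (Ioc 0 T)
  integrableOn_benefit : IntegrableOn (benefit c ρ u x) (Ioc 0 T)

theorem Run.runOn {x₀ T : ℝ} {u x : ℝ → ℝ} (h : Run b c ρ r x₀ u x) (hT : 0 ≤ T) :
    RunOn b c ρ r x₀ T u x where
  pos t ht := h.pos t ht.1
  integrableOn := locallyIntegrableOn_Ici_iff.1 h.locallyIntegrableOn T hT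
  continuousOn := h.continuousOn.mono Icc_subset_Ici_self
  nonneg _ ht := h.nonneg ht.1
  eq_add_integral _ ht := (h.trajectory.2 _ ht.1).2
  integrableOn_log := h.integrableOn_log.mono_set Ioc_subset_Ioi_self
  integrableOn_benefit := h.integrableOn_benefit.mono_set Ioc_subset_Ioi_self

/-- Dynamic programming inequality: follow the given control up to T, then a nearly optimal run from
y₀ T. -/
theorem RunOn.add_valueReal_le (hb : 0 < b) (hc : 0 < c) (hρ : 0 < ρ)
    (hr : IsRecyclingRate b ρ r) {x₀ T : ℝ} {u₀ y₀ : ℝ → ℝ} (hT : 0 ≤ T)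
    (h₀ : RunOn b c ρ r x₀ T u₀ y₀) :
    (∫ t in (0 : ℝ)..T, benefit c ρ u₀ y₀ t) + Real.exp (-ρ * T) * valueReal b c ρ r (y₀ T) ≤
      valueReal b c ρ r x₀ := by
  have hTm : T ∈ Icc 0 T := right_mem_Icc.2 hT
  have key : ∀ u x, Run b c ρ r (y₀ T) u x → (∫ t in (0 : ℝ)..T, benefit c ρ u₀ y₀ t) +
      Real.exp (-ρ * T) * gain c ρ u x ≤ valueReal b c ρ r x₀ := by
    intro u x h
    -- At the junction the control is taken from the first piece, so `hu2` needs t > 0; the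
    -- trajectories agree there, so `hx2` includes t = 0.
    set u' : ℝ → ℝ := fun t => if t ≤ T then u₀ t else u (t - T) with hu'
    set x' : ℝ → ℝ := fun t => if t ≤ T then y₀ t else x (t - T) with hx'
    have hu1 : ∀ t ≤ T, u' t = u₀ t := fun t ht => by simp [hu', ht]
    have hu2 : ∀ t, 0 < t → u' (T + t) = u t := fun t ht => by simp [hu', ht]
    have hx1 : ∀ t ≤ T, x' t = y₀ t := fun t ht => by simp [hx', ht]
    have hx2 : ∀ t, 0 ≤ t → x' (T + t) = x t := fun t ht => by
      rcases ht.eq_or_lt with h0 | h0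
      · simp [← h0, hx', h.initial]
      · simp [hx', h0]
    have hshift : ∀ {f : ℝ → ℝ} {F : ℝ → ℝ} {k : ℝ}, IntegrableOn F (Ioi 0) →
        (∀ t, 0 < t → f (T + t) = k * F t) → IntegrableOn f (Ioc 0 T) →
        IntegrableOn f (Ioi 0) := by
      intro f F k hF hfF hfc
      rw [← Ioc_union_Ioi_eq_Ioi hT]
      refine IntegrableOn.union hfc ?_
      refine integrableOn_Ioi_comp_add.1 ((hF.const_mul k).congr ?_)
      refine (ae_restrict_iff' measurableSet_Ioi).2 (Eventually.of_forall fun t ht => ?_)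
      exact (hfF t ht).symm
    have hexpT : ∀ t, Real.exp (-ρ * (T + t)) = Real.exp (-ρ * T) * Real.exp (-ρ * t) := by
      intro t; rw [← Real.exp_add]; ring_nf
    have hb2 : ∀ t, 0 < t → benefit c ρ u' x' (T + t) = Real.exp (-ρ * T) * benefit c ρ u x t := by
      intro t ht
      simp only [benefit, hu2 t ht, hx2 t ht.le, hexpT]; ring
    have hb1 : ∀ t ≤ T, benefit c ρ u' x' t = benefit c ρ u₀ y₀ t := by
      intro t ht
      simp only [benefit, hu1 t ht, hx1 t ht]
    have hxc : ContinuousOn x' (Ici 0) := by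
      have e : Ici (0 : ℝ) = Icc 0 T ∪ Ici T := (Icc_union_Ici_eq_Ici hT).symm
      rw [e]
      refine ContinuousOn.union_of_isClosed ?_ ?_ isClosed_Icc isClosed_Ici
      · exact h₀.continuousOn.congr fun t ht => hx1 t ht.2
      · have : ContinuousOn (fun t => x (t - T)) (Ici T) :=
          h.continuousOn.comp (by fun_prop) (fun t ht => mem_Ici.2 (sub_nonneg.2 ht))
        refine this.congr fun t ht => ?_
        have := hx2 (t - T) (sub_nonneg.2 ht)
        rwa [add_sub_cancel] at this
    have hloc : LocallyIntegrableOn u' (Ici 0) := by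
      rw [locallyIntegrableOn_Ici_iff]
      intro S hS
      have h1 : IntegrableOn u' (Ioc 0 T) :=
        h₀.integrableOn.congr_fun (fun t ht => (hu1 t ht.2).symm) measurableSet_Ioc
      have h2 : IntegrableOn u' (Ioc T (T + S)) := by
        have h3 : IntervalIntegrable u volume 0 S :=
          (intervalIntegrable_iff_integrableOn_Ioc_of_le hS).2
            (locallyIntegrableOn_Ici_iff.1 h.locallyIntegrableOn S hS)
        have h4 := h3.comp_sub_right T
        rw [zero_add, add_comm S T] at h4
        refine IntegrableOn.congr_fun ((intervalIntegrable_iff_integrableOn_Ioc_of_le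
          (by linarith)).1 h4) (fun t ht => ?_) measurableSet_Ioc
        have := hu2 (t - T) (sub_pos.2 ht.1)
        rw [add_sub_cancel] at this
        exact this.symm
      refine (h1.union h2).mono_set ?_
      rw [Ioc_union_Ioc_eq_Ioc hT (by linarith)]
      exact Ioc_subset_Ioc_right (by linarith)
    have hx0' : ∀ t, 0 ≤ t → 0 ≤ x' t := by
      intro t ht
      rcases le_or_gt t T with h1 | h1
      · rw [hx1 t h1]; exact h₀.nonneg t ⟨ht, h1⟩
      · have := hx2 (t - T) (by linarith)
        rw [add_sub_cancel] at this
        rw [this]; exact h.nonneg (by linarith)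
    have hi1 : ∀ t, 0 ≤ t → t ≤ T →
        x₀ + ∫ s in (0 : ℝ)..t, (u' s - b * x' s + r (x' s)) = y₀ t := by
      intro t ht0 ht1
      rw [h₀.eq_add_integral t ⟨ht0, ht1⟩]
      congr 1
      refine intervalIntegral.integral_congr fun s hs => ?_
      rw [uIcc_of_le ht0] at hs
      simp only [hu1 s (hs.2.trans ht1), hx1 s (hs.2.trans ht1)]
    have hvel : ∀ S, 0 ≤ S → IntervalIntegrable (fun s => u' s - b * x' s + r (x' s)) volume 0 S := by
      intro S hS
      have hsub : uIcc 0 S ⊆ Ici 0 := by rw [uIcc_of_le hS]; exact Icc_subset_Ici_self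
      have hu'' : IntervalIntegrable u' volume 0 S :=
        (hloc.integrableOn_compact_subset hsub isCompact_uIcc).intervalIntegrable
      refine (hu''.sub ?_).add ?_
      · exact ((continuousOn_const.mul hxc).mono hsub).intervalIntegrable
      · exact ContinuousOn.intervalIntegrable
          ((hr.continuousOn.comp hxc (fun t ht => hx0' t ht)).mono hsub)
    have htraj : IsTrajectory b r x₀ u' x' := by
      refine ⟨hxc, fun t ht => ⟨hx0' t ht, ?_⟩⟩
      rcases le_or_gt t T with h1 | h1
      · rw [hx1 t h1, hi1 t ht h1]
      · have e0 : T + (t - T) = t := by ring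
        have e1 := hx2 (t - T) (by linarith)
        rw [e0] at e1
        have e2 := (h.trajectory.2 (t - T) (by linarith)).2
        have hsub : uIcc T t ⊆ uIcc 0 t := by
          rw [uIcc_of_le h1.le, uIcc_of_le ht]; exact Icc_subset_Icc_left hT
        rw [← intervalIntegral.integral_add_adjacent_intervals (hvel T hT)
          ((hvel t ht).mono_set hsub)]
        have e3 : ∫ s in T..t, (u' s - b * x' s + r (x' s)) =
            ∫ s in (0 : ℝ)..(t - T), (u s - b * x s + r (x s)) := by
          have := intervalIntegral.integral_comp_add_left (a := 0) (b := t - T)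
            (fun s => u' s - b * x' s + r (x' s)) T
          rw [add_zero, e0] at this
          rw [← this]
          refine intervalIntegral.integral_congr_ae (Eventually.of_forall fun s hs => ?_)
          rw [uIoc_of_le (by linarith)] at hs
          simp only [hu2 s hs.1, hx2 s hs.1.le]
        rw [e3, e1, e2, ← hi1 T hT le_rfl]; ring
    have hrun : Run b c ρ r x₀ u' x' := by
      refine ⟨?_, hloc, htraj, ?_, ?_⟩
      · intro t ht
        rcases le_or_gt t T with h1 | h1
        · rw [hu1 t h1]; exact h₀.pos t ⟨ht, h1⟩
        · have := hu2 (t - T) (by linarith)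
          rw [add_sub_cancel] at this
          rw [this]; exact h.pos _ (by linarith)
      · refine hshift (k := Real.exp (-ρ * T)) h.integrableOn_log (fun t ht => ?_) ?_
        · rw [hu2 t ht, hexpT]; ring
        · exact h₀.integrableOn_log.congr_fun
            (fun t ht => by simp only [hu1 t ht.2]) measurableSet_Ioc
      · exact hshift (k := Real.exp (-ρ * T)) h.integrableOn_benefit hb2
          (h₀.integrableOn_benefit.congr_fun (fun t ht => (hb1 t ht.2).symm) measurableSet_Ioc)
    have hg := hrun.gain_le_valueReal hb hc hρ hr
    have e4 : gain c ρ u' x' = (∫ t in (0 : ℝ)..T, benefit c ρ u₀ y₀ t) +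
        Real.exp (-ρ * T) * gain c ρ u x := by
      rw [gain, integral_Ioi_eq_add hT hrun.integrableOn_benefit]
      congr 1
      · refine intervalIntegral.integral_congr fun s hs => ?_
        rw [uIcc_of_le hT] at hs
        exact hb1 s hs.2
      · rw [← setIntegral_Ioi_comp_add, gain, ← integral_const_mul]
        exact setIntegral_congr_fun measurableSet_Ioi fun t ht => hb2 t ht
    linarith
  have hE := Real.exp_pos (-ρ * T)
  refine le_of_forall_pos_le_add fun ε hε => ?_
  obtain ⟨u, x, h, h1⟩ := exists_run_gain_gt hb hc hρ hr (h₀.nonneg T hTm)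
    (sub_lt_self (valueReal b c ρ r (y₀ T)) (div_pos hε hE))
  have h2 := key u x h
  have h3 := mul_lt_mul_of_pos_left h1 hE
  rw [mul_sub, mul_div_cancel₀ _ hE.ne'] at h3
  linarith

/-- Prescribing a straight path and reading off the control u = v - g avoids solving a differential
equation; these are the test moves for all lower bounds on V. -/
theorem valueReal_ge_of_constant_velocity (hb : 0 < b) (hc : 0 < c) (hρ : 0 < ρ)
    (hr : IsRecyclingRate b ρ r) {x₀ v T : ℝ} (hT : 0 ≤ T)
    (hpath : ∀ t ∈ Icc 0 T, 0 ≤ x₀ + v * t)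
    (hpos : ∀ t ∈ Icc 0 T, 0 < v - drift b r (x₀ + v * t)) :
    (∫ t in (0 : ℝ)..T, Real.exp (-ρ * t) *
        (Real.log (v - drift b r (x₀ + v * t)) - c * (x₀ + v * t) ^ 2)) +
      Real.exp (-ρ * T) * valueReal b c ρ r (x₀ + v * T) ≤ valueReal b c ρ r x₀ := by
  have hdc : ContinuousOn (fun t => drift b r (x₀ + v * t)) (Icc 0 T) :=
    hr.continuousOn_drift.comp (by fun_prop) (fun t ht => hpath t ht)
  have hlogc : ContinuousOn (fun t => Real.log (v - drift b r (x₀ + v * t))) (Icc 0 T) :=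
    (continuousOn_const.sub hdc).log fun t ht => (hpos t ht).ne'
  refine RunOn.add_valueReal_le hb hc hρ hr hT
    (u₀ := fun t => v - drift b r (x₀ + v * t)) (y₀ := fun t => x₀ + v * t)
    ⟨hpos, ?_, by fun_prop, hpath, fun _ _ => ?_, ?_, ?_⟩
  · exact (continuousOn_const.sub hdc).integrableOn_Icc.mono_set Ioc_subset_Icc_self
  · have : ∀ s, v - drift b r (x₀ + v * s) - b * (x₀ + v * s) + r (x₀ + v * s) = v := by
      intro s; simp only [drift]; ring
    simp only [this, intervalIntegral.integral_const, smul_eq_mul]; ring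
  · exact (ContinuousOn.mul (by fun_prop) hlogc).integrableOn_Icc.mono_set Ioc_subset_Icc_self
  · exact (ContinuousOn.mul (by fun_prop)
      (hlogc.sub (by fun_prop))).integrableOn_Icc.mono_set Ioc_subset_Icc_self

/-- The principle of optimality along a run attaining the value. -/
theorem Run.optimality (hb : 0 < b) (hc : 0 < c) (hρ : 0 < ρ) (hr : IsRecyclingRate b ρ r)
    {x₀ : ℝ} {u x : ℝ → ℝ} (h : Run b c ρ r x₀ u x) (hopt : gain c ρ u x = valueReal b c ρ r x₀)
    {t₁ t₂ : ℝ} (h1 : 0 ≤ t₁) (h12 : t₁ ≤ t₂) :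
    Real.exp (-ρ * t₁) * valueReal b c ρ r (x t₁) =
      (∫ t in t₁..t₂, benefit c ρ u x t) + Real.exp (-ρ * t₂) * valueReal b c ρ r (x t₂) := by
  have key : ∀ T, 0 ≤ T → valueReal b c ρ r x₀ =
      (∫ t in (0 : ℝ)..T, benefit c ρ u x t) + Real.exp (-ρ * T) * valueReal b c ρ r (x T) := by
    intro T hT
    refine le_antisymm ?_ ((h.runOn hT).add_valueReal_le hb hc hρ hr hT)
    rw [← hopt, h.gain_eq_add_tail hT]
    have := (h.tail hr hT).gain_le_valueReal hb hc hρ hr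
    have := mul_le_mul_of_nonneg_left this (Real.exp_pos (-ρ * T)).le
    linarith
  have h2 := h1.trans h12
  have e1 := key t₁ h1
  have e2 := key t₂ h2
  have := intervalIntegral.integral_add_adjacent_intervals
    (h.intervalIntegrable_benefit le_rfl h1) (h.intervalIntegrable_benefit h1 h2)
  linarith

/-! ### Monotonicity and continuity of the value function -/

/-- Jump almost instantly from x₀ up to x₁: over a short time T the required control is at least 1,
so the logarithm does no harm and the pollution costs at most cx₁²T. -/
theorem antitoneOn_valueReal (hb : 0 < b) (hc : 0 < c) (hρ : 0 < ρ) (hr : IsRecyclingRate b ρ r) :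
    AntitoneOn (valueReal b c ρ r) (Ici 0) := by
  intro x₀ hx₀ x₁ hx₁ h01
  rw [mem_Ici] at hx₀ hx₁
  rcases h01.eq_or_lt with h | hlt
  · rw [h]
  obtain ⟨a, ha, hra⟩ := hr.exists_bound
  have hTpos : 0 < (x₁ - x₀) / (a + 1) := div_pos (by linarith) (by linarith)
  have hlim : Tendsto (fun T : ℝ => -(c * x₁ ^ 2) * T +
      Real.exp (-ρ * T) * valueReal b c ρ r x₁) (𝓝[>] 0) (𝓝 (valueReal b c ρ r x₁)) := by
    have : Continuous (fun T : ℝ => -(c * x₁ ^ 2) * T +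
      Real.exp (-ρ * T) * valueReal b c ρ r x₁) := by fun_prop
    have := this.tendsto 0
    simp only [mul_zero, zero_add, Real.exp_zero, one_mul] at this
    exact this.mono_left nhdsWithin_le_nhds
  refine le_of_tendsto hlim ?_
  filter_upwards [Ioo_mem_nhdsGT hTpos] with T hT
  set v := (x₁ - x₀) / T with hv
  have hva : a + 1 ≤ v := by
    rw [hv, le_div_iff₀ hT.1]
    have := (lt_div_iff₀ (by linarith)).1 hT.2
    linarith
  have hvT : x₀ + v * T = x₁ := by rw [hv, div_mul_cancel₀ _ hT.1.ne']; ring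
  have hv0 : 0 < v := by linarith
  have hpath : ∀ t ∈ Icc 0 T, 0 ≤ x₀ + v * t := fun t ht =>
    add_nonneg hx₀ (mul_nonneg hv0.le ht.1)
  have hone : ∀ t ∈ Icc 0 T, 1 ≤ v - drift b r (x₀ + v * t) := fun t ht => by
    have h1 := hra _ (hpath t ht)
    have h2 := mul_nonneg hb.le (hpath t ht)
    simp only [drift]; linarith
  have h := valueReal_ge_of_constant_velocity hb hc hρ hr hT.1.le hpath
    (fun t ht => one_pos.trans_le (hone t ht))
  rw [hvT] at h
  have hint : -(c * x₁ ^ 2) * T ≤ ∫ t in (0 : ℝ)..T, Real.exp (-ρ * t) *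
        (Real.log (v - drift b r (x₀ + v * t)) - c * (x₀ + v * t) ^ 2) := by
    have h1 : ∫ t in (0 : ℝ)..T, -(c * x₁ ^ 2) = -(c * x₁ ^ 2) * T := by
      rw [intervalIntegral.integral_const, smul_eq_mul]; ring
    rw [← h1]
    refine intervalIntegral.integral_mono_on hT.1.le (by simp) ?_ fun t ht => ?_
    · apply ContinuousOn.intervalIntegrable
      rw [uIcc_of_le hT.1.le]
      refine ContinuousOn.mul (by fun_prop) (ContinuousOn.sub (ContinuousOn.log ?_ ?_)
        (by fun_prop))
      · exact continuousOn_const.sub (hr.continuousOn_drift.comp (by fun_prop)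
          (fun t ht => hpath t ht))
      · exact fun t ht => (one_pos.trans_le (hone t ht)).ne'
    · have hl := Real.log_nonneg (hone t ht)
      have hx : x₀ + v * t ≤ x₁ := by
        rw [← hvT]; have := mul_le_mul_of_nonneg_left ht.2 hv0.le; linarith
      have hsq : (x₀ + v * t) ^ 2 ≤ x₁ ^ 2 := pow_le_pow_left₀ (hpath t ht) hx 2
      have hE0 := Real.exp_pos (-ρ * t)
      have hE1 : Real.exp (-ρ * t) ≤ 1 := Real.exp_le_one_iff.2 (by nlinarith [ht.1])
      have h2 : 0 ≤ c * x₁ ^ 2 := by positivity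
      have h3 : -(c * x₁ ^ 2) ≤
          Real.log (v - drift b r (x₀ + v * t)) - c * (x₀ + v * t) ^ 2 := by nlinarith
      have h4 := mul_le_mul_of_nonneg_left h3 hE0.le
      nlinarith
  linarith

/-- The logistic perturbation with carrying capacity `d`. -/
def logistic (d L m t : ℝ) : ℝ := d / (1 + m * Real.exp (-(2 * L) * t))

theorem logistic_pos {d L m : ℝ} (hd : 0 < d) (hm : 0 < m) (t : ℝ) : 0 < logistic d L m t := by
  have := Real.exp_pos (-(2 * L) * t)
  unfold logistic; positivity

theorem logistic_lt {d L m : ℝ} (hd : 0 < d) (hm : 0 < m) (t : ℝ) : logistic d L m t < d := by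
  have := mul_pos hm (Real.exp_pos (-(2 * L) * t))
  rw [logistic, div_lt_iff₀ (by positivity)]
  nlinarith

theorem hasDerivAt_logistic {d L m : ℝ} (hd : 0 < d) (hm : 0 < m) (t : ℝ) :
    HasDerivAt (logistic d L m)
      (2 * L * logistic d L m t * (1 - logistic d L m t / d)) t := by
  have he : HasDerivAt (fun t : ℝ => Real.exp (-(2 * L) * t))
      (Real.exp (-(2 * L) * t) * (-(2 * L))) t := by
    simpa using ((hasDerivAt_id t).const_mul (-(2 * L))).exp
  have hpos : 0 < 1 + m * Real.exp (-(2 * L) * t) := by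
    have := mul_pos hm (Real.exp_pos (-(2 * L) * t)); positivity
  have h := ((hasDerivAt_const t d).fun_div ((he.const_mul m).const_add 1) hpos.ne')
  convert! h using 1
  unfold logistic
  field_simp
  ring

theorem continuous_logistic {d L m : ℝ} (hd : 0 < d) (hm : 0 < m) : Continuous (logistic d L m) :=
  continuous_iff_continuousAt.2 fun t => (hasDerivAt_logistic hd hm t).continuousAt

theorem tendsto_integral_logistic_sq (hρ : 0 < ρ) {d L : ℝ} (hd : 0 < d) :
    Tendsto (fun m => ∫ t in Ioi 0, Real.exp (-ρ * t) * logistic d L m t ^ 2) atTop (𝓝 0) := by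
  suffices h : Tendsto (fun m => ∫ t in Ioi 0, Real.exp (-ρ * t) * logistic d L m t ^ 2) atTop
      (𝓝 (∫ t in Ioi (0 : ℝ), (0 : ℝ))) by simpa using h
  refine tendsto_integral_filter_of_dominated_convergence
    (fun t => Real.exp (-ρ * t) * d ^ 2) ?_ ?_ ?_ ?_
  · filter_upwards [eventually_gt_atTop 0] with m hm
    have := continuous_logistic (L := L) hd hm
    exact (by fun_prop : Continuous fun t =>
      Real.exp (-ρ * t) * logistic d L m t ^ 2).aestronglyMeasurable
  · filter_upwards [eventually_gt_atTop 0] with m hm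
    refine Eventually.of_forall fun t => ?_
    rw [Real.norm_of_nonneg (by positivity)]
    have := pow_le_pow_left₀ (logistic_pos (L := L) hd hm t).le (logistic_lt hd hm t).le 2
    gcongr
  · exact (exp_neg_integrableOn_Ioi 0 hρ).mul_const _
  · refine Eventually.of_forall fun t => ?_
    have h1 : Tendsto (fun m : ℝ => 1 + m * Real.exp (-(2 * L) * t)) atTop atTop :=
      tendsto_atTop_add_const_left _ _ (tendsto_id.atTop_mul_const (Real.exp_pos _))
    have h2 : Tendsto (fun m => logistic d L m t) atTop (𝓝 0) := h1.const_div_atTop d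
    simpa using (h2.pow 2).const_mul (Real.exp (-ρ * t))

/-- Raising the initial state of a run along a logistic curve costs only the extra pollution. -/
theorem Run.valueReal_logistic_ge (hb : 0 < b) (hc : 0 < c) (hρ : 0 < ρ)
    (hr : IsRecyclingRate b ρ r) {L a d m θ x₀ : ℝ} (hL : 0 < L)
    (hlip : ∀ x y, 0 ≤ x → 0 ≤ y → |drift b r x - drift b r y| ≤ L * |x - y|)
    (ha : 0 < a) (hra : ∀ x, 0 ≤ x → r x ≤ a) (hd : d = 2 * a / b) (hm : 0 < m) (hθ : 0 < θ)
    {u x : ℝ → ℝ} (h : Run b c ρ r x₀ u x) :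
    gain c ρ u x - c * θ * (∫ t in Ioi 0, Real.exp (-ρ * t) * x t ^ 2) -
      c * (1 + 1 / θ) * (∫ t in Ioi 0, Real.exp (-ρ * t) * logistic d L m t ^ 2) ≤
    valueReal b c ρ r (x₀ + d / (1 + m)) := by
  have hdpos : 0 < d := by rw [hd]; positivity
  set δ := logistic d L m with hδ
  have hδ0 : ∀ t, 0 < δ t := logistic_pos hdpos hm
  have hδd : ∀ t, δ t < d := logistic_lt hdpos hm
  have hδc : Continuous δ := continuous_logistic hdpos hm
  have hδ' := hasDerivAt_logistic (L := L) hdpos hm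
  set δ' : ℝ → ℝ := fun t => 2 * L * δ t * (1 - δ t / d) with hδ'def
  have hδ'c : Continuous δ' := by simp only [hδ'def]; fun_prop
  set η : ℝ → ℝ := fun t => δ' t + drift b r (x t) - drift b r (x t + δ t) with hη
  -- The extra control is nonnegative in two regimes. For δ ≤ d/2 the logistic growth is at least Lδ
  -- and beats the Lipschitz variation of the drift; for δ ≥ d/2 = a/b the extra decay bδ ≥ a
  -- outweighs any increase of r.
  have hη0 : ∀ t, 0 ≤ t → 0 ≤ η t := by
    intro t ht
    have hx := h.nonneg ht
    have hxδ : 0 ≤ x t + δ t := by linarith [hδ0 t]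
    rcases le_total (δ t) (d / 2) with h1 | h1
    · have h2 := (abs_le.1 (hlip _ _ hxδ hx)).2
      rw [add_sub_cancel_left, abs_of_pos (hδ0 t)] at h2
      have h3 : δ t / d ≤ 1 / 2 := by rw [div_le_iff₀ hdpos]; linarith
      have h4 : L * δ t ≤ δ' t := by
        have := mul_nonneg (mul_pos hL (hδ0 t)).le (by linarith : 0 ≤ 1 - 2 * (δ t / d))
        simp only [hδ'def]; linarith
      simp only [hη]; linarith
    · have h2 := hra _ hxδ
      have h3 := hr.nonneg hx
      have h4 : a ≤ b * δ t := by
        have : b * (d / 2) = a := by rw [hd]; field_simp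
        rw [← this]; gcongr
      have h5 : δ t / d ≤ 1 := (div_le_one hdpos).2 (hδd t).le
      have h6 : 0 ≤ δ' t := mul_nonneg (by have := hδ0 t; positivity) (by linarith)
      simp only [hη, drift]; linarith
  set C := 3 * L * d with hC
  have hCpos : 0 < C := by positivity
  have hηC : ∀ t, 0 ≤ t → η t ≤ C := by
    intro t ht
    have hx := h.nonneg ht
    have hxδ : 0 ≤ x t + δ t := by linarith [hδ0 t]
    have h2 := (abs_le.1 (hlip _ _ hxδ hx)).1
    rw [add_sub_cancel_left, abs_of_pos (hδ0 t)] at h2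
    have h3 : L * δ t ≤ L * d := by gcongr; exact (hδd t).le
    have h4 : 0 ≤ δ t / d := div_nonneg (hδ0 t).le hdpos.le
    have h5 : δ' t ≤ 2 * L * δ t := by
      have := mul_nonneg (mul_pos hL (hδ0 t)).le h4
      simp only [hδ'def]; nlinarith
    simp only [hη, hC]; linarith
  have hηc : ContinuousOn η (Ici 0) := by
    refine (hδ'c.continuousOn.add (hr.continuousOn_drift.comp h.continuousOn
      fun t ht => h.nonneg ht)).sub (hr.continuousOn_drift.comp
      (h.continuousOn.add hδc.continuousOn) fun t ht => ?_)
    exact add_nonneg (h.nonneg ht) (hδ0 t).le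
  set u' := fun t => u t + η t with hu'
  set x' := fun t => x t + δ t with hx'
  have hpos : ∀ t, 0 ≤ t → 0 < u' t := fun t ht => add_pos_of_pos_of_nonneg (h.pos t ht) (hη0 t ht)
  have hloc : LocallyIntegrableOn u' (Ici 0) :=
    h.locallyIntegrableOn.add (hηc.locallyIntegrableOn measurableSet_Ici)
  have hx'0 : ∀ t, 0 ≤ t → 0 ≤ x' t := fun t ht => add_nonneg (h.nonneg ht) (hδ0 t).le
  have hδinit : δ 0 = d / (1 + m) := by simp [hδ, logistic]
  have htraj : IsTrajectory b r (x₀ + d / (1 + m)) u' x' := by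
    refine ⟨h.continuousOn.add hδc.continuousOn, fun t ht => ⟨hx'0 t ht, ?_⟩⟩
    have h1 : ∀ s, u' s - b * x' s + r (x' s) = velocity b r u x s + δ' s := by
      intro s
      simp only [hu', hx', hη, velocity, drift]; ring
    simp only [h1]
    rw [intervalIntegral.integral_add (h.intervalIntegrable_velocity hr le_rfl ht)
      (hδ'c.intervalIntegrable _ _), intervalIntegral.integral_eq_sub_of_hasDerivAt
      (fun s _ => hδ' s) (hδ'c.intervalIntegrable _ _), ← hδ, hδinit]
    have := h.eq_add_integral hr le_rfl ht
    rw [h.initial] at this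
    simp only [hx']
    linarith
  have hlog1 : ∀ t, 0 ≤ t → Real.log (u t) ≤ Real.log (u' t) := fun t ht =>
    Real.log_le_log (h.pos t ht) (le_add_of_nonneg_right (hη0 t ht))
  have hlog2 : ∀ t, 0 ≤ t → |Real.log (u' t)| ≤ |Real.log (u t)| + C := by
    intro t ht
    have hu0 := h.pos t ht
    have h1 := hηC t ht
    rw [abs_le]
    constructor
    · linarith [hlog1 t ht, neg_abs_le (Real.log (u t))]
    · have h2 : Real.log (1 + C) ≤ C := by
        have := Real.log_le_sub_one_of_pos (by linarith : 0 < 1 + C); linarith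
      rcases le_total 1 (u t) with h3 | h3
      · have h4 : u' t ≤ u t * (1 + C) := by simp only [hu']; nlinarith
        have h5 := Real.log_le_log (hpos t ht) h4
        rw [Real.log_mul hu0.ne' (by linarith)] at h5
        linarith [le_abs_self (Real.log (u t))]
      · have h4 : u' t ≤ 1 + C := by simp only [hu']; linarith
        have h5 := Real.log_le_log (hpos t ht) h4
        linarith [abs_nonneg (Real.log (u t))]
  have hexpi : IntegrableOn (fun t : ℝ => Real.exp (-ρ * t)) (Ioi 0) := exp_neg_integrableOn_Ioi 0 hρ
  have hlogi : IntegrableOn (fun t => Real.exp (-ρ * t) * Real.log (u' t)) (Ioi 0) := by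
    refine Integrable.mono' (h.integrableOn_log.norm.add (hexpi.mul_const C))
      (aestronglyMeasurable_log hloc) ?_
    refine (ae_restrict_iff' measurableSet_Ioi).2 (Eventually.of_forall fun t ht => ?_)
    have hE := Real.exp_pos (-ρ * t)
    simp only [Pi.add_apply, norm_mul, Real.norm_eq_abs, abs_of_pos hE]
    have := mul_le_mul_of_nonneg_left (hlog2 t (mem_Ioi.1 ht).le) hE.le
    linarith
  have hδi : IntegrableOn (fun t => Real.exp (-ρ * t) * δ t ^ 2) (Ioi 0) := by
    refine Integrable.mono' (hexpi.mul_const (d ^ 2))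
      (by fun_prop : Continuous fun t => Real.exp (-ρ * t) * δ t ^ 2).aestronglyMeasurable
      (Eventually.of_forall fun t => ?_)
    rw [Real.norm_of_nonneg (by positivity)]
    have := pow_le_pow_left₀ (hδ0 t).le (hδd t).le 2
    gcongr
  have hxi := h.integrableOn_sq hc
  have hx'm : AEStronglyMeasurable x' (volume.restrict (Ioi 0)) :=
    (htraj.1.mono Ioi_subset_Ici_self).aestronglyMeasurable measurableSet_Ioi
  have hx'i : IntegrableOn (fun t => Real.exp (-ρ * t) * (c * x' t ^ 2)) (Ioi 0) := by
    refine Integrable.mono' ((hxi.const_mul (2 * c)).add (hδi.const_mul (2 * c))) ?_ ?_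
    · exact (by fun_prop : Continuous fun t : ℝ => Real.exp (-ρ * t)).aestronglyMeasurable.mul
        ((hx'm.pow 2).const_mul c)
    · refine Eventually.of_forall fun t => ?_
      rw [Real.norm_of_nonneg (by positivity)]
      have hE := Real.exp_pos (-ρ * t)
      have : x' t ^ 2 ≤ 2 * x t ^ 2 + 2 * δ t ^ 2 := by
        simp only [hx']; nlinarith [sq_nonneg (x t - δ t)]
      have := mul_le_mul_of_nonneg_left this (mul_pos hE hc).le
      simp only [Pi.add_apply]; linarith
  have hrun : Run b c ρ r (x₀ + d / (1 + m)) u' x' := by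
    refine ⟨hpos, hloc, htraj, hlogi, (hlogi.sub hx'i).congr (Eventually.of_forall fun t => ?_)⟩
    simp only [benefit, Pi.sub_apply]; ring
  refine le_trans ?_ (hrun.gain_le_valueReal hb hc hρ hr)
  have hA := h.integrableOn_benefit
  have hB : IntegrableOn (fun t => c * θ * (Real.exp (-ρ * t) * x t ^ 2)) (Ioi 0) := hxi.const_mul _
  have hD : IntegrableOn (fun t => c * (1 + 1 / θ) * (Real.exp (-ρ * t) * δ t ^ 2)) (Ioi 0) :=
    hδi.const_mul _
  have hAB : IntegrableOn (fun t => benefit c ρ u x t -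
      c * θ * (Real.exp (-ρ * t) * x t ^ 2)) (Ioi 0) := hA.sub hB
  rw [gain, gain, ← integral_const_mul, ← integral_const_mul, ← integral_sub hA hB,
    ← integral_sub hAB hD]
  refine setIntegral_mono_on (hAB.sub hD) hrun.integrableOn_benefit measurableSet_Ioi
    fun t ht => ?_
  have hE := Real.exp_pos (-ρ * t)
  have h1 := hlog1 t (mem_Ioi.1 ht).le
  have h2 : 2 * x t * δ t ≤ θ * x t ^ 2 + 1 / θ * δ t ^ 2 := by
    have : θ * x t ^ 2 + 1 / θ * δ t ^ 2 - 2 * x t * δ t = (θ * x t - δ t) ^ 2 / θ := by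
      field_simp; ring
    have : 0 ≤ (θ * x t - δ t) ^ 2 / θ := by positivity
    linarith
  have h3 : Real.log (u t) - c * x t ^ 2 - c * θ * x t ^ 2 - c * (1 + 1 / θ) * δ t ^ 2 ≤
      Real.log (u' t) - c * x' t ^ 2 := by
    have := mul_le_mul_of_nonneg_left h2 hc.le
    simp only [hx'] at h1 ⊢
    nlinarith
  have := mul_le_mul_of_nonneg_left h3 hE.le
  simp only [benefit]
  linarith

/-- Perturb a nearly optimal run along the logistic curve that starts at ε. The loss τ is split into
thirds: non-optimality, the term with θ, and the logistic integral, which vanishes as m → ∞, that is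
as ε → 0. The bound is uniform for x ≤ X, so it also gives continuity from the left. -/
theorem eventually_valueReal_sub_le (hb : 0 < b) (hc : 0 < c) (hρ : 0 < ρ)
    (hr : IsRecyclingRate b ρ r) (X : ℝ) {τ : ℝ} (hτ : 0 < τ) :
    ∃ ε₀ > 0, ∀ x, 0 ≤ x → x ≤ X → ∀ ε ∈ Ioo 0 ε₀,
      valueReal b c ρ r x - τ ≤ valueReal b c ρ r (x + ε) := by
  obtain ⟨L, hL, hlip⟩ := hr.exists_lipschitz_drift hb
  obtain ⟨a, ha, hra⟩ := hr.exists_bound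
  set d := 2 * a / b with hd
  have hdpos : 0 < d := by positivity
  set X' := max X 0
  -- Q bounds c/2 ∫ e^{-ρt}x² for every run from [0, X] whose gain is within τ/3 of the value.
  set Q := (ρ + b) ^ 2 / (2 * c) / ρ - valueReal b c ρ r X' + 1 + τ with hQ
  have hX' : (0 : ℝ) ≤ X' := le_max_right _ _
  have hVX := valueReal_le_sub_sq hb hc hρ hr hX'
  have hQpos : 0 < Q := by
    have : 0 ≤ c / (2 * (ρ + 2 * b)) * X' ^ 2 := by positivity
    simp only [hQ]; linarith
  set θ := τ / (6 * Q) with hθ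
  have hθpos : 0 < θ := by positivity
  have hlim := (tendsto_integral_logistic_sq hρ (d := d) (L := L) hdpos).const_mul
    (c * (1 + 1 / θ))
  rw [mul_zero] at hlim
  obtain ⟨m₀, hm₀⟩ := eventually_atTop.1 (hlim.eventually (gt_mem_nhds (by positivity : 0 < τ / 3)))
  refine ⟨d / (1 + max m₀ 1), by positivity, fun x hx hxX ε hε => ?_⟩
  set m := d / ε - 1 with hm
  have hmm : max m₀ 1 < m := by
    have := (lt_div_iff₀ (by positivity)).1 hε.2
    rw [hm, lt_sub_iff_add_lt, lt_div_iff₀ hε.1]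
    linarith
  have hmpos : 0 < m := lt_of_lt_of_le one_pos ((le_max_right _ _).trans hmm.le)
  have hdm : d / (1 + m) = ε := by
    rw [hm, add_sub_cancel, div_div_cancel₀ hdpos.ne']
  have h1 := hm₀ m ((le_max_left _ _).trans hmm.le)
  have hVle : valueReal b c ρ r X' ≤ valueReal b c ρ r x :=
    antitoneOn_valueReal hb hc hρ hr (mem_Ici.2 hx) (mem_Ici.2 hX') (hxX.trans (le_max_left _ _))
  obtain ⟨u, y, h, hg⟩ := exists_run_gain_gt hb hc hρ hr hx
    (sub_lt_self (valueReal b c ρ r x) (by positivity : 0 < τ / 3))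
  have h2 := h.valueReal_logistic_ge hb hc hρ hr hL hlip ha hra hd hmpos hθpos
  rw [hdm] at h2
  have h3 := h.gain_add_le hc hρ hr
  have h4 : c * θ * (∫ t in Ioi 0, Real.exp (-ρ * t) * y t ^ 2) ≤ τ / 3 := by
    have h5 : c / 2 * (∫ t in Ioi 0, Real.exp (-ρ * t) * y t ^ 2) ≤ Q := by
      simp only [hQ]; linarith
    have h6 := mul_le_mul_of_nonneg_left h5 (by positivity : 0 ≤ 2 * θ)
    have h7 : 2 * θ * Q = τ / 3 := by rw [hθ]; field_simp; norm_num
    linarith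
  linarith

theorem continuousOn_valueReal (hb : 0 < b) (hc : 0 < c) (hρ : 0 < ρ)
    (hr : IsRecyclingRate b ρ r) : ContinuousOn (valueReal b c ρ r) (Ici 0) := by
  intro x hx
  rw [mem_Ici] at hx
  rw [Metric.continuousWithinAt_iff]
  intro τ hτ
  obtain ⟨ε₀, hε₀, h⟩ := eventually_valueReal_sub_le hb hc hρ hr (x + 1) (half_pos hτ)
  refine ⟨min ε₀ 1, by positivity, fun y hy hxy => ?_⟩
  rw [mem_Ici] at hy
  rw [Real.dist_eq] at hxy ⊢
  have hanti := antitoneOn_valueReal hb hc hρ hr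
  rcases lt_trichotomy x y with hlt | heq | hlt
  · rw [abs_of_pos (sub_pos.2 hlt)] at hxy
    have h1 := h x hx (by linarith) (y - x) ⟨by linarith, hxy.trans_le (min_le_left _ _)⟩
    rw [add_sub_cancel] at h1
    have h2 := hanti (mem_Ici.2 hx) (mem_Ici.2 hy) hlt.le
    rw [abs_lt]; constructor <;> linarith
  · rw [heq]; simpa using hτ
  · rw [abs_of_neg (sub_neg.2 hlt)] at hxy
    have h1 := h y hy (by linarith) (x - y)
      ⟨by linarith, by linarith [min_le_left ε₀ 1]⟩
    rw [add_sub_cancel] at h1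
    have h2 := hanti (mem_Ici.2 hy) (mem_Ici.2 hx) hlt.le
    rw [abs_lt]; constructor <;> linarith

/-- Trajectories cannot cross downwards a state where the drift is nonnegative. -/
theorem Run.ge_of_drift_nonneg (hb : 0 < b) (hr : IsRecyclingRate b ρ r) {x₀ y t₁ t₂ : ℝ}
    {u x : ℝ → ℝ} (h : Run b c ρ r x₀ u x) (hy : 0 ≤ y) (hg : 0 ≤ drift b r y)
    (ht₁ : 0 ≤ t₁) (h12 : t₁ ≤ t₂) (h1 : y ≤ x t₁) : y ≤ x t₂ := by
  by_contra! hlt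
  obtain ⟨L, hL, hlip⟩ := hr.exists_lipschitz_drift hb
  obtain ⟨s, hs, hsy, hlast⟩ := exists_last_time h12
    (h.continuousOn.mono fun t ht => ht₁.trans ht.1) h1 hlt
  have hs0 : 0 ≤ s := ht₁.trans hs.1
  refine absurd (not_lt_of_speed_ge (C := L) hs.2.le hL.le
    (h.intervalIntegrable_velocity hr hs0 (hs0.trans hs.2.le))
    (fun t ht => h.eq_add_integral hr hs0 (hs0.trans ht.1)) hsy
    (Eventually.of_forall fun t ht => ?_)) (not_le.2 hlt)
  have ht0 : 0 ≤ t := hs0.trans ht.1.le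
  have h2 := (abs_le.1 (hlip _ _ (h.nonneg ht0) hy)).1
  rw [abs_of_neg (sub_neg.2 (hlast t ht))] at h2
  rw [velocity_eq]
  have := h.pos t ht0
  linarith

/-! ### The Hamiltonian -/

theorem log_sub_add_le_ham {x p u : ℝ} (hp : p < 0) (hu : 0 < u) :
    Real.log u - c * x ^ 2 + p * (u + drift b r x) ≤ ham b c r x p := by
  have := log_add_mul_le hp hu
  simp only [ham]; linarith

theorem ham_eq {x p : ℝ} (hp : p < 0) :
    ham b c r x p = Real.log (-1 / p) - c * x ^ 2 + p * (-1 / p + drift b r x) := by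
  have h : Real.log (-1 / p) = -Real.log (-p) := by
    rw [show -1 / p = (-p)⁻¹ by field_simp, Real.log_inv]
  have h2 : p * (-1 / p) = -1 := mul_div_cancel₀ _ hp.ne
  rw [h, mul_add, h2, ham]; ring

/-- Convexity of the Hamiltonian in p: it is a supremum of affine functions, and the one belonging
to u = -1/p is its tangent at p, with slope the feedback speed. -/
theorem ham_tangent_le {x p q : ℝ} (hp : p < 0) (hq : q < 0) :
    ham b c r x p + (-1 / p + drift b r x) * (q - p) ≤ ham b c r x q := by
  have h := log_sub_add_le_ham (b := b) (c := c) (r := r) (x := x) hq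
    (show 0 < -1 / p by exact div_pos_of_neg_of_neg (by norm_num) hp)
  rw [ham_eq hp]; linarith

/-- At p = 1/g the feedback speed vanishes, so this is the minimum over p; it equals the running
benefit of staying. -/
theorem ham_inv_drift {x : ℝ} (hg : drift b r x < 0) :
    ham b c r x (1 / drift b r x) = Real.log (-drift b r x) - c * x ^ 2 := by
  rw [ham_eq (one_div_neg.2 hg)]
  have : -1 / (1 / drift b r x) = -drift b r x := by field_simp
  rw [this]; ring

theorem ham_lt_of_mem_Icc {x p q m E : ℝ} (hp : p < 0) (hq : q < 0)
    (h1 : ham b c r x p < E) (h2 : ham b c r x q < E) (h : m ∈ Icc p q) : ham b c r x m < E := by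
  have hm : m < 0 := h.2.trans_lt hq
  have h3 := ham_tangent_le (b := b) (c := c) (r := r) (x := x) hm hp
  have h4 := ham_tangent_le (b := b) (c := c) (r := r) (x := x) hm hq
  rcases le_total 0 (-1 / m + drift b r x) with h5 | h5
  · have := mul_nonneg h5 (sub_nonneg.2 h.2); linarith
  · have := mul_nonneg_of_nonpos_of_nonpos h5 (sub_nonpos.2 h.1); linarith

theorem continuousAt_ham (hr : IsRecyclingRate b ρ r) {x p : ℝ} (hx : 0 < x) (hp : p < 0) :
    ContinuousAt (fun z : ℝ × ℝ => ham b c r z.1 z.2) (x, p) := by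
  have h1 : ContinuousAt (drift b r) x := (hr.hasDerivAt_drift hx).continuousAt
  have h2 : ContinuousAt (fun z : ℝ × ℝ => drift b r z.1) (x, p) :=
    ContinuousAt.comp (f := Prod.fst) (x := (x, p)) h1 continuousAt_fst
  have h3 : ContinuousAt (fun z : ℝ × ℝ => Real.log (-z.2)) (x, p) :=
    (continuousAt_snd.neg).log (by simpa using hp.ne)
  have h4 : ContinuousAt (fun z : ℝ × ℝ => c * z.1 ^ 2) (x, p) := by fun_prop
  exact ((h3.neg.sub continuousAt_const).sub h4).add (continuousAt_snd.mul h2)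

/-- The standing assumptions on the parameters. -/
structure Standing (b c ρ : ℝ) (r : ℝ → ℝ) : Prop where
  b_pos : 0 < b
  c_pos : 0 < c
  rho_pos : 0 < ρ
  rate : IsRecyclingRate b ρ r

namespace Standing

theorem continuousAt_value (S : Standing b c ρ r) {x : ℝ} (hx : 0 < x) :
    ContinuousAt (valueReal b c ρ r) x :=
  (continuousOn_valueReal S.b_pos S.c_pos S.rho_pos S.rate).continuousAt (Ici_mem_nhds hx)

theorem antitoneOn_value (S : Standing b c ρ r) : AntitoneOn (valueReal b c ρ r) (Ici 0) :=
  antitoneOn_valueReal S.b_pos S.c_pos S.rho_pos S.rate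

theorem continuousAt_drift (S : Standing b c ρ r) {x : ℝ} (hx : 0 < x) :
    ContinuousAt (drift b r) x := (S.rate.hasDerivAt_drift hx).continuousAt

theorem continuousAt_ham_left (S : Standing b c ρ r) {x p : ℝ} (hx : 0 < x) (hp : p < 0) :
    ContinuousAt (fun y => ham b c r y p) x :=
  ContinuousAt.comp (f := fun y : ℝ => (y, p)) (x := x) (continuousAt_ham S.rate hx hp)
    (by fun_prop)

/-! ### Supersolution property -/

/-- The test move gives V(x + vT) ≤ e^{ρT}(V(x) - ∫ f), whose right side has slope ρV - ln(v - g) +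
cx² at T = 0. Nothing is assumed about the regularity of V. -/
theorem eventually_move (S : Standing b c ρ r) {x v κ : ℝ} (hx : 0 < x)
    (hv : 0 < v - drift b r x)
    (hκ : ρ * valueReal b c ρ r x - Real.log (v - drift b r x) + c * x ^ 2 < κ) :
    ∀ᶠ T in 𝓝[>] (0 : ℝ), valueReal b c ρ r (x + v * T) ≤ valueReal b c ρ r x + κ * T := by
  set V := valueReal b c ρ r with hV
  have hp : Tendsto (fun t : ℝ => x + v * t) (𝓝 0) (𝓝 x) := by
    have : Continuous (fun t : ℝ => x + v * t) := by fun_prop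
    simpa using this.tendsto 0
  have hev : ∀ᶠ t in 𝓝 (0 : ℝ), 0 < x + v * t ∧ 0 < v - drift b r (x + v * t) := by
    have h2 : ∀ᶠ y in 𝓝 x, 0 < v - drift b r y :=
      (continuousAt_const.sub (S.continuousAt_drift hx)).eventually (lt_mem_nhds hv)
    exact hp.eventually ((lt_mem_nhds hx).and h2)
  obtain ⟨δ, hδ, hball⟩ := Metric.eventually_nhds_iff.1 hev
  have hI : ∀ t ∈ Ioo (-δ) δ, 0 < x + v * t ∧ 0 < v - drift b r (x + v * t) := fun t ht =>
    hball (by rw [Real.dist_eq, sub_zero, abs_lt]; exact ht)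
  set f := fun t => Real.exp (-ρ * t) *
    (Real.log (v - drift b r (x + v * t)) - c * (x + v * t) ^ 2) with hf
  have hfc : ContinuousOn f (Ioo (-δ) δ) := by
    intro t ht
    have h1 : ContinuousAt (fun t => drift b r (x + v * t)) t :=
      ContinuousAt.comp (f := fun t => x + v * t) (S.continuousAt_drift (hI t ht).1) (by fun_prop)
    have h2 := (continuousAt_const.sub h1).log (hI t ht).2.ne'
    have h3 : ContinuousAt (fun t : ℝ => Real.exp (-ρ * t)) t := by fun_prop
    have h4 : ContinuousAt (fun t : ℝ => c * (x + v * t) ^ 2) t := by fun_prop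
    exact (h3.mul (h2.sub h4)).continuousWithinAt
  have h0 : (0 : ℝ) ∈ Ioo (-δ) δ := ⟨by linarith, hδ⟩
  have hF : HasDerivAt (fun T => ∫ t in (0 : ℝ)..T, f t) (f 0) 0 :=
    intervalIntegral.integral_hasDerivAt_right (by simp)
      (hfc.stronglyMeasurableAtFilter isOpen_Ioo 0 h0)
      (hfc.continuousAt (isOpen_Ioo.mem_nhds h0))
  have hE : HasDerivAt (fun T : ℝ => Real.exp (ρ * T)) (Real.exp (ρ * 0) * ρ) 0 := by
    simpa using ((hasDerivAt_id (0 : ℝ)).const_mul ρ).exp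
  have hG := (hE.fun_mul (hF.const_sub (V x))).tendsto_slope_zero
  simp only [intervalIntegral.integral_same, sub_zero, mul_zero, Real.exp_zero, one_mul,
    smul_eq_mul, zero_add] at hG
  have hlt : ρ * V x + -f 0 < κ := by
    simp only [hf, mul_zero, Real.exp_zero, one_mul, add_zero]; linarith
  have hG' := (hG.mono_left (nhdsGT_le_nhdsNE 0)).eventually (gt_mem_nhds hlt)
  filter_upwards [hG', Ioo_mem_nhdsGT hδ] with T hT hTδ
  have hsub : ∀ t ∈ Icc 0 T, t ∈ Ioo (-δ) δ := fun t ht =>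
    ⟨by linarith [ht.1], ht.2.trans_lt hTδ.2⟩
  have h := valueReal_ge_of_constant_velocity S.b_pos S.c_pos S.rho_pos S.rate (x₀ := x) (v := v)
    hTδ.1.le (fun t ht => (hI t (hsub t ht)).1.le) (fun t ht => (hI t (hsub t ht)).2)
  have hEE : Real.exp (ρ * T) * Real.exp (-ρ * T) = 1 := by
    rw [← Real.exp_add]; simp
  have h' : Real.exp (-ρ * T) * V (x + v * T) ≤ V x - ∫ t in (0 : ℝ)..T, f t := by
    simp only [hf]; linarith
  have h2 := mul_le_mul_of_nonneg_left h' (Real.exp_pos (ρ * T)).le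
  rw [← mul_assoc, hEE, one_mul] at h2
  have h3 := (inv_mul_lt_iff₀ hTδ.1).1 hT
  linarith

theorem log_neg_drift_le (S : Standing b c ρ r) {x : ℝ} (hx : 0 < x) (hg : drift b r x < 0) :
    Real.log (-drift b r x) - c * x ^ 2 ≤ ρ * valueReal b c ρ r x := by
  by_contra! hlt
  obtain ⟨T, h1, h2⟩ := ((S.eventually_move (v := 0)
    (κ := (ρ * valueReal b c ρ r x - Real.log (-drift b r x) + c * x ^ 2) / 2) hx
    (by linarith) (by rw [zero_sub]; linarith)).and self_mem_nhdsWithin).exists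
  rw [zero_mul, add_zero] at h1
  have : 0 < T := h2
  nlinarith

/-- The control u = -1/q realises H(x,q) and moves right at speed v > 0; the hypothesis on H says
that the cost per unit time is below qv, that is, below slope q per unit length. -/
theorem eventually_right_le (S : Standing b c ρ r) {x q : ℝ} (hx : 0 < x) (hq : q < 0)
    (hv : 0 < -1 / q + drift b r x) (hH : ρ * valueReal b c ρ r x < ham b c r x q) :
    ∀ᶠ y in 𝓝[>] x, valueReal b c ρ r y - q * y ≤ valueReal b c ρ r x - q * x := by
  set v := -1 / q + drift b r x with hvdef
  rw [ham_eq hq, ← hvdef] at hH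
  have hu : v - drift b r x = -1 / q := by rw [hvdef]; ring
  have h := S.eventually_move (v := v) (κ := q * v) hx
    (by rw [hu]; exact div_pos_of_neg_of_neg (by norm_num) hq) (by rw [hu]; linarith)
  have ht : Tendsto (fun y => (y - x) / v) (𝓝[>] x) (𝓝[>] 0) := by
    refine tendsto_nhdsWithin_iff.2 ⟨?_, ?_⟩
    · have : Continuous (fun y => (y - x) / v) := by fun_prop
      have := this.tendsto x
      rw [sub_self, zero_div] at this
      exact this.mono_left nhdsWithin_le_nhds
    · filter_upwards [self_mem_nhdsWithin] with y hy
      exact div_pos (sub_pos.2 hy) hv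
  filter_upwards [ht.eventually h] with y hy
  rw [mul_div_cancel₀ _ hv.ne', add_sub_cancel, mul_assoc, mul_div_cancel₀ _ hv.ne'] at hy
  linarith

theorem eventually_left_le (S : Standing b c ρ r) {x q : ℝ} (hx : 0 < x) (hq : q < 0)
    (hv : -1 / q + drift b r x < 0) (hH : ρ * valueReal b c ρ r x < ham b c r x q) :
    ∀ᶠ y in 𝓝[<] x, valueReal b c ρ r y - q * y ≤ valueReal b c ρ r x - q * x := by
  set v := -1 / q + drift b r x with hvdef
  rw [ham_eq hq, ← hvdef] at hH
  have hu : v - drift b r x = -1 / q := by rw [hvdef]; ring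
  have h := S.eventually_move (v := v) (κ := q * v) hx
    (by rw [hu]; exact div_pos_of_neg_of_neg (by norm_num) hq) (by rw [hu]; linarith)
  have ht : Tendsto (fun y => (y - x) / v) (𝓝[<] x) (𝓝[>] 0) := by
    refine tendsto_nhdsWithin_iff.2 ⟨?_, ?_⟩
    · have : Continuous (fun y => (y - x) / v) := by fun_prop
      have := this.tendsto x
      rw [sub_self, zero_div] at this
      exact this.mono_left nhdsWithin_le_nhds
    · filter_upwards [self_mem_nhdsWithin] with y hy
      exact div_pos_of_neg_of_neg (sub_neg.2 hy) hv
  filter_upwards [ht.eventually h] with y hy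
  rw [mul_div_cancel₀ _ hv.ne, add_sub_cancel, mul_assoc, mul_div_cancel₀ _ hv.ne] at hy
  linarith

end Standing

/-! ### Verification and the subsolution property -/

/-- Along the run the benefit plus the derivative of e^{-ρt}φ(x) is at most e^{-ρt}(H(x,φ') - ρφ) ≤
-ηe^{-ρt}. -/
theorem Run.verification (hρ : 0 < ρ) (hr : IsRecyclingRate b ρ r) {x₀ t₁ t₂ α β η : ℝ}
    {u x φ φ' : ℝ → ℝ} (h : Run b c ρ r x₀ u x) (ht₁ : 0 ≤ t₁) (h12 : t₁ ≤ t₂)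
    (hS : ∀ t ∈ Icc t₁ t₂, x t ∈ Icc α β)
    (hφ : ∀ y ∈ Icc α β, HasDerivAt φ (φ' y) y) (hφ' : ContinuousOn φ' (Icc α β))
    (hneg : ∀ y ∈ Icc α β, φ' y < 0)
    (hham : ∀ y ∈ Icc α β, ham b c r y (φ' y) ≤ ρ * φ y - η) :
    (∫ t in t₁..t₂, benefit c ρ u x t) + Real.exp (-ρ * t₂) * φ (x t₂) +
      η * ((Real.exp (-ρ * t₁) - Real.exp (-ρ * t₂)) / ρ) ≤ Real.exp (-ρ * t₁) * φ (x t₁) := by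
  have ht₂ := ht₁.trans h12
  obtain ⟨hi, he⟩ := discounted_chain_rule_Icc (ρ := ρ) h12
    (h.intervalIntegrable_velocity hr ht₁ ht₂)
    (fun t ht => h.eq_add_integral hr ht₁ (ht₁.trans ht.1)) hS hφ hφ'
  have hb := h.intervalIntegrable_benefit ht₁ ht₂
  have hexp : IntervalIntegrable (fun t => -η * Real.exp (-ρ * t)) volume t₁ t₂ := by
    apply Continuous.intervalIntegrable; fun_prop
  have hle := intervalIntegral.integral_mono_on h12 (hb.add hi) hexp fun t ht => by
    have hu := h.pos t (ht₁.trans ht.1)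
    have hx := hS t ht
    have h1 := log_sub_add_le_ham (b := b) (c := c) (r := r) (x := x t) (hneg _ hx) hu
    have h2 := hham _ hx
    rw [← velocity_eq] at h1
    have h3 := mul_le_mul_of_nonneg_left (h1.trans h2) (Real.exp_pos (-ρ * t)).le
    simp only [benefit]
    linarith
  rw [intervalIntegral.integral_add hb hi, he, intervalIntegral.integral_const_mul,
    integral_exp_interval hρ] at hle
  linarith

namespace Standing

/-- If H(x₀,p) < ρV(x₀), verification with a slightly steeper parabola shows that every run from x₀
falls short of V(x₀) by a fixed ε. A run staying within δ for unit time loses through the gap η; one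
exiting earlier loses through the additional quadratic term. When the drift at x₀ is nonnegative no
trajectory goes below x₀, so touching on the right suffices. -/
theorem le_ham_of_touched (S : Standing b c ρ r) {x₀ p K : ℝ} (hx₀ : 0 < x₀) (hp : p < 0)
    (hK : ∀ᶠ y in 𝓝 x₀, (0 ≤ drift b r x₀ → x₀ ≤ y) →
      valueReal b c ρ r y ≤ valueReal b c ρ r x₀ + p * (y - x₀) + K * (y - x₀) ^ 2) :
    ρ * valueReal b c ρ r x₀ ≤ ham b c r x₀ p := by
  by_contra! hlt
  set V := valueReal b c ρ r with hV
  set φ := fun y => V x₀ + p * (y - x₀) + (K + 1) * (y - x₀) ^ 2 with hφ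
  set φ' := fun y => p + 2 * (K + 1) * (y - x₀) with hφ'
  have hφ'c : Continuous φ' := by simp only [hφ']; fun_prop
  have hφc : Continuous φ := by simp only [hφ]; fun_prop
  have hφd : ∀ y, HasDerivAt φ (φ' y) y := fun y => by
    have h1 := (hasDerivAt_id y).sub_const x₀
    have := ((h1.const_mul p).const_add (V x₀)).fun_add ((h1.fun_pow 2).const_mul (K + 1))
    convert! this using 1
    simp only [hφ', id]; push_cast; ring
  set η := (ρ * V x₀ - ham b c r x₀ p) / 2 with hη
  have hηpos : 0 < η := by simp only [hη]; linarith
  have hφ'0 : φ' x₀ = p := by simp [hφ']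
  have hφ0 : φ x₀ = V x₀ := by simp [hφ]
  have e1 : ∀ᶠ y in 𝓝 x₀, φ' y < 0 := by
    have := hφ'c.tendsto x₀
    rw [hφ'0] at this
    exact this.eventually (gt_mem_nhds hp)
  have e2 : ∀ᶠ y in 𝓝 x₀, ham b c r y (φ' y) - ρ * φ y < -η := by
    have h1 : ContinuousAt (fun y => ham b c r y (φ' y)) x₀ := by
      refine ContinuousAt.comp (f := fun y : ℝ => (y, φ' y))
        (g := fun z : ℝ × ℝ => ham b c r z.1 z.2) (x := x₀) ?_ (by fun_prop)
      rw [hφ'0]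
      exact continuousAt_ham S.rate hx₀ hp
    have h2 : ContinuousAt (fun y => ham b c r y (φ' y) - ρ * φ y) x₀ :=
      h1.sub (continuousAt_const.mul hφc.continuousAt)
    refine h2.eventually (gt_mem_nhds ?_)
    beta_reduce
    rw [hφ'0, hφ0]; linarith
  obtain ⟨δ', hδ', hball⟩ := Metric.eventually_nhds_iff.1 ((e1.and e2).and (hK.and (lt_mem_nhds hx₀)))
  set δ := δ' / 2 with hδ
  have hδpos : 0 < δ := by positivity
  have hN : ∀ y ∈ Icc (x₀ - δ) (x₀ + δ), (φ' y < 0 ∧ ham b c r y (φ' y) - ρ * φ y < -η) ∧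
      ((0 ≤ drift b r x₀ → x₀ ≤ y) → V y ≤ V x₀ + p * (y - x₀) + K * (y - x₀) ^ 2) ∧ 0 < y := by
    intro y hy
    refine hball ?_
    rw [Real.dist_eq]
    have : |y - x₀| ≤ δ := abs_le.2 ⟨by linarith [hy.1], by linarith [hy.2]⟩
    linarith
  set ε := min (η * ((1 - Real.exp (-ρ)) / ρ)) (Real.exp (-ρ) * δ ^ 2) with hε
  have hexp1 : Real.exp (-ρ) < 1 := Real.exp_lt_one_iff.2 (by linarith [S.rho_pos])
  have hεpos : 0 < ε := lt_min (mul_pos hηpos (div_pos (by linarith) S.rho_pos))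
    (mul_pos (Real.exp_pos _) (by positivity))
  obtain ⟨u, x, h, hg⟩ := exists_run_gain_gt S.b_pos S.c_pos S.rho_pos S.rate hx₀.le
    (sub_lt_self (V x₀) hεpos)
  obtain ⟨τ, hτ0, hτ1, hin, hout⟩ : ∃ τ, 0 ≤ τ ∧ τ ≤ 1 ∧ (∀ t ∈ Icc 0 τ, |x t - x₀| ≤ δ) ∧
      (τ = 1 ∨ |x τ - x₀| = δ) := by
    by_cases hex : ∃ s ∈ Icc (0 : ℝ) 1, δ ≤ |x s - x₀|
    · obtain ⟨s, hs, hsδ⟩ := hex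
      have hc : ContinuousOn (fun t => |x t - x₀|) (Icc 0 s) :=
        ((h.continuousOn.mono Icc_subset_Ici_self).sub continuousOn_const).abs
      obtain ⟨τ, hτ, h1, h2⟩ := exists_first_time hs.1 hc
        (by simpa [h.initial] using hδpos) hsδ
      refine ⟨τ, hτ.1.le, hτ.2.trans hs.2, fun t ht => ?_, Or.inr h1⟩
      rcases ht.2.eq_or_lt with h3 | h3
      · rw [h3]; exact h1.le
      · exact (h2 t ⟨ht.1, h3⟩).le
    · push Not at hex
      exact ⟨1, zero_le_one, le_rfl, fun t ht => (hex t ht).le, Or.inl rfl⟩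
  have hmem : ∀ t ∈ Icc 0 τ, x t ∈ Icc (x₀ - δ) (x₀ + δ) := fun t ht => by
    have := abs_le.1 (hin t ht)
    exact ⟨by linarith, by linarith⟩
  have hver := h.verification S.rho_pos S.rate le_rfl hτ0 hmem (fun y _ => hφd y)
    hφ'c.continuousOn (fun y hy => (hN y hy).1.1) (η := η)
    (fun y hy => by linarith [(hN y hy).1.2])
  have hτm := hmem τ (right_mem_Icc.2 hτ0)
  have hVτ : V (x τ) ≤ φ (x τ) - (x τ - x₀) ^ 2 := by
    have := (hN _ hτm).2.1 (fun hd => h.ge_of_drift_nonneg S.b_pos S.rate hx₀.le hd le_rfl hτ0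
      (by rw [h.initial]))
    simp only [hφ]; linarith
  have htail := (h.tail S.rate hτ0).gain_le_valueReal S.b_pos S.c_pos S.rho_pos S.rate
  have hgain := h.gain_eq_add_tail hτ0
  have hE := Real.exp_pos (-ρ * τ)
  rw [h.initial, hφ0, mul_zero, Real.exp_zero, one_mul] at hver
  have h5 : Real.exp (-ρ * τ) * gain c ρ (fun t => u (τ + t)) (fun t => x (τ + t)) ≤
      Real.exp (-ρ * τ) * φ (x τ) - Real.exp (-ρ * τ) * (x τ - x₀) ^ 2 := by
    rw [← mul_sub]
    exact mul_le_mul_of_nonneg_left (htail.trans hVτ) hE.le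
  have h6 : η * ((1 - Real.exp (-ρ * τ)) / ρ) + Real.exp (-ρ * τ) * (x τ - x₀) ^ 2 < ε := by
    linarith
  have h7 : Real.exp (-ρ * τ) ≤ 1 := Real.exp_le_one_iff.2 (by nlinarith [S.rho_pos])
  have h8 : 0 ≤ η * ((1 - Real.exp (-ρ * τ)) / ρ) :=
    mul_nonneg hηpos.le (div_nonneg (by linarith) S.rho_pos.le)
  have h9 : 0 ≤ Real.exp (-ρ * τ) * (x τ - x₀) ^ 2 := by positivity
  rcases hout with h1 | h1
  · rw [h1, mul_one] at h6
    rw [h1, mul_one] at h9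
    linarith [min_le_left (η * ((1 - Real.exp (-ρ)) / ρ)) (Real.exp (-ρ) * δ ^ 2)]
  · have h2 : (x τ - x₀) ^ 2 = δ ^ 2 := by rw [← sq_abs, h1]
    have h3 : Real.exp (-ρ) ≤ Real.exp (-ρ * τ) :=
      Real.exp_le_exp.2 (by nlinarith [S.rho_pos])
    have h4 : Real.exp (-ρ) * δ ^ 2 ≤ Real.exp (-ρ * τ) * (x τ - x₀) ^ 2 := by
      rw [h2]; gcongr
    linarith [min_le_right (η * ((1 - Real.exp (-ρ)) / ρ)) (Real.exp (-ρ) * δ ^ 2)]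

theorem le_ham_of_touchedAbove (S : Standing b c ρ r) {x p : ℝ} (hx : 0 < x) (hp : p < 0)
    (h : TouchedAbove (valueReal b c ρ r) x p) :
    ρ * valueReal b c ρ r x ≤ ham b c r x p := by
  obtain ⟨K, hK⟩ := h
  exact S.le_ham_of_touched hx hp (hK.mono fun y hy _ => hy)

/-- The value at the limit of an optimal trajectory is that of staying there. -/
theorem value_eq_of_tendsto (S : Standing b c ρ r) {x₀ z : ℝ} {u x : ℝ → ℝ} (hz : 0 < z)
    (hg : drift b r z < 0) (h : Run b c ρ r x₀ u x) (hopt : gain c ρ u x = valueReal b c ρ r x₀)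
    (hlim : Tendsto x atTop (𝓝 z)) :
    ρ * valueReal b c ρ r z = Real.log (-drift b r z) - c * z ^ 2 := by
  refine le_antisymm ?_ (S.log_neg_drift_le hz hg)
  by_contra! hlt
  set V := valueReal b c ρ r with hV
  set p := 1 / drift b r z with hp
  have hpneg : p < 0 := one_div_neg.2 hg
  rw [← ham_inv_drift hg, ← hp] at hlt
  set φ := fun y => V z + p * (y - z) with hφ
  have hφc : Continuous φ := by simp only [hφ]; fun_prop
  have hφ0 : φ z = V z := by simp [hφ]
  set η := (ρ * V z - ham b c r z p) / 2 with hη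
  have hηpos : 0 < η := by simp only [hη]; linarith
  have e2 : ∀ᶠ y in 𝓝 z, ham b c r y p - ρ * φ y < -η := by
    have h2 : ContinuousAt (fun y => ham b c r y p - ρ * φ y) z :=
      (S.continuousAt_ham_left hz hpneg).sub (continuousAt_const.mul hφc.continuousAt)
    refine h2.eventually (gt_mem_nhds ?_)
    beta_reduce
    rw [hφ0]; linarith
  obtain ⟨δ', hδ', hball⟩ := Metric.eventually_nhds_iff.1 e2
  set δ := δ' / 2 with hδ
  have hδpos : 0 < δ := by positivity
  have hN : ∀ y ∈ Icc (z - δ) (z + δ), ham b c r y p - ρ * φ y < -η := by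
    intro y hy
    refine hball ?_
    rw [Real.dist_eq]
    have : |y - z| ≤ δ := abs_le.2 ⟨by linarith [hy.1], by linarith [hy.2]⟩
    linarith
  obtain ⟨T₀, hT₀⟩ := eventually_atTop.1
    (hlim.eventually (Icc_mem_nhds (show z - δ < z by linarith) (show z < z + δ by linarith)))
  -- Were staying at z strictly worse than V(z), every unit of time near z would create a fixed
  -- discrepancy in φ - V along the optimal trajectory, although φ - V tends to 0 there.
  have hineq : ∀ᶠ T in atTop, Real.exp (-ρ) * (φ (x (T + 1)) - V (x (T + 1))) +
      η * ((1 - Real.exp (-ρ)) / ρ) ≤ φ (x T) - V (x T) := by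
    filter_upwards [eventually_ge_atTop T₀, eventually_ge_atTop 0] with T hT hT0
    have hver := h.verification S.rho_pos S.rate hT0 (by linarith : T ≤ T + 1)
      (fun t ht => hT₀ t (hT.trans ht.1)) (φ := φ) (φ' := fun _ => p)
      (fun y _ => by
        have := (((hasDerivAt_id y).sub_const z).const_mul p).const_add (V z)
        simp only [mul_one] at this
        exact this) continuousOn_const
      (fun _ _ => hpneg) (η := η) (fun y hy => by linarith [hN y hy])
    have ho := h.optimality S.b_pos S.c_pos S.rho_pos S.rate hopt hT0 (by linarith : T ≤ T + 1)
    have hE := Real.exp_pos (-ρ * T)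
    have he : Real.exp (-ρ * (T + 1)) = Real.exp (-ρ * T) * Real.exp (-ρ) := by
      rw [← Real.exp_add]; ring_nf
    rw [he] at hver ho
    refine le_of_mul_le_mul_left ?_ hE
    have e : η * ((Real.exp (-ρ * T) - Real.exp (-ρ * T) * Real.exp (-ρ)) / ρ) =
        Real.exp (-ρ * T) * (η * ((1 - Real.exp (-ρ)) / ρ)) := by ring
    rw [e] at hver
    linarith
  have hl1 : Tendsto (fun T => φ (x T) - V (x T)) atTop (𝓝 0) := by
    have : ContinuousAt (fun y => φ y - V y) z :=
      hφc.continuousAt.sub (S.continuousAt_value hz)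
    have := this.tendsto.comp hlim
    rwa [hφ0, sub_self] at this
  have hl2 := hl1.comp (tendsto_atTop_add_const_right atTop (1 : ℝ) tendsto_id)
  have := le_of_tendsto_of_tendsto ((hl2.const_mul (Real.exp (-ρ))).add_const
    (η * ((1 - Real.exp (-ρ)) / ρ))) hl1 hineq
  rw [mul_zero, zero_add] at this
  have hexp1 : Real.exp (-ρ) < 1 := Real.exp_lt_one_iff.2 (by linarith [S.rho_pos])
  have : 0 < η * ((1 - Real.exp (-ρ)) / ρ) :=
    mul_pos hηpos (div_pos (by linarith) S.rho_pos)
  linarith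

end Standing

/-! ### Local structure of the value function -/

/-- The value function is strictly differentiable at `x`, solves the Hamilton-Jacobi equation there
and the optimal feedback moves to the right. -/
def MovesRightAt (b c ρ : ℝ) (r : ℝ → ℝ) (x : ℝ) : Prop :=
  ∃ p < 0, HasStrictDerivAt (valueReal b c ρ r) p x ∧
    ham b c r x p = ρ * valueReal b c ρ r x ∧ 0 < -1 / p + drift b r x

/-- The value function is strictly differentiable at `x`, solves the Hamilton-Jacobi equation there
and the optimal feedback moves to the left. -/
def MovesLeftAt (b c ρ : ℝ) (r : ℝ → ℝ) (x : ℝ) : Prop :=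
  ∃ p < 0, HasStrictDerivAt (valueReal b c ρ r) p x ∧
    ham b c r x p = ρ * valueReal b c ρ r x ∧ -1 / p + drift b r x < 0

/-- Staying at `x` is optimal. -/
def IsRest (b c ρ : ℝ) (r : ℝ → ℝ) (x : ℝ) : Prop :=
  drift b r x < 0 ∧ ρ * valueReal b c ρ r x = Real.log (-drift b r x) - c * x ^ 2

theorem MovesRightAt.not_movesLeftAt {x : ℝ} (h : MovesRightAt b c ρ r x) :
    ¬ MovesLeftAt b c ρ r x := by
  rintro ⟨q, -, hq, -, hvq⟩
  obtain ⟨p, -, hp, -, hvp⟩ := h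
  rw [hp.hasDerivAt.unique hq.hasDerivAt] at hvp
  exact lt_asymm hvp hvq

/-! ### Touching slopes of monotone functions; convexity and coercivity of the Hamiltonian -/

theorem TouchedAbove.nonneg_of_monotoneOn {f : ℝ → ℝ} {ξ p : ℝ} {s : Set ℝ} (hs : s ∈ 𝓝 ξ)
    (hf : MonotoneOn f s) (h : TouchedAbove f ξ p) : 0 ≤ p := by
  obtain ⟨K, hK⟩ := h
  have h1 : ∀ᶠ y in 𝓝[>] ξ, 0 ≤ p + K * (y - ξ) := by
    filter_upwards [nhdsWithin_le_nhds hs, nhdsWithin_le_nhds hK, self_mem_nhdsWithin]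
      with y hys hy hlt
    have h2 := hf (mem_of_mem_nhds hs) hys (le_of_lt hlt)
    have h3 : 0 < y - ξ := sub_pos.2 hlt
    by_contra! h4
    nlinarith [mul_neg_of_neg_of_pos h4 h3]
  have h2 : Tendsto (fun y => p + K * (y - ξ)) (𝓝[>] ξ) (𝓝 p) := by
    have : Continuous (fun y => p + K * (y - ξ)) := by fun_prop
    have := this.tendsto ξ
    rw [sub_self, mul_zero, add_zero] at this
    exact this.mono_left nhdsWithin_le_nhds
  exact ge_of_tendsto h2 h1

theorem TouchedAbove.nonpos_of_antitoneOn {f : ℝ → ℝ} {ξ p : ℝ} {s : Set ℝ} (hs : s ∈ 𝓝 ξ)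
    (hf : AntitoneOn f s) (h : TouchedAbove f ξ p) : p ≤ 0 := by
  obtain ⟨K, hK⟩ := h
  have h1 : ∀ᶠ y in 𝓝[<] ξ, p + K * (y - ξ) ≤ 0 := by
    filter_upwards [nhdsWithin_le_nhds hs, nhdsWithin_le_nhds hK, self_mem_nhdsWithin]
      with y hys hy hlt
    have h2 := hf hys (mem_of_mem_nhds hs) (le_of_lt hlt)
    have h3 : y - ξ < 0 := sub_neg.2 hlt
    by_contra! h4
    nlinarith [mul_neg_of_pos_of_neg h4 h3]
  have h2 : Tendsto (fun y => p + K * (y - ξ)) (𝓝[<] ξ) (𝓝 p) := by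
    have : Continuous (fun y => p + K * (y - ξ)) := by fun_prop
    have := this.tendsto ξ
    rw [sub_self, mul_zero, add_zero] at this
    exact this.mono_left nhdsWithin_le_nhds
  exact le_of_tendsto h2 h1

theorem ham_lt_of_mem_Ico {x p q m E : ℝ} (hp : p < 0) (hq : q < 0) (h1 : ham b c r x p < E)
    (h2 : ham b c r x q = E) (hpm : p ≤ m) (hmq : m < q) : ham b c r x m < E := by
  have hm : m < 0 := hmq.trans hq
  have h3 := ham_tangent_le (b := b) (c := c) (r := r) (x := x) hm hp
  have h4 := ham_tangent_le (b := b) (c := c) (r := r) (x := x) hm hq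
  rcases lt_or_ge 0 (-1 / m + drift b r x) with h5 | h5
  · have := mul_pos h5 (sub_pos.2 hmq); linarith
  · have := mul_nonneg_of_nonpos_of_nonpos h5 (sub_nonpos.2 hpm); linarith

theorem ham_lt_of_mem_Ioc {x p q m E : ℝ} (hq : q < 0) (h1 : ham b c r x p = E)
    (h2 : ham b c r x q < E) (hpm : p < m) (hmq : m ≤ q) : ham b c r x m < E := by
  have hm : m < 0 := hmq.trans_lt hq
  have h3 := ham_tangent_le (b := b) (c := c) (r := r) (x := x) hm (hpm.trans hm)
  have h4 := ham_tangent_le (b := b) (c := c) (r := r) (x := x) hm hq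
  rcases lt_or_ge (-1 / m + drift b r x) 0 with h5 | h5
  · have := mul_pos_of_neg_of_neg h5 (sub_neg.2 hpm); linarith
  · have := mul_nonneg h5 (sub_nonneg.2 hmq); linarith

theorem ham_neg_exp (x N : ℝ) :
    ham b c r x (-Real.exp N) = -N - 1 - c * x ^ 2 - Real.exp N * drift b r x := by
  simp only [ham, neg_neg, Real.log_exp]; ring

theorem exists_lt_ham_right {M : ℝ} (hM : M < 0) (x E : ℝ) :
    ∃ q ∈ Ioo M 0, E < ham b c r x q := by
  set N := |Real.log (-M)| + |c * x ^ 2| + |drift b r x| + |E| + 2 with hN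
  have h1 := le_abs_self (c * x ^ 2)
  have h2 := le_abs_self (drift b r x)
  have h3 := le_abs_self E
  have h4 := neg_abs_le (Real.log (-M))
  have h5 := abs_nonneg (c * x ^ 2)
  have h6 := abs_nonneg (drift b r x)
  have h7 := abs_nonneg E
  have h8 := abs_nonneg (Real.log (-M))
  refine ⟨-Real.exp (-N), ⟨?_, neg_lt_zero.2 (Real.exp_pos _)⟩, ?_⟩
  · have : Real.exp (-N) < -M := by
      rw [← Real.exp_log (neg_pos.2 hM), Real.exp_lt_exp]; linarith
    linarith
  · rw [ham_neg_exp]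
    have h9 : Real.exp (-N) ≤ 1 := Real.exp_le_one_iff.2 (by linarith)
    have h10 : Real.exp (-N) * drift b r x ≤ 1 * |drift b r x| :=
      (mul_le_mul_of_nonneg_left h2 (Real.exp_pos _).le).trans
        (mul_le_mul_of_nonneg_right h9 h6)
    linarith

/-- For negative drift the linear term p g beats the logarithm as p → -∞; this is where the
left-moving branch comes from. -/
theorem exists_lt_ham_left {x : ℝ} (hg : drift b r x < 0) {M : ℝ} (hM : M < 0) (E : ℝ) :
    ∃ q < M, E < ham b c r x q := by
  set G := -drift b r x with hG
  have hGpos : 0 < G := neg_pos.2 hg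
  set N := |Real.log (-M)| + |c * x ^ 2| + |E| + 2 + 4 / G with hN
  have h1 := le_abs_self (c * x ^ 2)
  have h3 := le_abs_self E
  have h4 := le_abs_self (Real.log (-M))
  have h5 := abs_nonneg (c * x ^ 2)
  have h7 := abs_nonneg E
  have h8 := abs_nonneg (Real.log (-M))
  have h9 : 0 < 4 / G := by positivity
  have hNpos : 0 < N := by linarith
  refine ⟨-Real.exp N, ?_, ?_⟩
  · have : -M < Real.exp N := by
      rw [← Real.exp_log (neg_pos.2 hM), Real.exp_lt_exp]; linarith
    linarith
  · rw [ham_neg_exp]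
    have h10 := Real.quadratic_le_exp_of_nonneg hNpos.le
    have h11 : 4 ≤ G * N := by
      have : 4 / G ≤ N := by linarith
      rw [div_le_iff₀ hGpos] at this; linarith
    have h12 : G * (N ^ 2 / 2) ≤ G * Real.exp N := by gcongr; linarith
    have h13 : 4 * N ≤ G * N * N := by gcongr
    have : Real.exp N * drift b r x = -(G * Real.exp N) := by rw [hG]; ring
    nlinarith

/-! ### Branches of the Hamilton-Jacobi equation and their propagation -/

namespace Standing

theorem continuousOn_ham_right {x : ℝ} : ContinuousOn (fun p => ham b c r x p) (Iio 0) := by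
  unfold ham
  refine ((ContinuousOn.neg (ContinuousOn.log (by fun_prop) ?_)).sub continuousOn_const).sub
    continuousOn_const |>.add (by fun_prop)
  intro p hp
  exact (neg_pos.2 hp).ne'

theorem continuousOn_sub_linear (S : Standing b c ρ r) (q : ℝ) {s : Set ℝ} (hs : s ⊆ Ioi 0) :
    ContinuousOn (fun y => valueReal b c ρ r y - q * y) s := fun _ hy =>
  ((S.continuousAt_value (hs hy)).sub (by fun_prop)).continuousWithinAt

theorem eventually_ham_lt (S : Standing b c ρ r) {x q : ℝ} (hx : 0 < x) (hq : q < 0)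
    (h : ham b c r x q < ρ * valueReal b c ρ r x) :
    ∀ᶠ y in 𝓝 x, ham b c r y q < ρ * valueReal b c ρ r y :=
  (S.continuousAt_ham_left hx hq).eventually_lt
    (continuousAt_const.mul (S.continuousAt_value hx)) h

theorem eventually_lt_ham (S : Standing b c ρ r) {x q : ℝ} (hx : 0 < x) (hq : q < 0)
    (h : ρ * valueReal b c ρ r x < ham b c r x q) :
    ∀ᶠ y in 𝓝 x, ρ * valueReal b c ρ r y < ham b c r y q :=
  ContinuousAt.eventually_lt (continuousAt_const.mul (S.continuousAt_value hx))
    (S.continuousAt_ham_left hx hq) h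

/-- Monotonicity of V - My excludes touching slopes below M, which leaves the root p ∈ (M, 0) of H =
ρV. For q₁ < p the touching slopes in [M, q₁] violate the subsolution inequality, so V - q₁y
increases; for q₂ > p moves to the right show that V - q₂y decreases. Both hold on a whole
neighbourhood, which gives strict differentiability. -/
theorem movesRightAt_of_monotoneOn (S : Standing b c ρ r) {α β x M : ℝ} (hα : 0 ≤ α)
    (hx : x ∈ Ioo α β) (hM : M < 0)
    (hmono : MonotoneOn (fun y => valueReal b c ρ r y - M * y) (Ioo α β))
    (hH : ∀ y ∈ Ioo α β, ham b c r y M < ρ * valueReal b c ρ r y) : MovesRightAt b c ρ r x := by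
  have hx0 : 0 < x := hα.trans_lt hx.1
  obtain ⟨q₀, hq₀, hq₀H⟩ := exists_lt_ham_right (b := b) (c := c) (r := r) hM x
    (ρ * valueReal b c ρ r x)
  obtain ⟨p, hp, hpH⟩ := intermediate_value_Ioo hq₀.1.le
    (continuousOn_ham_right (b := b) (c := c) (r := r) (x := x) |>.mono
      fun y hy => hy.2.trans_lt hq₀.2) ⟨hH x hx, hq₀H⟩
  have hp0 : p < 0 := hp.2.trans hq₀.2
  have hv : 0 < -1 / p + drift b r x := by
    have h1 := ham_tangent_le (b := b) (c := c) (r := r) (x := x) hp0 hM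
    have h2 := hH x hx
    by_contra! h3
    have := mul_nonneg_of_nonpos_of_nonpos h3 (sub_nonpos.2 hp.1.le)
    beta_reduce at hpH; linarith
  refine ⟨p, hp0, hasStrictDerivAt_of_monotone_antitone fun ε hε => ?_, hpH, hv⟩
  -- Capping at M keeps q₁ in the interval where convexity gives H < ρV; capping at p/2 keeps q₂
  -- negative.
  set q₁ := max (p - ε) M with hq₁
  set q₂ := min (p + ε) (p / 2) with hq₂
  have hq₁p : q₁ < p := max_lt (by linarith) hp.1
  have hpq₂ : p < q₂ := lt_min (by linarith) (by linarith)
  have hq₂0 : q₂ < 0 := (min_le_right _ _).trans_lt (by linarith)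
  have hq₁0 : q₁ < 0 := hq₁p.trans hp0
  have e1 : ham b c r x q₁ < ρ * valueReal b c ρ r x :=
    ham_lt_of_mem_Ico hM hp0 (hH x hx) hpH (le_max_right _ _) hq₁p
  have e2 : ρ * valueReal b c ρ r x < ham b c r x q₂ := by
    have h1 := ham_tangent_le (b := b) (c := c) (r := r) (x := x) hp0 hq₂0
    have := mul_pos hv (sub_pos.2 hpq₂)
    beta_reduce at hpH; linarith
  have e3 : 0 < -1 / q₂ + drift b r x := by
    have : -1 / p ≤ -1 / q₂ := by
      rw [neg_div, neg_div]
      exact neg_le_neg (one_div_le_one_div_of_neg_of_le hq₂0 hpq₂.le)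
    linarith
  have e3' : ∀ᶠ y in 𝓝 x, 0 < -1 / q₂ + drift b r y :=
    (continuousAt_const.add (S.continuousAt_drift hx0)).eventually (lt_mem_nhds e3)
  obtain ⟨δ, hδ, hball⟩ := Metric.eventually_nhds_iff.1 (((S.eventually_ham_lt hx0 hq₁0 e1).and
    (S.eventually_lt_ham hx0 hq₂0 e2)).and (e3'.and (Ioo_mem_nhds hx.1 hx.2)))
  have hN : ∀ y ∈ Ioo (x - δ) (x + δ), (ham b c r y q₁ < ρ * valueReal b c ρ r y ∧
      ρ * valueReal b c ρ r y < ham b c r y q₂) ∧ 0 < -1 / q₂ + drift b r y ∧ y ∈ Ioo α β :=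
    fun y hy => hball (by
      rw [Real.dist_eq, abs_lt]; exact ⟨by linarith [hy.1], by linarith [hy.2]⟩)
  have hsub : ∀ {y z}, y ∈ Ioo (x - δ) (x + δ) → z ∈ Ioo (x - δ) (x + δ) → ∀ w ∈ Icc y z,
      w ∈ Ioo (x - δ) (x + δ) := fun hy hz w hw => ⟨hy.1.trans_le hw.1, hw.2.trans_lt hz.2⟩
  have hpos : ∀ y ∈ Ioo (x - δ) (x + δ), 0 < y := fun y hy => hα.trans_lt (hN y hy).2.2.1
  refine ⟨δ, hδ, fun y hy z hz hyz => ?_, fun y hy z hz hyz => ?_⟩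
  · rcases hyz.eq_or_lt with rfl | hlt
    · exact le_rfl
    have h1 := le_of_touchedAbove_nonneg hlt
      (S.continuousOn_sub_linear q₁ fun w hw => hpos w (hsub hy hz w hw)) fun ξ hξ s hs => by
        by_contra! hs0
        have hξ' := hN ξ (hsub hy hz ξ (Ioo_subset_Icc_self hξ))
        have ht := hs.add_linear
        have hMs : 0 ≤ s + q₁ - M := by
          refine TouchedAbove.nonneg_of_monotoneOn (Ioo_mem_nhds hξ'.2.2.1 hξ'.2.2.2) hmono ?_
          obtain ⟨K, hK⟩ := ht
          exact ⟨K, hK.mono fun w hw => by linarith⟩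
        have h2 := S.le_ham_of_touchedAbove (hα.trans_lt hξ'.2.2.1) (by linarith) ht
        have h3 := ham_lt_of_mem_Icc (m := s + q₁) hM hq₁0 (hH ξ hξ'.2.2) hξ'.1.1
          ⟨by linarith, by linarith⟩
        linarith
    have h2 : p - ε ≤ q₁ := le_max_left _ _
    have := mul_le_mul_of_nonneg_right h2 (sub_nonneg.2 hyz)
    beta_reduce at h1 ⊢
    linarith
  · have h1 := le_left_of_eventually_right_le hyz
      (S.continuousOn_sub_linear q₂ fun w hw => hpos w (hsub hy hz w hw)) fun w hw => by
        have hw' := hN w (hsub hy hz w (Ico_subset_Icc_self hw))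
        exact S.eventually_right_le (hα.trans_lt hw'.2.2.1) hq₂0 hw'.2.1 hw'.1.2
    have h2 : q₂ ≤ p + ε := min_le_left _ _
    have := mul_le_mul_of_nonneg_right h2 (sub_nonneg.2 hyz)
    beta_reduce at h1 ⊢
    linarith

/-- Mirror image of `movesRightAt_of_monotoneOn`. Negative drift is required for the branch p < M to
exist. -/
theorem movesLeftAt_of_antitoneOn (S : Standing b c ρ r) {α β x M : ℝ} (hα : 0 ≤ α)
    (hx : x ∈ Ioo α β) (hM : M < 0) (hg : drift b r x < 0)
    (hanti : AntitoneOn (fun y => valueReal b c ρ r y - M * y) (Ioo α β))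
    (hH : ∀ y ∈ Ioo α β, ham b c r y M < ρ * valueReal b c ρ r y) : MovesLeftAt b c ρ r x := by
  have hx0 : 0 < x := hα.trans_lt hx.1
  obtain ⟨q₀, hq₀, hq₀H⟩ := exists_lt_ham_left (c := c) hg hM (ρ * valueReal b c ρ r x)
  obtain ⟨p, hp, hpH⟩ := intermediate_value_Ioo' hq₀.le
    (continuousOn_ham_right (b := b) (c := c) (r := r) (x := x) |>.mono
      fun y hy => hy.2.trans_lt hM) ⟨hH x hx, hq₀H⟩
  have hp0 : p < 0 := hp.2.trans hM
  have hv : -1 / p + drift b r x < 0 := by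
    have h1 := ham_tangent_le (b := b) (c := c) (r := r) (x := x) hp0 hM
    have h2 := hH x hx
    by_contra! h3
    have := mul_nonneg h3 (sub_nonneg.2 hp.2.le)
    beta_reduce at hpH; linarith
  refine ⟨p, hp0, hasStrictDerivAt_of_monotone_antitone fun ε hε => ?_, hpH, hv⟩
  set q₁ := min (p + ε) M with hq₁
  set q₂ := p - ε with hq₂
  have hq₁p : p < q₁ := lt_min (by linarith) hp.2
  have hpq₂ : q₂ < p := by linarith
  have hq₂0 : q₂ < 0 := by linarith
  have hq₁0 : q₁ < 0 := (min_le_right _ _).trans_lt hM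
  have e1 : ham b c r x q₁ < ρ * valueReal b c ρ r x :=
    ham_lt_of_mem_Ioc hM hpH (hH x hx) hq₁p (min_le_right _ _)
  have e2 : ρ * valueReal b c ρ r x < ham b c r x q₂ := by
    have h1 := ham_tangent_le (b := b) (c := c) (r := r) (x := x) hp0 hq₂0
    have := mul_pos_of_neg_of_neg hv (sub_neg.2 hpq₂)
    beta_reduce at hpH; linarith
  have e3 : -1 / q₂ + drift b r x < 0 := by
    have : -1 / q₂ ≤ -1 / p := by
      rw [neg_div, neg_div]
      exact neg_le_neg (one_div_le_one_div_of_neg_of_le hp0 hpq₂.le)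
    linarith
  have e3' : ∀ᶠ y in 𝓝 x, -1 / q₂ + drift b r y < 0 :=
    (continuousAt_const.add (S.continuousAt_drift hx0)).eventually (gt_mem_nhds e3)
  obtain ⟨δ, hδ, hball⟩ := Metric.eventually_nhds_iff.1 (((S.eventually_ham_lt hx0 hq₁0 e1).and
    (S.eventually_lt_ham hx0 hq₂0 e2)).and (e3'.and (Ioo_mem_nhds hx.1 hx.2)))
  have hN : ∀ y ∈ Ioo (x - δ) (x + δ), (ham b c r y q₁ < ρ * valueReal b c ρ r y ∧
      ρ * valueReal b c ρ r y < ham b c r y q₂) ∧ -1 / q₂ + drift b r y < 0 ∧ y ∈ Ioo α β :=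
    fun y hy => hball (by
      rw [Real.dist_eq, abs_lt]; exact ⟨by linarith [hy.1], by linarith [hy.2]⟩)
  have hsub : ∀ {y z}, y ∈ Ioo (x - δ) (x + δ) → z ∈ Ioo (x - δ) (x + δ) → ∀ w ∈ Icc y z,
      w ∈ Ioo (x - δ) (x + δ) := fun hy hz w hw => ⟨hy.1.trans_le hw.1, hw.2.trans_lt hz.2⟩
  have hpos : ∀ y ∈ Ioo (x - δ) (x + δ), 0 < y := fun y hy => hα.trans_lt (hN y hy).2.2.1
  refine ⟨δ, hδ, fun y hy z hz hyz => ?_, fun y hy z hz hyz => ?_⟩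
  · exact le_right_of_eventually_left_le hyz
      (S.continuousOn_sub_linear q₂ fun w hw => hpos w (hsub hy hz w hw)) fun w hw => by
        have hw' := hN w (hsub hy hz w (Ioc_subset_Icc_self hw))
        exact S.eventually_left_le (hα.trans_lt hw'.2.2.1) hq₂0 hw'.2.1 hw'.1.2
  · rcases hyz.eq_or_lt with rfl | hlt
    · exact le_rfl
    have h1 := le_of_touchedAbove_nonpos hlt
      (S.continuousOn_sub_linear q₁ fun w hw => hpos w (hsub hy hz w hw)) fun ξ hξ s hs => by
        by_contra! hs0
        have hξ' := hN ξ (hsub hy hz ξ (Ioo_subset_Icc_self hξ))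
        have ht := hs.add_linear
        have hMs : s + q₁ - M ≤ 0 := by
          refine TouchedAbove.nonpos_of_antitoneOn (Ioo_mem_nhds hξ'.2.2.1 hξ'.2.2.2) hanti ?_
          obtain ⟨K, hK⟩ := ht
          exact ⟨K, hK.mono fun w hw => by linarith⟩
        have h2 := S.le_ham_of_touchedAbove (hα.trans_lt hξ'.2.2.1) (by linarith) ht
        have h3 := ham_lt_of_mem_Icc (m := s + q₁) hq₁0 hM hξ'.1.1 (hH ξ hξ'.2.2)
          ⟨by linarith, by linarith⟩
        linarith
    have h2 : q₁ ≤ p + ε := min_le_left _ _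
    have := mul_le_mul_of_nonneg_right h2 (sub_nonneg.2 hyz)
    beta_reduce at h1 ⊢
    linarith

/-- For g < 0 the minimiser M = 1/g works, since off the rest points ρV strictly exceeds the benefit
of staying. For g ≥ 0, H(x,p) → -∞ as p → -∞. -/
theorem exists_ham_lt (S : Standing b c ρ r) {x : ℝ} (hx : 0 < x) (hZ : ¬ IsRest b c ρ r x) :
    ∃ M < 0, ham b c r x M < ρ * valueReal b c ρ r x := by
  rcases lt_or_ge (drift b r x) 0 with hg | hg
  · refine ⟨1 / drift b r x, one_div_neg.2 hg, ?_⟩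
    rw [ham_inv_drift hg]
    exact lt_of_le_of_ne (S.log_neg_drift_le hx hg) fun h => hZ ⟨hg, h.symm⟩
  · refine ⟨-Real.exp |ρ * valueReal b c ρ r x|, neg_lt_zero.2 (Real.exp_pos _), ?_⟩
    rw [ham_neg_exp]
    have h1 := neg_abs_le (ρ * valueReal b c ρ r x)
    have h2 := mul_nonneg (Real.exp_pos |ρ * valueReal b c ρ r x|).le hg
    have h3 := mul_nonneg S.c_pos.le (sq_nonneg x)
    linarith

/-- A local maximum of V - My would be a touching of slope M, impossible while H(·,M) < ρV. So V -
My decreases, then increases, and for every threshold x₁ one of the two monotone pieces covers its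
side. -/
theorem exists_local_dichotomy (S : Standing b c ρ r) {x₀ : ℝ} (hx₀ : 0 < x₀)
    (hZ : ¬ IsRest b c ρ r x₀) :
    ∃ δ > 0, ∀ x₁, (∀ x ∈ Ioo (x₀ - δ) (x₀ + δ), x₁ < x → MovesRightAt b c ρ r x) ∨
      ∀ x ∈ Ioo (x₀ - δ) (x₀ + δ), x < x₁ → MovesLeftAt b c ρ r x := by
  obtain ⟨M, hM, hMH⟩ := S.exists_ham_lt hx₀ hZ
  obtain ⟨δ, hδ, hball⟩ := Metric.eventually_nhds_iff.1
    ((S.eventually_ham_lt hx₀ hM hMH).and (lt_mem_nhds hx₀))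
  have hN : ∀ y ∈ Ioo (x₀ - δ) (x₀ + δ), ham b c r y M < ρ * valueReal b c ρ r y ∧ 0 < y :=
    fun y hy => hball (by
      rw [Real.dist_eq, abs_lt]; exact ⟨by linarith [hy.1], by linarith [hy.2]⟩)
  have hα : 0 ≤ x₀ - δ := by
    by_contra! h
    exact lt_irrefl _ (hN 0 ⟨h, by linarith⟩).2
  have hloc : ∀ ξ ∈ Ioo (x₀ - δ) (x₀ + δ),
      ¬ IsLocalMax (fun y => valueReal b c ρ r y - M * y) ξ := by
    intro ξ hξ hmax
    have := S.le_ham_of_touchedAbove (hN ξ hξ).2 hM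
      ⟨0, hmax.mono fun y hy => by beta_reduce at hy; linarith⟩
    linarith [(hN ξ hξ).1]
  refine ⟨δ, hδ, fun x₁ => ?_⟩
  rcases antitoneOn_or_monotoneOn_of_no_localMax
    (S.continuousOn_sub_linear M fun y hy => (hN y hy).2) hloc x₁ with h | h
  · right
    intro x hx hlt
    have hsub : Ioo (x₀ - δ) (min (x₀ + δ) x₁) ⊆ Ioo (x₀ - δ) (x₀ + δ) ∩ Iic x₁ := fun y hy =>
      ⟨⟨hy.1, hy.2.trans_le (min_le_left _ _)⟩, (hy.2.trans_le (min_le_right _ _)).le⟩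
    have hxm : x ∈ Ioo (x₀ - δ) (min (x₀ + δ) x₁) := ⟨hx.1, lt_min hx.2 hlt⟩
    refine S.movesLeftAt_of_antitoneOn hα hxm hM ?_ (h.mono hsub)
      fun y hy => (hN y (hsub hy).1).1
    -- With nonnegative drift, the decrease of V - My to the right of x would already be an
    -- admissible one-sided touching of slope M.
    by_contra! hg
    have := S.le_ham_of_touched (K := 0) (hN x hx).2 hM (by
      filter_upwards [Ioo_mem_nhds hxm.1 hxm.2] with y hy hxy
      have := h (hsub hxm) (hsub hy) (hxy hg)
      beta_reduce at this
      linarith)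
    linarith [(hN x hx).1]
  · left
    intro x hx hlt
    have hsub : Ioo (max (x₀ - δ) x₁) (x₀ + δ) ⊆ Ioo (x₀ - δ) (x₀ + δ) ∩ Ici x₁ := fun y hy =>
      ⟨⟨(le_max_left _ _).trans_lt hy.1, hy.2⟩, ((le_max_right _ _).trans_lt hy.1).le⟩
    exact S.movesRightAt_of_monotoneOn (hα.trans (le_max_left _ _)) ⟨max_lt hx.1 hlt, hx.2⟩ hM
      (h.mono hsub) fun y hy => (hN y (hsub hy).1).1

/-- At the infimum s of the failures, apply the dichotomy with a threshold just left of s: either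
right motion extends past s, or points already known to move right would move left. -/
theorem movesRightAt_of_not_movesLeftAt (S : Standing b c ρ r) {α β x₁ : ℝ} (hα : 0 ≤ α)
    (hZ : ∀ x ∈ Ioo α β, ¬ IsRest b c ρ r x) (hx₁ : x₁ ∈ Ioo α β)
    (h : ¬ MovesLeftAt b c ρ r x₁) : ∀ x ∈ Ioo x₁ β, MovesRightAt b c ρ r x := by
  by_contra! hex
  obtain ⟨w, hw, hwR⟩ := hex
  set A := {x ∈ Ioo x₁ β | ¬ MovesRightAt b c ρ r x} with hA
  have hwA : w ∈ A := ⟨hw, hwR⟩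
  have hbdd : BddBelow A := ⟨x₁, fun y hy => hy.1.1.le⟩
  set s := sInf A with hs
  have hsw : s ≤ w := csInf_le hbdd hwA
  have hbelow : ∀ y, x₁ < y → y < s → MovesRightAt b c ρ r y := by
    intro y h1 h2
    by_contra hy
    exact (csInf_le hbdd (⟨⟨h1, h2.trans (hsw.trans_lt hw.2)⟩, hy⟩ : y ∈ A)).not_gt h2
  obtain ⟨δ, hδ, hloc⟩ := S.exists_local_dichotomy (hα.trans_lt hx₁.1) (hZ x₁ hx₁)
  have hstart : ∀ y ∈ Ioo x₁ (x₁ + δ), MovesRightAt b c ρ r y := by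
    intro y hy
    rcases hloc ((x₁ + y) / 2) with h1 | h1
    · exact h1 y ⟨by linarith [hy.1], hy.2⟩ (by linarith [hy.1])
    · exact absurd (h1 x₁ ⟨by linarith, by linarith⟩ (by linarith [hy.1])) h
  have hx₁s : x₁ + δ ≤ s := by
    refine le_csInf ⟨w, hwA⟩ fun y hy => ?_
    by_contra! hlt
    exact hy.2 (hstart y ⟨hy.1.1, hlt⟩)
  have hsI : s ∈ Ioo α β := ⟨by linarith [hx₁.1], hsw.trans_lt hw.2⟩
  obtain ⟨η, hη, hloc⟩ := S.exists_local_dichotomy (hα.trans_lt hsI.1) (hZ s hsI)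
  set m := max (s - η / 2) ((x₁ + s) / 2) with hm
  have hms : m < s := max_lt (by linarith) (by linarith)
  have hηm : s - η < m := (by linarith : s - η < s - η / 2).trans_le (le_max_left _ _)
  have hx₁m : x₁ < m := (by linarith : x₁ < (x₁ + s) / 2).trans_le (le_max_right _ _)
  rcases hloc ((m + s) / 2) with h1 | h1
  · have : s + η ≤ s := by
      refine le_csInf ⟨w, hwA⟩ fun y hy => ?_
      by_contra! hlt
      have h2 : s ≤ y := csInf_le hbdd hy
      exact hy.2 (h1 y ⟨by linarith, hlt⟩ (by linarith))
    linarith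
  · exact (hbelow m hx₁m hms).not_movesLeftAt (h1 m ⟨hηm, by linarith⟩ (by linarith))

theorem movesLeftAt_of_not_movesRightAt (S : Standing b c ρ r) {α β x₁ : ℝ} (hα : 0 ≤ α)
    (hZ : ∀ x ∈ Ioo α β, ¬ IsRest b c ρ r x) (hx₁ : x₁ ∈ Ioo α β)
    (h : ¬ MovesRightAt b c ρ r x₁) : ∀ x ∈ Ioo α x₁, MovesLeftAt b c ρ r x := by
  intro x hx
  by_contra hL
  exact h (S.movesRightAt_of_not_movesLeftAt hα hZ ⟨hx.1, hx.2.trans hx₁.2⟩ hL x₁ ⟨hx.2, hx₁.2⟩)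

end Standing

/-! ### Optimal feedback -/

/-- The derivative of the value function. -/
def costate (b c ρ : ℝ) (r : ℝ → ℝ) (x : ℝ) : ℝ := deriv (valueReal b c ρ r) x

/-- The speed under the feedback control `u = -1 / V'(x)`. -/
def speed (b c ρ : ℝ) (r : ℝ → ℝ) (x : ℝ) : ℝ := -1 / costate b c ρ r x + drift b r x

/-- The value function is a classical decreasing solution of the Hamilton-Jacobi equation
at `x`. -/
structure IsClassicalAt (b c ρ : ℝ) (r : ℝ → ℝ) (x : ℝ) : Prop where
  hasDerivAt : HasDerivAt (valueReal b c ρ r) (costate b c ρ r x) x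
  neg : costate b c ρ r x < 0
  ham_eq : ham b c r x (costate b c ρ r x) = ρ * valueReal b c ρ r x

theorem IsClassicalAt.of_hasDerivAt {x p : ℝ} (h : HasDerivAt (valueReal b c ρ r) p x) (hp : p < 0)
    (hH : ham b c r x p = ρ * valueReal b c ρ r x) : IsClassicalAt b c ρ r x := by
  have : costate b c ρ r x = p := h.deriv
  exact ⟨this ▸ h, this ▸ hp, this ▸ hH⟩

theorem MovesRightAt.isClassicalAt {x : ℝ} (h : MovesRightAt b c ρ r x) :
    IsClassicalAt b c ρ r x := by
  obtain ⟨p, hp, hd, hH, -⟩ := h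
  exact .of_hasDerivAt hd.hasDerivAt hp hH

theorem MovesLeftAt.isClassicalAt {x : ℝ} (h : MovesLeftAt b c ρ r x) :
    IsClassicalAt b c ρ r x := by
  obtain ⟨p, hp, hd, hH, -⟩ := h
  exact .of_hasDerivAt hd.hasDerivAt hp hH

theorem MovesRightAt.hasStrictDerivAt {x : ℝ} (h : MovesRightAt b c ρ r x) :
    HasStrictDerivAt (valueReal b c ρ r) (costate b c ρ r x) x := by
  obtain ⟨p, -, hd, -, -⟩ := h
  have : costate b c ρ r x = p := hd.hasDerivAt.deriv
  exact this ▸ hd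

theorem MovesLeftAt.hasStrictDerivAt {x : ℝ} (h : MovesLeftAt b c ρ r x) :
    HasStrictDerivAt (valueReal b c ρ r) (costate b c ρ r x) x := by
  obtain ⟨p, -, hd, -, -⟩ := h
  have : costate b c ρ r x = p := hd.hasDerivAt.deriv
  exact this ▸ hd

theorem MovesRightAt.speed_pos {x : ℝ} (h : MovesRightAt b c ρ r x) : 0 < speed b c ρ r x := by
  obtain ⟨p, -, hd, -, hv⟩ := h
  have : costate b c ρ r x = p := hd.hasDerivAt.deriv
  rwa [speed, this]

theorem MovesLeftAt.speed_neg {x : ℝ} (h : MovesLeftAt b c ρ r x) : speed b c ρ r x < 0 := by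
  obtain ⟨p, -, hd, -, hv⟩ := h
  have : costate b c ρ r x = p := hd.hasDerivAt.deriv
  rwa [speed, this]

/-- Along an optimal run dynamic programming is an equality. By the chain rule for V, the integral
of the nonnegative Hamiltonian gap is then zero, so the gap vanishes almost everywhere and
uniqueness of the maximiser gives u = -1/V'(x). -/
theorem Standing.velocity_ae_eq (S : Standing b c ρ r) {x₀ t₁ t₂ : ℝ} {u x : ℝ → ℝ}
    (h : Run b c ρ r x₀ u x) (hopt : gain c ρ u x = valueReal b c ρ r x₀) (ht₁ : 0 ≤ t₁)
    (h12 : t₁ ≤ t₂) {A : Set ℝ} {K : NNReal} (hA : ∀ t ∈ Icc t₁ t₂, x t ∈ A)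
    (hL : LipschitzOnWith K (valueReal b c ρ r) A) (hcl : ∀ y ∈ A, IsClassicalAt b c ρ r y) :
    ∀ᵐ t, t ∈ Ioc t₁ t₂ → velocity b r u x t = speed b c ρ r (x t) := by
  have ht₂ := ht₁.trans h12
  obtain ⟨hi, he⟩ := discounted_chain_rule (ρ := ρ) h12
    (h.intervalIntegrable_velocity S.rate ht₁ ht₂)
    (fun t ht => h.eq_add_integral S.rate ht₁ (ht₁.trans ht.1)) hA hL
    (fun y hy => (hcl y hy).hasDerivAt)
  have hb := h.intervalIntegrable_benefit ht₁ ht₂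
  have ho := h.optimality S.b_pos S.c_pos S.rho_pos S.rate hopt ht₁ h12
  set F := fun t => -(benefit c ρ u x t + Real.exp (-ρ * t) *
    (costate b c ρ r (x t) * velocity b r u x t - ρ * valueReal b c ρ r (x t))) with hF
  have hFi : IntervalIntegrable F volume t₁ t₂ := (hb.add hi).neg
  have hF0 : ∫ t in t₁..t₂, F t = 0 := by
    simp only [hF]
    rw [intervalIntegral.integral_neg, intervalIntegral.integral_add hb hi, he]
    linarith
  have hmem : ∀ᵐ t ∂(volume.restrict (Ioc t₁ t₂)), t ∈ Ioc t₁ t₂ :=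
    ae_restrict_mem measurableSet_Ioc
  have hFnn : 0 ≤ᵐ[volume.restrict (Ioc t₁ t₂)] F := by
    filter_upwards [hmem] with t ht
    have hx := hcl _ (hA t ⟨ht.1.le, ht.2⟩)
    have h1 := log_sub_add_le_ham (b := b) (c := c) (r := r) (x := x t) hx.neg
      (h.pos t (ht₁.trans ht.1.le))
    rw [hx.ham_eq, ← velocity_eq] at h1
    have h3 := mul_le_mul_of_nonneg_left h1 (Real.exp_pos (-ρ * t)).le
    simp only [hF, benefit, Pi.zero_apply]
    linarith
  have hae := (intervalIntegral.integral_eq_zero_iff_of_le_of_nonneg_ae h12 hFnn hFi).1 hF0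
  refine (ae_restrict_iff' measurableSet_Ioc).1 ?_
  filter_upwards [hae, hmem] with t hFt ht
  have hx := hcl _ (hA t ⟨ht.1.le, ht.2⟩)
  have hu := h.pos t (ht₁.trans ht.1.le)
  have h1 : Real.exp (-ρ * t) * (Real.log (u t) - c * x t ^ 2 +
      costate b c ρ r (x t) * velocity b r u x t - ρ * valueReal b c ρ r (x t)) = 0 := by
    simp only [hF, benefit, Pi.zero_apply] at hFt
    linarith
  have h2 := (mul_eq_zero.1 h1).resolve_left (Real.exp_pos _).ne'
  rw [← hx.ham_eq, velocity_eq] at h2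
  have := eq_of_log_add_mul_eq hx.neg hu (by simp only [ham] at h2; linarith)
  rw [velocity_eq, speed, ← this]

/-- Optimal trajectories do not cross an interval against the optimal feedback. -/
theorem Standing.not_crossing (S : Standing b c ρ r) {x₀ σ t₁ t₂ y₁ y₂ : ℝ} {u x : ℝ → ℝ}
    (h : Run b c ρ r x₀ u x) (hopt : gain c ρ u x = valueReal b c ρ r x₀) (ht₁ : 0 ≤ t₁)
    (h12 : t₁ ≤ t₂) (hσ : σ * σ = 1) (hy : y₁ < y₂) (h1 : y₂ ≤ σ * x t₁) (h2 : σ * x t₂ ≤ y₁)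
    (hcl : ∀ y ∈ Icc y₁ y₂, IsClassicalAt b c ρ r (σ * y))
    (hst : ∀ y ∈ Icc y₁ y₂, HasStrictDerivAt (valueReal b c ρ r) (costate b c ρ r (σ * y)) (σ * y))
    (hsp : ∀ y ∈ Icc y₁ y₂, 0 < σ * speed b c ρ r (σ * y)) : False := by
  -- The chain rule needs a Lipschitz bound, which strict differentiability supplies only near a
  -- point; crossing a small interval around the midpoint suffices. The sign σ = ±1 treats both
  -- directions at once.
  set m := (y₁ + y₂) / 2 with hm
  have hmI : m ∈ Icc y₁ y₂ := ⟨by linarith, by linarith⟩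
  obtain ⟨K, s, hs, hL⟩ := (hst m hmI).hasStrictFDerivAt.exists_lipschitzOnWith
  have hs' : ∀ᶠ y in 𝓝 m, σ * y ∈ s :=
    (continuous_const.mul continuous_id).continuousAt.eventually_mem hs
  obtain ⟨δ, hδ, hball⟩ := Metric.eventually_nhds_iff.1 hs'
  set η := min (δ / 2) ((y₂ - y₁) / 2) with hη
  have hηpos : 0 < η := lt_min (by linarith) (by linarith)
  have hη1 : η ≤ δ / 2 := min_le_left _ _
  have hη2 : η ≤ (y₂ - y₁) / 2 := min_le_right _ _
  have hin : ∀ y ∈ Icc (m - η) (m + η), y ∈ Icc y₁ y₂ ∧ σ * y ∈ s := fun y hy =>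
    ⟨⟨by linarith [hy.1], by linarith [hy.2]⟩, hball (by
      rw [Real.dist_eq, abs_lt]; exact ⟨by linarith [hy.1], by linarith [hy.2]⟩)⟩
  have hxc : ContinuousOn (fun t => σ * x t) (Icc t₁ t₂) :=
    continuousOn_const.mul (h.continuousOn.mono fun t ht => ht₁.trans ht.1)
  obtain ⟨a, a', ha, haa', ha', hxa, hxa', hmem⟩ := exists_crossing h12 hxc
    (show m - η < m + η by linarith) (by linarith) (by linarith)
  have hσσ : ∀ t, σ * (σ * x t) = x t := fun t => by rw [← mul_assoc, hσ, one_mul]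
  have ha0 := ht₁.trans ha
  have hae := S.velocity_ae_eq h hopt ha0 haa'.le (A := x '' Icc a a') (K := K)
    (fun t ht => mem_image_of_mem _ ht)
    (hL.mono (by rintro _ ⟨t, ht, rfl⟩; rw [← hσσ]; exact (hin _ (hmem t ht)).2))
    (by rintro _ ⟨t, ht, rfl⟩; rw [← hσσ]; exact hcl _ (hin _ (hmem t ht)).1)
  have heq := h.eq_add_integral S.rate ha0 (ha0.trans haa'.le)
  have hint : 0 ≤ ∫ t in a..a', σ * velocity b r u x t := by
    refine intervalIntegral.integral_nonneg_of_ae_restrict haa'.le ?_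
    rw [← restrict_Ioc_eq_restrict_Icc]
    refine (ae_restrict_iff' measurableSet_Ioc).2 ?_
    filter_upwards [hae] with t ht htI
    rw [ht htI, ← hσσ t]
    exact (hsp _ (hin _ (hmem t ⟨htI.1.le, htI.2⟩)).1).le
  rw [intervalIntegral.integral_const_mul] at hint
  rw [heq, mul_add] at hxa'
  linarith

/-! ### Points of rest -/

/-- The running benefit of staying at `x`. -/
def stay (b c : ℝ) (r : ℝ → ℝ) (x : ℝ) : ℝ := Real.log (-drift b r x) - c * x ^ 2

/-- `(ρ - g') / g + 2 c x` for the drift `g`; steady states are its zeros with `g < 0`. -/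
def defect (b c ρ : ℝ) (r : ℝ → ℝ) (x : ℝ) : ℝ :=
  (ρ - (deriv r x - b)) / drift b r x + 2 * c * x

theorem Standing.hasDerivAt_stay (S : Standing b c ρ r) {x : ℝ} (hx : 0 < x)
    (hg : drift b r x < 0) :
    HasDerivAt (stay b c r) (ρ / drift b r x - defect b c ρ r x) x := by
  have h1 := ((S.rate.hasDerivAt_drift (b := b) hx).fun_neg.log (neg_pos.2 hg).ne').fun_sub
    (((hasDerivAt_id x).fun_pow 2).const_mul c)
  convert! h1 using 1
  simp only [defect, id]
  have := hg.ne
  field_simp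
  push_cast
  ring

namespace Standing

theorem eventually_move_nhdsWithin (S : Standing b c ρ r) {x v κ : ℝ} (hx : 0 < x) (hv0 : v ≠ 0)
    (hv : 0 < v - drift b r x)
    (hκ : ρ * valueReal b c ρ r x - Real.log (v - drift b r x) + c * x ^ 2 < κ) :
    ∀ᶠ y in 𝓝 x, 0 < (y - x) / v →
      valueReal b c ρ r y ≤ valueReal b c ρ r x + κ * ((y - x) / v) := by
  have ht : Tendsto (fun y => (y - x) / v) (𝓝[{y | 0 < (y - x) / v}] x) (𝓝[>] 0) := by
    refine tendsto_nhdsWithin_iff.2 ⟨?_, ?_⟩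
    · have : Continuous (fun y => (y - x) / v) := by fun_prop
      have := this.tendsto x
      rw [sub_self, zero_div] at this
      exact this.mono_left nhdsWithin_le_nhds
    · exact self_mem_nhdsWithin
  refine eventually_nhdsWithin_iff.1 ((ht.eventually (S.eventually_move hx hv hκ)).mono ?_)
  intro y hy
  rwa [mul_div_cancel₀ _ hv0, add_sub_cancel] at hy

theorem hasDerivAt_log_ratio {g : ℝ} (hg : g < 0) :
    HasDerivAt (fun v => Real.log (-g) - Real.log (v - g)) (1 / g) 0 := by
  have h := (((hasDerivAt_id (0 : ℝ)).sub_const g).log (by simpa using hg.ne)).const_sub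
    (Real.log (-g))
  convert! h using 1
  simp only [id, zero_sub]
  rw [div_neg, neg_neg]

/-- V ≥ stay/ρ nearby, with equality at z. Comparing with a move at velocity v yields d v ≤ ρ(ln(-g)
- ln(v - g)), where d is the slope of `stay` at z. Equality holds at v = 0, so the derivatives in v
agree there: d = ρ/g. -/
theorem defect_eq_zero_of_isRest (S : Standing b c ρ r) {z : ℝ} (hz : 0 < z)
    (h : IsRest b c ρ r z) : defect b c ρ r z = 0 := by
  obtain ⟨hg, hV⟩ := h
  set g := drift b r z with hgdef
  set d := ρ / g - defect b c ρ r z with hd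
  have hst := S.hasDerivAt_stay hz hg
  rw [← hgdef, ← hd] at hst
  have key : ∀ v, g < v → d * v ≤ ρ * (Real.log (-g) - Real.log (v - g)) := by
    intro v hv
    suffices d * v / ρ ≤ Real.log (-g) - Real.log (v - g) by
      rwa [div_le_iff₀' S.rho_pos] at this
    refine le_of_forall_gt_imp_ge_of_dense fun κ hκ => ?_
    rw [div_le_iff₀ S.rho_pos, mul_comm κ ρ]
    have hmove := S.eventually_move (v := v) (κ := κ) hz (by linarith) (by linarith)
    have hder : HasDerivAt (fun T => stay b c r (z + v * T)) (d * v) 0 := by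
      have h1 : HasDerivAt (fun T : ℝ => z + v * T) v 0 := by
        simpa using ((hasDerivAt_id (0 : ℝ)).const_mul v).const_add z
      exact HasDerivAt.comp (h₂ := stay b c r) 0 (by simpa using hst) h1
    have hsl := hder.tendsto_slope_zero.mono_left (nhdsGT_le_nhdsNE 0)
    refine le_of_tendsto hsl ?_
    have hc : Tendsto (fun T : ℝ => z + v * T) (𝓝[>] 0) (𝓝 z) := by
      have : Continuous (fun T : ℝ => z + v * T) := by fun_prop
      have := this.tendsto 0
      rw [mul_zero, add_zero] at this
      exact this.mono_left nhdsWithin_le_nhds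
    filter_upwards [hmove, self_mem_nhdsWithin, hc.eventually (lt_mem_nhds hz),
      hc.eventually ((S.continuousAt_drift hz).eventually (gt_mem_nhds hg))] with T h1 h2 h3 h4
    have h5 := S.log_neg_drift_le h3 h4
    have h6 := mul_le_mul_of_nonneg_left h1 S.rho_pos.le
    have hT : 0 < T := h2
    simp only [zero_add, mul_zero, add_zero, smul_eq_mul]
    rw [inv_mul_le_iff₀ hT]
    simp only [stay]
    rw [← hgdef]
    linarith
  have hmin : IsLocalMin (fun v => ρ * (Real.log (-g) - Real.log (v - g)) - d * v) 0 := by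
    filter_upwards [lt_mem_nhds hg] with v hv
    have := key v hv
    simp only [zero_sub, sub_self, mul_zero]
    linarith
  have hder := ((hasDerivAt_log_ratio hg).const_mul ρ).fun_sub
    ((hasDerivAt_id (0 : ℝ)).const_mul d)
  have h0 := hmin.hasDerivAt_eq_zero hder
  have : ρ * (1 / g) = ρ / g := by ring
  linarith

/-- From below V is supported by stay/ρ, whose slope at z is 1/g once the defect vanishes. From
above, moves at small velocities of either sign cost slope 1/g up to ε. -/
theorem hasDerivAt_of_isRest (S : Standing b c ρ r) {z : ℝ} (hz : 0 < z)
    (h : IsRest b c ρ r z) : HasDerivAt (valueReal b c ρ r) (1 / drift b r z) z := by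
  have hk := S.defect_eq_zero_of_isRest hz h
  obtain ⟨hg, hV⟩ := h
  have hst := S.hasDerivAt_stay hz hg
  rw [hk, sub_zero] at hst
  set g := drift b r z with hgdef
  rw [hasDerivAt_iff_isLittleO, Asymptotics.isLittleO_iff]
  intro ε hε
  have hlow : ∀ᶠ y in 𝓝 z, (1 / g) * (y - z) - ε * |y - z| ≤
      valueReal b c ρ r y - valueReal b c ρ r z := by
    have h1 := (Asymptotics.isLittleO_iff.1 (hasDerivAt_iff_isLittleO.1 hst))
      (mul_pos S.rho_pos hε)
    filter_upwards [h1, lt_mem_nhds hz,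
      (S.continuousAt_drift hz).eventually (gt_mem_nhds hg)] with y hy hy0 hyg
    have h2 := S.log_neg_drift_le hy0 hyg
    rw [Real.norm_eq_abs, Real.norm_eq_abs, smul_eq_mul] at hy
    have h3 := (abs_le.1 hy).1
    simp only [stay] at h3
    rw [← hgdef] at h3
    have e : (y - z) * (ρ / g) = ρ * ((1 / g) * (y - z)) := by ring
    rw [e] at h3
    refine le_of_mul_le_mul_left ?_ S.rho_pos
    linarith
  have hup : ∀ v, v ≠ 0 → g < v →
      Real.log (-g) - Real.log (v - g) < (1 / g) * v + ε * |v| →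
      ∀ᶠ y in 𝓝 z, 0 < (y - z) / v → valueReal b c ρ r y - valueReal b c ρ r z ≤
        (1 / g) * (y - z) + ε * |y - z| := by
    intro v hv0 hv hlt
    filter_upwards [S.eventually_move_nhdsWithin (v := v) (κ := (1 / g) * v + ε * |v|) hz hv0
      (by linarith) (by linarith)] with y hy hpos
    have h1 := hy hpos
    have h2 : |v| * ((y - z) / v) = |y - z| := by
      rw [← abs_of_pos hpos, ← abs_mul, mul_div_cancel₀ _ hv0]
    have h3 : v * ((y - z) / v) = y - z := mul_div_cancel₀ _ hv0
    have h4 : ((1 / g) * v + ε * |v|) * ((y - z) / v) = (1 / g) * (y - z) + ε * |y - z| := by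
      rw [add_mul, mul_assoc, h3, mul_assoc, h2]
    linarith
  have hsmall : ∀ᶠ v in 𝓝 (0 : ℝ), v ≠ 0 →
      Real.log (-g) - Real.log (v - g) < (1 / g) * v + ε * |v| := by
    filter_upwards [Asymptotics.isLittleO_iff.1
      (hasDerivAt_iff_isLittleO.1 (hasDerivAt_log_ratio hg)) (half_pos hε)] with v hv hv0
    simp only [zero_sub, sub_self, sub_zero, Real.norm_eq_abs, smul_eq_mul] at hv
    have h1 := (abs_le.1 hv).2
    have h2 := mul_pos hε (abs_pos.2 hv0)
    linarith
  obtain ⟨δ, hδ, hball⟩ := Metric.eventually_nhds_iff.1 (hsmall.and (lt_mem_nhds hg))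
  have hd1 : dist (δ / 2) 0 < δ := by
    rw [Real.dist_eq, sub_zero, abs_of_pos (half_pos hδ)]; linarith
  have hd2 : dist (-(δ / 2)) 0 < δ := by
    rw [Real.dist_eq, sub_zero, abs_neg, abs_of_pos (half_pos hδ)]; linarith
  have hne : δ / 2 ≠ 0 := (half_pos hδ).ne'
  filter_upwards [hlow, hup _ hne (hball hd1).2 ((hball hd1).1 hne),
    hup _ (neg_ne_zero.2 hne) (hball hd2).2 ((hball hd2).1 (neg_ne_zero.2 hne))]
    with y h1 h2 h3
  rw [Real.norm_eq_abs, Real.norm_eq_abs, smul_eq_mul, mul_comm, abs_le]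
  refine ⟨by linarith, ?_⟩
  rcases lt_trichotomy y z with hyz | rfl | hyz
  · have := h3 (div_pos_of_neg_of_neg (by linarith) (by linarith)); linarith
  · simp
  · have := h2 (div_pos (by linarith) (by linarith)); linarith

theorem isClassicalAt_of_isRest (S : Standing b c ρ r) {z : ℝ} (hz : 0 < z)
    (h : IsRest b c ρ r z) : IsClassicalAt b c ρ r z :=
  .of_hasDerivAt (S.hasDerivAt_of_isRest hz h) (one_div_neg.2 h.1) (by
    rw [ham_inv_drift h.1, h.2])

end Standing

/-! ### The value function near points of rest -/

/-- The relative deviation of the costate from `1 / g`, for which the feedback speed vanishes. -/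
def excess (b c ρ : ℝ) (r : ℝ → ℝ) (x : ℝ) : ℝ := costate b c ρ r x * drift b r x - 1

theorem neg_one_lt_excess {x : ℝ} (h : IsClassicalAt b c ρ r x) (hg : drift b r x < 0) :
    -1 < excess b c ρ r x := by
  have := mul_pos_of_neg_of_neg h.neg hg
  simp only [excess]; linarith

/-- The Hamilton-Jacobi equation in the variable s = V'g - 1: s - ln(1 + s) is the gap between ρV
and the benefit of staying, so s² is controlled by that gap. -/
theorem excess_sub_log {x : ℝ} (h : IsClassicalAt b c ρ r x) (hg : drift b r x < 0) :
    excess b c ρ r x - Real.log (1 + excess b c ρ r x) =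
      ρ * valueReal b c ρ r x - stay b c r x := by
  have h1 : 1 + excess b c ρ r x = -costate b c ρ r x * -drift b r x := by
    simp only [excess]; ring
  rw [h1, Real.log_mul (neg_pos.2 h.neg).ne' (neg_pos.2 hg).ne', ← h.ham_eq]
  simp only [excess, ham, stay]
  ring

theorem speed_eq {x : ℝ} (h : IsClassicalAt b c ρ r x) (hg : drift b r x < 0) :
    speed b c ρ r x = drift b r x * excess b c ρ r x / (1 + excess b c ρ r x) := by
  have h1 := h.neg.ne
  have h2 := hg.ne
  simp only [excess, speed, add_sub_cancel]
  field_simp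
  ring

theorem costate_eq {x : ℝ} (hg : drift b r x < 0) :
    costate b c ρ r x = (1 + excess b c ρ r x) / drift b r x := by
  rw [eq_div_iff hg.ne]; simp only [excess]; ring

namespace Standing

theorem differentiableAt_defect (S : Standing b c ρ r) {x : ℝ} (hx : 0 < x)
    (hg : drift b r x < 0) : DifferentiableAt ℝ (defect b c ρ r) x := by
  have h1 : DifferentiableAt ℝ (deriv r) x :=
    (S.rate.contDiffAt_deriv hx).differentiableAt (by norm_num)
  have h2 : DifferentiableAt ℝ (drift b r) x := (S.rate.hasDerivAt_drift hx).differentiableAt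
  unfold defect
  exact (((h1.sub_const b).const_sub ρ).fun_div h2 hg.ne).fun_add (by fun_prop)

/-- The gap E = ρV - stay at distance y on the side σ = ±1 has derivative σ(ρs/g + defect), where s
is the excess. Here |s| ≤ √(12E) and the defect is O(y), so `le_quadratic_of_deriv_le_sqrt` gives E
= O(y²), hence s = O(y) and a speed of order y. -/
theorem exists_bound_near_rest (S : Standing b c ρ r) {z σ δ₀ : ℝ} (hz : 0 < z)
    (h : IsRest b c ρ r z) (hσ : σ * σ = 1) (hδ₀ : 0 < δ₀)
    (hcl : ∀ y ∈ Ioo 0 δ₀, IsClassicalAt b c ρ r (z + σ * y)) :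
    ∃ δ > 0, δ ≤ δ₀ ∧ ∃ C ≥ 0, ∀ y ∈ Ioo 0 δ, 0 < z + σ * y ∧ drift b r (z + σ * y) < 0 ∧
      |excess b c ρ r (z + σ * y)| ≤ C * y ∧ |speed b c ρ r (z + σ * y)| ≤ C * y ∧
      |costate b c ρ r (z + σ * y)| ≤ C := by
  have hk := S.defect_eq_zero_of_isRest hz h
  obtain ⟨hg, hV⟩ := h
  have hσabs : |σ| = 1 := by
    have : |σ| * |σ| = 1 := by rw [← abs_mul, hσ, abs_one]
    nlinarith [abs_nonneg σ]
  set γ := -drift b r z with hγ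
  have hγpos : 0 < γ := neg_pos.2 hg
  obtain ⟨C₂, hC₂pos, hC₂⟩ := ((S.differentiableAt_defect hz hg).hasDerivAt.isBigO_sub).exists_pos
  have hDc : ContinuousAt (fun x => ρ * valueReal b c ρ r x - stay b c r x) z :=
    (continuousAt_const.mul (S.continuousAt_value hz)).sub (S.hasDerivAt_stay hz hg).continuousAt
  have hD0 : ρ * valueReal b c ρ r z - stay b c r z = 0 := by rw [hV, stay, sub_self]
  -- With E below 1/48 the bound s² ≤ 12E gives |s| ≤ 1/2, which keeps 1 + s away from 0.
  have e1 : ∀ᶠ x in 𝓝 z, ρ * valueReal b c ρ r x - stay b c r x < 1 / 48 :=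
    hDc.eventually (gt_mem_nhds (by beta_reduce; rw [hD0]; norm_num))
  have e2 : ∀ᶠ x in 𝓝 z, drift b r x ∈ Ioo (-(2 * γ)) (-(γ / 2)) :=
    (S.continuousAt_drift hz).eventually (Ioo_mem_nhds (by linarith) (by linarith))
  have hpath : Tendsto (fun y : ℝ => z + σ * y) (𝓝[>] 0) (𝓝 z) := by
    have : Continuous (fun y : ℝ => z + σ * y) := by fun_prop
    have := this.tendsto 0
    rw [mul_zero, add_zero] at this
    exact this.mono_left nhdsWithin_le_nhds
  obtain ⟨δ, hδ, hall⟩ := (mem_nhdsGT_iff_exists_Ioo_subset' (show (0 : ℝ) < δ₀ from hδ₀)).1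
    (inter_mem (hpath.eventually ((e1.and e2).and (hC₂.bound.and (lt_mem_nhds hz))))
      (Ioo_mem_nhdsGT hδ₀))
  have hδpos : 0 < δ := hδ
  set E := fun y => ρ * valueReal b c ρ r (z + σ * y) - stay b c r (z + σ * y) with hE
  have hN : ∀ y ∈ Ioo 0 δ, IsClassicalAt b c ρ r (z + σ * y) ∧ E y < 1 / 48 ∧
      drift b r (z + σ * y) ∈ Ioo (-(2 * γ)) (-(γ / 2)) ∧
      |defect b c ρ r (z + σ * y)| ≤ C₂ * y ∧ 0 < z + σ * y := by
    intro y hy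
    obtain ⟨⟨⟨h1, h2⟩, h3, h4⟩, h5⟩ := hall hy
    refine ⟨hcl y h5, h1, h2, ?_, h4⟩
    rw [hk, sub_zero, add_sub_cancel_left, Real.norm_eq_abs, Real.norm_eq_abs, abs_mul, hσabs,
      one_mul, abs_of_pos hy.1] at h3
    exact h3
  have hs : ∀ y ∈ Ioo 0 δ, excess b c ρ r (z + σ * y) ^ 2 ≤ 12 * E y := fun y hy => by
    obtain ⟨h1, h2, h3, -, -⟩ := hN y hy
    have hgy : drift b r (z + σ * y) < 0 := h3.2.trans (by linarith)
    exact sq_le_of_sub_log_eq (neg_one_lt_excess h1 hgy) (excess_sub_log h1 hgy) (by linarith)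
  have hsabs : ∀ y ∈ Ioo 0 δ, |excess b c ρ r (z + σ * y)| ≤ √12 * √(E y) := fun y hy => by
    rw [← Real.sqrt_mul (by norm_num)]
    exact Real.abs_le_sqrt (hs y hy)
  set C₁ := ρ * (2 / γ) * √12 with hC₁
  have hC₁nn : 0 ≤ C₁ := by have := S.rho_pos; positivity
  have hEd : ∀ y ∈ Ioo 0 δ, HasDerivAt E (σ * (ρ * (excess b c ρ r (z + σ * y) /
      drift b r (z + σ * y)) + defect b c ρ r (z + σ * y))) y := by
    intro y hy
    obtain ⟨h1, h2, h3, -, h5⟩ := hN y hy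
    have hgy : drift b r (z + σ * y) < 0 := h3.2.trans (by linarith)
    have hp : HasDerivAt (fun y : ℝ => z + σ * y) σ y := by
      simpa using ((hasDerivAt_id y).const_mul σ).const_add z
    have hV' := HasDerivAt.comp (h₂ := valueReal b c ρ r) y h1.hasDerivAt hp
    have hst' := HasDerivAt.comp (h₂ := stay b c r) y (S.hasDerivAt_stay h5 hgy) hp
    have := (hV'.const_mul ρ).fun_sub hst'
    convert! this using 1
    rw [costate_eq hgy]
    have := hgy.ne
    field_simp
    ring
  have hE0 : Tendsto E (𝓝[>] 0) (𝓝 0) := by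
    have := hDc.tendsto.comp hpath
    rwa [hD0] at this
  have hbd := le_quadratic_of_deriv_le_sqrt (C₁ := C₁) (C₂ := C₂) hC₁nn hC₂pos.le hE0 hEd
    fun y hy => by
      obtain ⟨h1, h2, h3, h4, h5⟩ := hN y hy
      have h6 := hsabs y hy
      have h7 : |excess b c ρ r (z + σ * y) / drift b r (z + σ * y)| ≤
          (2 / γ) * (√12 * √(E y)) := by
        rw [abs_div, div_le_iff₀ (abs_pos.2 (h3.2.trans (by linarith)).ne)]
        have h8 : γ / 2 ≤ |drift b r (z + σ * y)| := by
          rw [abs_of_neg (h3.2.trans (by linarith))]; linarith [h3.2]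
        calc _ ≤ √12 * √(E y) := h6
          _ = (2 / γ) * (√12 * √(E y)) * (γ / 2) := by field_simp
          _ ≤ _ := by gcongr
      refine (le_abs_self _).trans ?_
      rw [abs_mul, hσabs, one_mul]
      refine (abs_add_le _ _).trans (add_le_add ?_ h4)
      rw [abs_mul, abs_of_pos S.rho_pos]
      have := mul_le_mul_of_nonneg_left h7 S.rho_pos.le
      linarith
  set N := C₁ + C₂ + 1 with hNdef
  have hNpos : 0 < N := by positivity
  -- The three entries serve the excess (12N² ≤ (4N)²), the speed (|g| ≤ 2γ and 1 + s ≥ 1/2) and the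
  -- costate ((1 + s)/|g| with |g| ≥ γ/2).
  set C := max (4 * N) (max (16 * γ * N) (4 / γ)) with hC
  have hC1 : 4 * N ≤ C := le_max_left _ _
  have hC2 : 16 * γ * N ≤ C := (le_max_left _ _).trans (le_max_right _ _)
  have hC3 : 4 / γ ≤ C := (le_max_right _ _).trans (le_max_right _ _)
  refine ⟨δ, hδpos, ?_, C, by linarith, fun y hy => ?_⟩
  · by_contra! hlt
    exact lt_irrefl δ₀ (hall (⟨hδ₀, hlt⟩ : δ₀ ∈ Ioo 0 δ)).2.2
  obtain ⟨h1, h2, h3, h4, h5⟩ := hN y hy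
  have hgy : drift b r (z + σ * y) < 0 := h3.2.trans (by linarith)
  set s := excess b c ρ r (z + σ * y) with hsdef
  have hs2 := hs y hy
  have hsy : |s| ≤ 4 * N * y := by
    refine abs_le_of_sq_le_sq ?_ (by have := hy.1; positivity)
    have := hbd y hy
    nlinarith [mul_pos hNpos hy.1]
  have hsh : |s| ≤ 1 / 2 := by
    refine abs_le_of_sq_le_sq ?_ (by norm_num)
    linarith
  have hs1 : 1 / 2 ≤ 1 + s := by linarith [(abs_le.1 hsh).1]
  have hdabs : |drift b r (z + σ * y)| ≤ 2 * γ := by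
    rw [abs_of_neg hgy]; linarith [h3.1]
  refine ⟨h5, hgy, hsy.trans (mul_le_mul_of_nonneg_right hC1 hy.1.le), ?_, ?_⟩
  · rw [speed_eq h1 hgy, ← hsdef, abs_div, abs_mul, abs_of_pos (by linarith : 0 < 1 + s),
      div_le_iff₀ (by linarith)]
    have h6 : |drift b r (z + σ * y)| * |s| ≤ 2 * γ * (4 * N * y) := by gcongr
    have h7 : 16 * γ * N * y ≤ C * y := mul_le_mul_of_nonneg_right hC2 hy.1.le
    have h8 : 0 ≤ C * y := by have := hy.1; nlinarith
    nlinarith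
  · rw [costate_eq hgy, ← hsdef, abs_div, abs_of_pos (by linarith : 0 < 1 + s),
      div_le_iff₀ (abs_pos.2 hgy.ne)]
    have h6 : γ / 2 ≤ |drift b r (z + σ * y)| := by
      rw [abs_of_neg hgy]; linarith [h3.2]
    have h7 : 4 / γ * (γ / 2) ≤ C * |drift b r (z + σ * y)| := by gcongr
    have h8 : 4 / γ * (γ / 2) = 2 := by field_simp; norm_num
    linarith [(abs_le.1 hsh).2]

/-- Optimal trajectories do not leave a point of rest to a side where the value function is a
classical solution. -/
theorem not_departing (S : Standing b c ρ r) {x₀ z σ δ₀ t₁ t₂ : ℝ} {u x : ℝ → ℝ} (hz : 0 < z)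
    (hrest : IsRest b c ρ r z) (hσ : σ * σ = 1) (hδ₀ : 0 < δ₀)
    (hcl : ∀ y ∈ Ioo 0 δ₀, IsClassicalAt b c ρ r (z + σ * y))
    (h : Run b c ρ r x₀ u x) (hopt : gain c ρ u x = valueReal b c ρ r x₀) (ht₁ : 0 ≤ t₁)
    (h12 : t₁ ≤ t₂) (h1 : σ * (x t₁ - z) ≤ 0) (h2 : 0 < σ * (x t₂ - z)) : False := by
  obtain ⟨δ, hδ, hδδ₀, C, hC, hbd⟩ := S.exists_bound_near_rest hz hrest hσ hδ₀ hcl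
  have hσabs : |σ| = 1 := by
    have : |σ| * |σ| = 1 := by rw [← abs_mul, hσ, abs_one]
    nlinarith [abs_nonneg σ]
  have hxc : ContinuousOn (fun t => -(σ * (x t - z))) (Icc t₁ t₂) :=
    (continuousOn_const.mul ((h.continuousOn.mono fun t ht => ht₁.trans ht.1).sub
      continuousOn_const)).neg
  obtain ⟨a, ha, hxa, hlast⟩ := exists_last_time (c := 0) h12 hxc (by linarith) (by linarith)
  have hevt : ∀ᶠ t in 𝓝[>] a, -(δ / 2) < -(σ * (x t - z)) := by
    have hI : Icc t₁ t₂ ∈ 𝓝[>] a :=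
      mem_of_superset (Ioo_mem_nhdsGT ha.2) fun t ht => ⟨ha.1.trans ht.1.le, ht.2.le⟩
    have := (hxc a ⟨ha.1, ha.2.le⟩).tendsto.mono_left (nhdsWithin_le_of_mem hI)
    refine this.eventually (lt_mem_nhds ?_)
    rw [hxa]; linarith
  obtain ⟨a', ha', hall⟩ := (mem_nhdsGT_iff_exists_Ioo_subset' ha.2).1 hevt
  set e := (a + min a' t₂) / 2 with he
  have haa' : a < min a' t₂ := lt_min ha' ha.2
  have hae : a < e := by linarith
  have hea' : e < a' := (by linarith : e < min a' t₂).trans_le (min_le_left _ _)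
  have het₂ : e ≤ t₂ := (by linarith : e < min a' t₂).le.trans (min_le_right _ _)
  have ha0 : 0 ≤ a := ht₁.trans ha.1
  have hσσ : ∀ t, x t = z + σ * (σ * (x t - z)) := fun t => by
    rw [← mul_assoc, hσ, one_mul]; ring
  have hmem : ∀ t ∈ Ioc a e, σ * (x t - z) ∈ Ioo 0 δ := fun t ht => by
    have h3 := hlast t ⟨ht.1, ht.2.trans het₂⟩
    have h4 : -(δ / 2) < -(σ * (x t - z)) := hall ⟨ht.1, ht.2.trans_lt hea'⟩
    exact ⟨by linarith, by linarith⟩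
  have hmem' : ∀ t ∈ Icc a e, σ * (x t - z) ∈ Icc 0 (δ / 2) := fun t ht => by
    rcases ht.1.eq_or_lt with h3 | h3
    · rw [← h3, neg_eq_zero.1 hxa]; exact ⟨le_rfl, by linarith⟩
    · have h4 : -(δ / 2) < -(σ * (x t - z)) := hall ⟨h3, ht.2.trans_lt hea'⟩
      exact ⟨(hmem t ⟨h3, ht.2⟩).1.le, by linarith⟩
  set A := (fun y => z + σ * y) '' Icc 0 (δ / 2) with hA
  have hAcl : ∀ w ∈ A, IsClassicalAt b c ρ r w := by
    rintro _ ⟨y, hy, rfl⟩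
    rcases hy.1.eq_or_lt with h3 | h3
    · beta_reduce; rw [← h3, mul_zero, add_zero]; exact S.isClassicalAt_of_isRest hz hrest
    · exact hcl y ⟨h3, by linarith [hy.2]⟩
  set B := max C |costate b c ρ r z| with hB
  have hAconv : Convex ℝ A := by
    have : A = (fun w => z + w) '' ((fun y => σ • y) '' Icc 0 (δ / 2)) := by
      rw [image_image]; rfl
    rw [this]
    exact ((convex_Icc 0 (δ / 2)).smul σ).translate z
  have hLip : LipschitzOnWith B.toNNReal (valueReal b c ρ r) A := by
    refine hAconv.lipschitzOnWith_of_nnnorm_hasDerivWithin_le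
      (f' := costate b c ρ r) (fun w hw => (hAcl w hw).hasDerivAt.hasDerivWithinAt) ?_
    rintro _ ⟨y, hy, rfl⟩
    rw [← NNReal.coe_le_coe, coe_nnnorm, Real.norm_eq_abs,
      Real.coe_toNNReal _ (hC.trans (le_max_left _ _))]
    rcases hy.1.eq_or_lt with h3 | h3
    · beta_reduce; rw [← h3, mul_zero, add_zero]; exact le_max_right _ _
    · exact (hbd y ⟨h3, by linarith [hy.2]⟩).2.2.2.2.trans (le_max_left _ _)
  have hvel := S.velocity_ae_eq h hopt ha0 hae.le
    (fun t ht => (⟨_, hmem' t ht, (hσσ t).symm⟩ : x t ∈ A)) hLip hAcl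
  have heq : ∀ t ∈ Icc a e, -(σ * (x t - z)) = -(σ * (x a - z)) +
      ∫ s in a..t, -σ * velocity b r u x s := fun t ht => by
    rw [intervalIntegral.integral_const_mul, h.eq_add_integral S.rate ha0 (ha0.trans ht.1)]
    ring
  -- The signed distance to z moves at a rate of at most C times itself, so by Grönwall it cannot
  -- become positive after being 0.
  have := not_lt_of_speed_ge (x := fun t => -(σ * (x t - z))) hae.le hC
    ((h.intervalIntegrable_velocity S.rate ha0 (ha0.trans hae.le)).const_mul (-σ)) heq hxa (by
      filter_upwards [hvel] with t ht htI
      rw [ht htI, zero_sub, neg_neg]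
      have h3 := (hbd _ (hmem t htI)).2.2.2.1
      rw [← hσσ t] at h3
      have h4 : |σ * speed b c ρ r (x t)| ≤ C * (σ * (x t - z)) := by
        rw [abs_mul, hσabs, one_mul]; exact h3
      linarith [(abs_le.1 h4).2])
  linarith [(hmem e ⟨hae, le_rfl⟩).1]

/-! ### Global structure -/

/-- The trajectory passes below every y in (e, x₀). At a non-rest y that does not move left, the
dichotomy produces a right-moving strip just above y, to be crossed the wrong way. A rest point y
would have to be left downwards, where V is classical at rest and non-rest points alike. -/
theorem movesLeftAt_of_tendsto (S : Standing b c ρ r) {x₀ e : ℝ} {u x : ℝ → ℝ} (he : 0 ≤ e)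
    (h : Run b c ρ r x₀ u x) (hopt : gain c ρ u x = valueReal b c ρ r x₀)
    (hlim : Tendsto x atTop (𝓝 e)) : ∀ y ∈ Ioo e x₀, MovesLeftAt b c ρ r y := by
  have hreach : ∀ y, e < y → ∃ T, 0 ≤ T ∧ x T < y := fun y hy => by
    obtain ⟨T, h1, h2⟩ := ((hlim.eventually (gt_mem_nhds hy)).and (eventually_ge_atTop 0)).exists
    exact ⟨T, h2, h1⟩
  have key : ∀ y ∈ Ioo e x₀, ¬ IsRest b c ρ r y → MovesLeftAt b c ρ r y := by
    intro y hy hZ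
    by_contra hL
    obtain ⟨δ, hδ, hloc⟩ := S.exists_local_dichotomy (he.trans_lt hy.1) hZ
    set η := min δ (x₀ - y) / 4 with hη
    have h1 : min δ (x₀ - y) ≤ δ := min_le_left _ _
    have h2 : min δ (x₀ - y) ≤ x₀ - y := min_le_right _ _
    have h3 : 0 < min δ (x₀ - y) := lt_min hδ (by linarith [hy.2])
    rcases hloc (y + η) with h4 | h4
    · have hR : ∀ w ∈ Icc (y + 2 * η) (y + 3 * η), MovesRightAt b c ρ r w := fun w hw =>
        h4 w ⟨by linarith [hw.1], by linarith [hw.2]⟩ (by linarith [hw.1])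
      obtain ⟨T, hT, hxT⟩ := hreach (y + 2 * η) (by linarith [hy.1])
      exact S.not_crossing h hopt le_rfl hT (σ := 1) (one_mul 1)
        (show y + 2 * η < y + 3 * η by linarith) (by rw [h.initial]; linarith)
        (by linarith) (fun w hw => by rw [one_mul]; exact (hR w hw).isClassicalAt)
        (fun w hw => by rw [one_mul]; exact (hR w hw).hasStrictDerivAt)
        (fun w hw => by rw [one_mul, one_mul]; exact (hR w hw).speed_pos)
    · exact hL (h4 y ⟨by linarith, by linarith⟩ (by linarith))
  intro y hy
  refine key y hy fun hrest => ?_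
  obtain ⟨T, hT, hxT⟩ := hreach y hy.1
  have hy0 := he.trans_lt hy.1
  refine S.not_departing hy0 hrest (σ := -1) (by norm_num) (sub_pos.2 hy.1) (fun w hw => ?_)
    h hopt le_rfl hT (by rw [h.initial]; linarith [hy.2]) (by linarith)
  have hw' : y + -1 * w ∈ Ioo e x₀ := ⟨by linarith [hw.2], by linarith [hw.1, hy.2]⟩
  by_cases hZ : IsRest b c ρ r (y + -1 * w)
  · exact S.isClassicalAt_of_isRest (he.trans_lt hw'.1) hZ
  · exact (key _ hw' hZ).isClassicalAt

theorem movesRightAt_of_tendsto (S : Standing b c ρ r) {x₀ e : ℝ} {u x : ℝ → ℝ} (hx₀ : 0 ≤ x₀)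
    (h : Run b c ρ r x₀ u x) (hopt : gain c ρ u x = valueReal b c ρ r x₀)
    (hlim : Tendsto x atTop (𝓝 e)) : ∀ y ∈ Ioo x₀ e, MovesRightAt b c ρ r y := by
  have hreach : ∀ y, y < e → ∃ T, 0 ≤ T ∧ y < x T := fun y hy => by
    obtain ⟨T, h1, h2⟩ := ((hlim.eventually (lt_mem_nhds hy)).and (eventually_ge_atTop 0)).exists
    exact ⟨T, h2, h1⟩
  have key : ∀ y ∈ Ioo x₀ e, ¬ IsRest b c ρ r y → MovesRightAt b c ρ r y := by
    intro y hy hZ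
    by_contra hR
    obtain ⟨δ, hδ, hloc⟩ := S.exists_local_dichotomy (hx₀.trans_lt hy.1) hZ
    set η := min δ (y - x₀) / 4 with hη
    have h1 : min δ (y - x₀) ≤ δ := min_le_left _ _
    have h2 : min δ (y - x₀) ≤ y - x₀ := min_le_right _ _
    have h3 : 0 < min δ (y - x₀) := lt_min hδ (by linarith [hy.1])
    rcases hloc (y - η) with h4 | h4
    · exact hR (h4 y ⟨by linarith, by linarith⟩ (by linarith))
    · have hL : ∀ w ∈ Icc (-(y - 2 * η)) (-(y - 3 * η)), MovesLeftAt b c ρ r (-1 * w) :=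
        fun w hw => h4 _ ⟨by linarith [hw.2], by linarith [hw.1]⟩ (by linarith [hw.1])
      obtain ⟨T, hT, hxT⟩ := hreach (y - 2 * η) (by linarith [hy.2])
      exact S.not_crossing h hopt le_rfl hT (σ := -1) (by norm_num)
        (show -(y - 2 * η) < -(y - 3 * η) by linarith) (by rw [h.initial]; linarith)
        (by linarith) (fun w hw => (hL w hw).isClassicalAt)
        (fun w hw => (hL w hw).hasStrictDerivAt)
        (fun w hw => by rw [neg_one_mul]; exact neg_pos.2 (hL w hw).speed_neg)
  intro y hy
  refine key y hy fun hrest => ?_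
  obtain ⟨T, hT, hxT⟩ := hreach y hy.2
  have hy0 := hx₀.trans_lt hy.1
  refine S.not_departing hy0 hrest (σ := 1) (by norm_num) (sub_pos.2 hy.2) (fun w hw => ?_)
    h hopt le_rfl hT (by rw [h.initial]; linarith [hy.1]) (by linarith)
  have hw' : y + 1 * w ∈ Ioo x₀ e := ⟨by linarith [hw.1, hy.1], by linarith [hw.2]⟩
  by_cases hZ : IsRest b c ρ r (y + 1 * w)
  · exact S.isClassicalAt_of_isRest (hx₀.trans_lt hw'.1) hZ
  · exact (key _ hw' hZ).isClassicalAt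

/-- Otherwise all of (0, x₁) moves left. Negative speed and g ≥ -bx give -V' > 1/(bx), so V + (1/b)
ln x decreases and V is unbounded at 0, against V ≤ V(0). -/
theorem movesRightAt_of_no_rest (S : Standing b c ρ r) {e : ℝ}
    (hZ : ∀ x ∈ Ioo 0 e, ¬ IsRest b c ρ r x) : ∀ x ∈ Ioo 0 e, MovesRightAt b c ρ r x := by
  intro x₁ hx₁
  by_contra hR
  have hL := S.movesLeftAt_of_not_movesRightAt le_rfl hZ hx₁ hR
  set V := valueReal b c ρ r with hV
  set f := fun x => V x + 1 / b * Real.log x with hf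
  have hfd : ∀ x ∈ Ioo 0 x₁, HasDerivAt f (costate b c ρ r x + 1 / b * (1 / x)) x := fun x hx => by
    have h1 := (Real.hasDerivAt_log hx.1.ne').const_mul (1 / b)
    rw [← one_div] at h1
    exact (hL x hx).isClassicalAt.hasDerivAt.fun_add h1
  have hanti : AntitoneOn f (Ioo 0 x₁) := by
    refine antitoneOn_of_hasDerivWithinAt_nonpos (convex_Ioo _ _)
      (fun x hx => (hfd x hx).continuousAt.continuousWithinAt)
      (fun x hx => (hfd x (interior_subset hx)).hasDerivWithinAt) fun x hx => ?_
    have hx' := interior_subset hx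
    have h1 := (hL x hx').speed_neg
    have h2 := (hL x hx').isClassicalAt.neg
    have h3 := S.rate.neg_le_drift (b := b) hx'.1.le
    have hbx := mul_pos S.b_pos hx'.1
    rw [speed, show -1 / costate b c ρ r x = 1 / -costate b c ρ r x by
      rw [div_neg, neg_div]] at h1
    have h4 : 1 / -costate b c ρ r x < b * x := by linarith
    have h5 := (one_div_lt (neg_pos.2 h2) hbx).1 h4
    have h6 : 1 / b * (1 / x) = 1 / (b * x) := by rw [div_mul_div_comm, one_mul]
    rw [h6]; linarith
  set w := x₁ / 2 with hw
  have hw0 : 0 < w := by linarith [hx₁.1]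
  have hVw : V w ≤ V 0 := S.antitoneOn_value (mem_Ici.2 le_rfl) (mem_Ici.2 hw0.le) hw0.le
  -- Going from w down to w e^{-E} raises V by at least E/b = V(0) - V(w) + 1.
  set E := b * (V 0 - V w + 1) with hE
  have hEpos : 0 < E := mul_pos S.b_pos (by linarith)
  set y := w * Real.exp (-E) with hy
  have hy0 : 0 < y := mul_pos hw0 (Real.exp_pos _)
  have hyw : y ≤ w := mul_le_of_le_one_right hw0.le (Real.exp_le_one_iff.2 (by linarith))
  have h1 := hanti ⟨hy0, by linarith [hx₁.1]⟩ (⟨hw0, by linarith [hx₁.1]⟩ : w ∈ Ioo 0 x₁) hyw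
  have h2 : V y ≤ V 0 := S.antitoneOn_value (mem_Ici.2 le_rfl) (mem_Ici.2 hy0.le) hy0.le
  simp only [hf] at h1
  rw [hy, Real.log_mul hw0.ne' (Real.exp_pos _).ne', Real.log_exp, ← hy, mul_add] at h1
  have h3 : 1 / b * -E = -(V 0 - V w + 1) := by
    rw [hE]; have := S.b_pos.ne'; field_simp
  linarith

/-- Otherwise a half-line moves right. There g ≤ -bx/2 from some point on, so -V' < 2/(bx) and V
decreases at most logarithmically, against the quadratic upper bound. -/
theorem movesLeftAt_of_no_rest (S : Standing b c ρ r) {e : ℝ} (he : 0 ≤ e)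
    (hZ : ∀ x ∈ Ioi e, ¬ IsRest b c ρ r x) : ∀ x ∈ Ioi e, MovesLeftAt b c ρ r x := by
  intro x₁ hx₁
  by_contra hL
  have hR : ∀ x, x₁ < x → MovesRightAt b c ρ r x := fun x hx =>
    S.movesRightAt_of_not_movesLeftAt (β := x + 1) he (fun y hy => hZ y hy.1)
      ⟨hx₁, by linarith⟩ hL x ⟨hx, by linarith⟩
  have hx₁0 : 0 < x₁ := he.trans_lt hx₁
  obtain ⟨a, ha, hra⟩ := S.rate.exists_bound
  set X := max (x₁ + 1) (2 * a / b) with hX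
  have hX1 : x₁ + 1 ≤ X := le_max_left _ _
  have hX2 : 2 * a / b ≤ X := le_max_right _ _
  rw [div_le_iff₀ S.b_pos] at hX2
  set V := valueReal b c ρ r with hV
  set f := fun x => V x + 2 / b * Real.log x with hf
  have hfd : ∀ x ∈ Ici X, HasDerivAt f (costate b c ρ r x + 2 / b * (1 / x)) x := fun x hx => by
    rw [mem_Ici] at hx
    have h1 := (Real.hasDerivAt_log (by linarith : 0 < x).ne').const_mul (2 / b)
    rw [← one_div] at h1
    exact (hR x (by linarith)).isClassicalAt.hasDerivAt.fun_add h1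
  have hmono : MonotoneOn f (Ici X) := by
    refine monotoneOn_of_hasDerivWithinAt_nonneg (convex_Ici _)
      (fun x hx => (hfd x hx).continuousAt.continuousWithinAt)
      (fun x hx => (hfd x (interior_subset hx)).hasDerivWithinAt) fun x hx => ?_
    have hx' : X ≤ x := interior_subset hx
    have hx0 : 0 < x := by linarith
    have h1 := (hR x (by linarith)).speed_pos
    have h2 := (hR x (by linarith)).isClassicalAt.neg
    have h3 : drift b r x ≤ -(b * x / 2) := by
      have := hra x hx0.le
      have := mul_le_mul_of_nonneg_right hx' S.b_pos.le
      simp only [drift]; linarith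
    have hbx : 0 < b * x / 2 := by have := S.b_pos; positivity
    rw [speed, show -1 / costate b c ρ r x = 1 / -costate b c ρ r x by
      rw [div_neg, neg_div]] at h1
    have h4 : b * x / 2 < 1 / -costate b c ρ r x := by linarith
    have h5 := (lt_one_div hbx (neg_pos.2 h2)).1 h4
    have h6 : 2 / b * (1 / x) = 1 / (b * x / 2) := by
      have := S.b_pos.ne'; field_simp
    rw [h6]; linarith
  set C := (ρ + b) ^ 2 / (2 * c) / ρ with hC
  set k := c / (2 * (ρ + 2 * b)) with hk
  have hkpos : 0 < k := by have := S.b_pos; have := S.c_pos; have := S.rho_pos; positivity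
  set A := C - V X - 2 / b * Real.log X with hA
  have hbpos : 0 < 2 / b := by have := S.b_pos; positivity
  set x := max X ((|A| + 2 / b) / k + 1) with hx
  have hxX : X ≤ x := le_max_left _ _
  have hx2 : (|A| + 2 / b) / k + 1 ≤ x := le_max_right _ _
  have h0 : 0 ≤ (|A| + 2 / b) / k := by positivity
  have hx1 : 1 ≤ x := by linarith
  have h1 := hmono (mem_Ici.2 le_rfl) (mem_Ici.2 hxX) hxX
  have h2 := valueReal_le_sub_sq S.b_pos S.c_pos S.rho_pos S.rate (x₀ := x) (by linarith)
  have h3 := Real.log_le_sub_one_of_pos (by linarith : 0 < x)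
  have h4 : 2 / b * Real.log x ≤ 2 / b * x := by gcongr; linarith
  have h5 : |A| + 2 / b ≤ k * (x - 1) := by
    rw [← div_le_iff₀' hkpos]; linarith
  have h6 := le_abs_self A
  have h7 := abs_nonneg A
  simp only [hf] at h1
  nlinarith

end Standing

/-! ### Second derivatives -/

theorem contDiffAt_two_of_eventually {f f' f'' : ℝ → ℝ} {x : ℝ}
    (h : ∀ᶠ y in 𝓝 x, HasDerivAt f (f' y) y ∧ HasDerivAt f' (f'' y) y ∧ ContinuousAt f'' y) :
    ContDiffAt ℝ 2 f x := by
  obtain ⟨s, hs, hso, hxs⟩ := eventually_nhds_iff.1 h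
  have h2 : EqOn (deriv f') f'' s := fun y hy => (hs y hy).2.1.deriv
  have h1 : EqOn (deriv f) f' s := fun y hy => (hs y hy).1.deriv
  have hf' : ContDiffOn ℝ 1 f' s := by
    rw [← zero_add (1 : WithTop ℕ∞), contDiffOn_succ_iff_deriv_of_isOpen hso]
    refine ⟨fun y hy => (hs y hy).2.1.differentiableAt.differentiableWithinAt, by simp, ?_⟩
    rw [contDiffOn_zero]
    exact ContinuousOn.congr (fun y hy => (hs y hy).2.2.continuousWithinAt) h2
  have hf : ContDiffOn ℝ 2 f s := by
    rw [← one_add_one_eq_two, contDiffOn_succ_iff_deriv_of_isOpen hso]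
    exact ⟨fun y hy => (hs y hy).1.differentiableAt.differentiableWithinAt, by simp,
      hf'.congr h1⟩
  exact hf.contDiffAt (hso.mem_nhds hxs)

/-- Strict differentiability makes f(w) - f'(x)w Lipschitz with a small constant near x, which
bounds f' - f'(x) at all nearby points. -/
theorem continuousAt_of_hasStrictDerivAt {f f' : ℝ → ℝ} {x : ℝ} (h : HasStrictDerivAt f (f' x) x)
    (hf : ∀ᶠ y in 𝓝 x, HasDerivAt f (f' y) y) : ContinuousAt f' x := by
  rw [Metric.continuousAt_iff']
  intro ε hε
  have h1 := (Asymptotics.isLittleO_iff.1 h.hasStrictFDerivAt.isLittleO) (half_pos hε)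
  have hdiag : Tendsto (fun y : ℝ => (y, y)) (𝓝 x) (𝓝 (x, x)) :=
    (continuous_id.prodMk continuous_id).tendsto x
  filter_upwards [hf, hdiag.eventually h1.eventually_nhds] with y hy hlip
  have h2 : HasDerivAt (fun w => f w - f' x * w) (f' y - f' x) y := by
    have := hy.fun_sub ((hasDerivAt_id y).const_mul (f' x))
    rwa [mul_one] at this
  have h3 := norm_deriv_le_of_lip' (f := fun w => f w - f' x * w) (x₀ := y) (half_pos hε).le (by
    have hpair : Tendsto (fun w : ℝ => (w, y)) (𝓝 y) (𝓝 (y, y)) :=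
      (continuous_id.prodMk continuous_const).tendsto y
    filter_upwards [hpair.eventually hlip] with w hw
    simp only [ContinuousLinearMap.toSpanSingleton_apply, smul_eq_mul] at hw
    convert! hw using 2
    ring)
  rw [h2.deriv] at h3
  rw [dist_eq_norm]
  linarith

/-- Since N vanishes at x, continuity of D is enough. -/
theorem hasDerivAt_div_of_zero {N D : ℝ → ℝ} {x N' : ℝ} (hN : HasDerivAt N N' x) (hN0 : N x = 0)
    (hD : ContinuousAt D x) (hD0 : D x ≠ 0) : HasDerivAt (fun y => N y / D y) (N' / D x) x := by
  rw [hasDerivAt_iff_tendsto_slope] at hN ⊢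
  refine (hN.div (hD.tendsto.mono_left nhdsWithin_le_nhds) hD0).congr fun y => ?_
  simp only [slope_def_field, hN0, Pi.div_apply, zero_div, sub_zero]
  rw [div_right_comm]

/-- The derivative of the costate where the optimal feedback moves. -/
def curvature (b c ρ : ℝ) (r : ℝ → ℝ) (x : ℝ) : ℝ :=
  (ρ * costate b c ρ r x + 2 * c * x - costate b c ρ r x * (deriv r x - b)) / speed b c ρ r x

/-- The optimal feedback moves at `x`. -/
structure MovesAt (b c ρ : ℝ) (r : ℝ → ℝ) (x : ℝ) : Prop where
  isClassicalAt : IsClassicalAt b c ρ r x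
  hasStrictDerivAt : HasStrictDerivAt (valueReal b c ρ r) (costate b c ρ r x) x
  speed_ne_zero : speed b c ρ r x ≠ 0

theorem MovesRightAt.movesAt {x : ℝ} (h : MovesRightAt b c ρ r x) : MovesAt b c ρ r x :=
  ⟨h.isClassicalAt, h.hasStrictDerivAt, h.speed_pos.ne'⟩

theorem MovesLeftAt.movesAt {x : ℝ} (h : MovesLeftAt b c ρ r x) : MovesAt b c ρ r x :=
  ⟨h.isClassicalAt, h.hasStrictDerivAt, h.speed_neg.ne⟩

namespace Standing

theorem continuousAt_costate {x : ℝ} (h : ∀ᶠ y in 𝓝 x, MovesAt b c ρ r y) :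
    ContinuousAt (costate b c ρ r) x :=
  continuousAt_of_hasStrictDerivAt h.self_of_nhds.hasStrictDerivAt
    (h.mono fun _ hy => hy.isClassicalAt.hasDerivAt)

/-- Implicit differentiation. With p = V'(x), N(y) = ρV(y) - H(y,p) = (V'(y) - p)D(y), where D is
the divided difference of H(y,·) and D(x) is the speed. N is differentiable because V is, and D is
continuous and nonzero at x. -/
theorem hasDerivAt_costate (S : Standing b c ρ r) {x : ℝ} (hx : 0 < x)
    (h : ∀ᶠ y in 𝓝 x, MovesAt b c ρ r y) :
    HasDerivAt (costate b c ρ r) (curvature b c ρ r x) x := by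
  have hpc := continuousAt_costate h
  have hx' := h.self_of_nhds
  set p := costate b c ρ r x with hp
  have hp0 : p < 0 := hx'.isClassicalAt.neg
  set L := fun q : ℝ => Real.log (-q) with hL
  have hLd : HasDerivAt L (1 / p) p := by
    have := (hasDerivAt_id p).fun_neg.log (by simpa using hp0.ne)
    convert! this using 1
    simp only [id]; rw [neg_div_neg_eq]
  set N := fun y => ρ * valueReal b c ρ r y - ham b c r y p with hN
  set D := fun y => drift b r y - dslope L p (costate b c ρ r y) with hD
  have hNd : HasDerivAt N (ρ * p + 2 * c * x - p * (deriv r x - b)) x := by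
    have h1 := (((hasDerivAt_id x).fun_pow 2).const_mul c).const_sub (-Real.log (-p) - 1)
    have h2 := h1.fun_add ((S.rate.hasDerivAt_drift (b := b) hx).const_mul p)
    convert! (hx'.isClassicalAt.hasDerivAt.const_mul ρ).fun_sub h2 using 1
    simp only [id]; push_cast; ring
  have hDp : D x = speed b c ρ r x := by
    simp only [hD, ← hp, dslope_same, hLd.deriv, speed]; ring
  have hDc : ContinuousAt D x := (S.continuousAt_drift hx).sub
    (ContinuousAt.comp (f := costate b c ρ r) (continuousAt_dslope_same.2 hLd.differentiableAt) hpc)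
  have hN0 : N x = 0 := sub_eq_zero.2 hx'.isClassicalAt.ham_eq.symm
  have hDx : D x ≠ 0 := hDp ▸ hx'.speed_ne_zero
  have hq := (hasDerivAt_div_of_zero hNd hN0 hDc hDx).const_add p
  rw [hDp] at hq
  refine hq.congr_of_eventuallyEq ?_
  filter_upwards [h, hDc.eventually_ne hDx] with y hy hDy
  have h1 := sub_smul_dslope L p (costate b c ρ r y)
  rw [smul_eq_mul] at h1
  have h2 : N y = (costate b c ρ r y - p) * D y := by
    simp only [hN, hD, hL] at h1 ⊢
    rw [mul_sub, h1, ← hy.isClassicalAt.ham_eq]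
    simp only [ham]; ring
  rw [h2, mul_div_cancel_right₀ _ hDy]; ring

theorem continuousAt_curvature (S : Standing b c ρ r) {x : ℝ} (hx : 0 < x)
    (h : ∀ᶠ y in 𝓝 x, MovesAt b c ρ r y) : ContinuousAt (curvature b c ρ r) x := by
  have hp := continuousAt_costate h
  have hx' := h.self_of_nhds
  have hr : ContinuousAt (deriv r) x := (S.rate.contDiffAt_deriv hx).continuousAt
  have hs : ContinuousAt (speed b c ρ r) x :=
    (continuousAt_const.div hp hx'.isClassicalAt.neg.ne).add (S.continuousAt_drift hx)
  have hid : ContinuousAt (fun y => 2 * c * y) x := by fun_prop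
  exact (((continuousAt_const.mul hp).add hid).sub (hp.mul (hr.sub continuousAt_const))).div hs
    hx'.speed_ne_zero

theorem eventually_twice_differentiable (S : Standing b c ρ r) {x : ℝ} (hx : 0 < x)
    (h : ∀ᶠ y in 𝓝 x, MovesAt b c ρ r y) :
    HasDerivAt (valueReal b c ρ r) (costate b c ρ r x) x ∧
      HasDerivAt (costate b c ρ r) (deriv (costate b c ρ r) x) x ∧
      ContinuousAt (deriv (costate b c ρ r)) x := by
  have h1 := S.hasDerivAt_costate hx h
  refine ⟨h.self_of_nhds.isClassicalAt.hasDerivAt, h1.deriv ▸ h1, ?_⟩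
  refine (S.continuousAt_curvature hx h).congr ?_
  filter_upwards [h.eventually_nhds, lt_mem_nhds hx] with y hy hy0
  exact (S.hasDerivAt_costate hy0 hy).deriv.symm

theorem contDiffAt_of_movesAt (S : Standing b c ρ r) {x : ℝ} (hx : 0 < x)
    (h : ∀ᶠ y in 𝓝 x, MovesAt b c ρ r y) : ContDiffAt ℝ 2 (valueReal b c ρ r) x := by
  refine contDiffAt_two_of_eventually (f' := costate b c ρ r) (f'' := deriv (costate b c ρ r)) ?_
  filter_upwards [h.eventually_nhds, lt_mem_nhds hx] with y hy hy0
  exact S.eventually_twice_differentiable hy0 hy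

/-- The left side is the derivative of the excess s. Division by the speed leaves the singular
quotient defect/s, which gives the form required by `tendsto_slope_of_deriv_eq`. -/
theorem curvature_mul_drift_add {x : ℝ} (h : IsClassicalAt b c ρ r x) (hg : drift b r x < 0)
    (he : excess b c ρ r x ≠ 0) :
    curvature b c ρ r x * drift b r x + costate b c ρ r x * (deriv r x - b) =
      (1 + excess b c ρ r x) * (ρ / drift b r x) +
        (1 + excess b c ρ r x) * defect b c ρ r x / excess b c ρ r x := by
  have h1 : 1 + excess b c ρ r x ≠ 0 := by linarith [neg_one_lt_excess h hg]
  rw [curvature, speed_eq h hg, costate_eq hg, defect]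
  have := hg.ne
  field_simp
  ring

/-- At distance y from z on the side σ, the function σ · excess is positive because the feedback
points towards z, and it solves s' = a(y) + k(y)y/s with a → ρ/g and k → κ. Its slope tends to θ,
which does not involve σ, so the limit of V'' is the same from both sides. -/
theorem tendsto_near_rest (S : Standing b c ρ r) {z σ δ₀ κ θ : ℝ} (hz : 0 < z)
    (h : IsRest b c ρ r z) (hσ : σ * σ = 1) (hδ₀ : 0 < δ₀)
    (hmov : ∀ y ∈ Ioo 0 δ₀, ∀ᶠ w in 𝓝 (z + σ * y), MovesAt b c ρ r w)
    (hpos : ∀ y ∈ Ioo 0 δ₀, σ * speed b c ρ r (z + σ * y) < 0)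
    (hκ : HasDerivAt (defect b c ρ r) κ z) (hκpos : 0 < κ) (hθ : 0 < θ)
    (hroot : θ ^ 2 = ρ / drift b r z * θ + κ) :
    Tendsto (fun y => costate b c ρ r (z + σ * y)) (𝓝[>] 0) (𝓝 (1 / drift b r z)) ∧
    Tendsto (fun y => deriv (costate b c ρ r) (z + σ * y)) (𝓝[>] 0)
      (𝓝 ((θ - 1 / drift b r z * (deriv r z - b)) / drift b r z)) := by
  have hk := S.defect_eq_zero_of_isRest hz h
  obtain ⟨δ, hδ, hδδ₀, C, hC, hbd⟩ := S.exists_bound_near_rest hz h hσ hδ₀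
    fun y hy => (hmov y hy).self_of_nhds.isClassicalAt
  have hg := h.1
  have hσ0 : σ ≠ 0 := by rintro rfl; norm_num at hσ
  set e := fun y => excess b c ρ r (z + σ * y) with he
  set g := fun y => drift b r (z + σ * y) with hgdef
  have hpath : Tendsto (fun y : ℝ => z + σ * y) (𝓝[>] 0) (𝓝 z) := by
    have : Continuous (fun y : ℝ => z + σ * y) := by fun_prop
    have := this.tendsto 0
    rw [mul_zero, add_zero] at this
    exact this.mono_left nhdsWithin_le_nhds
  have hI : Ioo 0 δ ∈ 𝓝[>] (0 : ℝ) := Ioo_mem_nhdsGT hδ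
  have hgt : Tendsto g (𝓝[>] 0) (𝓝 (drift b r z)) := (S.continuousAt_drift hz).tendsto.comp hpath
  have he0 : Tendsto e (𝓝[>] 0) (𝓝 0) := by
    have hlin : Tendsto (fun y : ℝ => C * y) (𝓝[>] 0) (𝓝 0) := by
      have : Continuous (fun y : ℝ => C * y) := by fun_prop
      have := this.tendsto 0
      rw [mul_zero] at this
      exact this.mono_left nhdsWithin_le_nhds
    refine squeeze_zero_norm' ?_ hlin
    filter_upwards [hI] with y hy
    exact (hbd y hy).2.2.1
  have hcl : ∀ y ∈ Ioo 0 δ, IsClassicalAt b c ρ r (z + σ * y) := fun y hy =>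
    (hmov y ⟨hy.1, hy.2.trans_le hδδ₀⟩).self_of_nhds.isClassicalAt
  have hp : Tendsto (fun y => costate b c ρ r (z + σ * y)) (𝓝[>] 0) (𝓝 (1 / drift b r z)) := by
    have h1 := (he0.const_add 1).div hgt hg.ne
    rw [add_zero] at h1
    refine h1.congr' ?_
    filter_upwards [hI] with y hy
    exact (costate_eq (hbd y hy).2.1).symm
  have hepos : ∀ y ∈ Ioo 0 δ, 0 < σ * e y := fun y hy => by
    have h1 := hpos y ⟨hy.1, hy.2.trans_le hδδ₀⟩
    have h2 := (hbd y hy).2.1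
    have h3 := neg_one_lt_excess (hcl y hy) h2
    rw [speed_eq (hcl y hy) h2, ← mul_div_assoc, div_lt_iff₀ (by linarith), zero_mul] at h1
    have h4 : drift b r (z + σ * y) * (σ * e y) < 0 := by simp only [he]; linarith
    exact pos_of_mul_neg_right h4 h2.le
  set k := fun y => (1 + e y) * (σ * (defect b c ρ r (z + σ * y) / y)) with hkdef
  set a := fun y => (1 + e y) * (ρ / g y) with ha
  have hdq : Tendsto (fun y => σ * (defect b c ρ r (z + σ * y) / y)) (𝓝[>] 0) (𝓝 κ) := by
    have h1 : HasDerivAt (fun y : ℝ => z + σ * y) σ 0 := by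
      simpa using ((hasDerivAt_id (0 : ℝ)).const_mul σ).const_add z
    have h2 := (HasDerivAt.comp (h₂ := defect b c ρ r) (0 : ℝ)
      (by simpa using hκ) h1).tendsto_slope_zero
    have h3 := (h2.mono_left (nhdsGT_le_nhdsNE 0)).const_mul σ
    have h4 : σ * (κ * σ) = κ := by rw [mul_comm κ, ← mul_assoc, hσ, one_mul]
    rw [h4] at h3
    refine h3.congr fun y => ?_
    simp only [Function.comp, zero_add, mul_zero, add_zero, hk, sub_zero, smul_eq_mul]
    ring
  have hkt : Tendsto k (𝓝[>] 0) (𝓝 κ) := by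
    have := (he0.const_add 1).mul hdq
    rwa [add_zero, one_mul] at this
  have hat : Tendsto a (𝓝[>] 0) (𝓝 (ρ / drift b r z)) := by
    have h1 : Tendsto (fun y => ρ / g y) (𝓝[>] 0) (𝓝 (ρ / drift b r z)) :=
      tendsto_const_nhds.div hgt hg.ne
    have := (he0.const_add 1).mul h1
    rwa [add_zero, one_mul] at this
  have hident : ∀ y ∈ Ioo 0 δ, curvature b c ρ r (z + σ * y) * g y +
      costate b c ρ r (z + σ * y) * (deriv r (z + σ * y) - b) =
      a y + k y * y / (σ * e y) := fun y hy => by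
    have hey : e y ≠ 0 := fun h0 => by
      have := hepos y hy; rw [h0, mul_zero] at this; exact lt_irrefl _ this
    rw [curvature_mul_drift_add (hcl y hy) (hbd y hy).2.1 hey]
    have hy0 := hy.1.ne'
    simp only [ha, hkdef, he, hgdef]
    field_simp
  have hcurv : ∀ y ∈ Ioo 0 δ, HasDerivAt (costate b c ρ r) (curvature b c ρ r (z + σ * y))
      (z + σ * y) := fun y hy =>
    S.hasDerivAt_costate (hbd y hy).1 (hmov y ⟨hy.1, hy.2.trans_le hδδ₀⟩)
  have hs : ∀ y ∈ Ioo 0 δ, HasDerivAt (fun y => σ * e y) (a y + k y * y / (σ * e y)) y := by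
    intro y hy
    have h1 : HasDerivAt (fun y : ℝ => z + σ * y) σ y := by
      simpa using ((hasDerivAt_id y).const_mul σ).const_add z
    have h2 : HasDerivAt (excess b c ρ r) _ (z + σ * y) :=
      ((hcurv y hy).fun_mul (S.rate.hasDerivAt_drift (b := b) (hbd y hy).1)).sub_const 1
    have h3 := (HasDerivAt.comp (h₂ := excess b c ρ r) (h := fun y => z + σ * y) y h2 h1).const_mul σ
    convert! h3 using 1
    rw [← hident y hy]
    simp only [hgdef]
    linear_combination (-(curvature b c ρ r (z + σ * y) * drift b r (z + σ * y) +
      costate b c ρ r (z + σ * y) * (deriv r (z + σ * y) - b))) * hσ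
  have hs0 : Tendsto (fun y => σ * e y) (𝓝[>] 0) (𝓝 0) := by
    have := he0.const_mul σ; rwa [mul_zero] at this
  have hslope := tendsto_slope_of_deriv_eq hδ hs hepos hs0 hat hkt hκpos hθ hroot
  refine ⟨hp, ?_⟩
  have hinv : Tendsto (fun y => k y * y / (σ * e y)) (𝓝[>] 0) (𝓝 (κ / θ)) := by
    refine (hkt.div hslope hθ.ne').congr fun y => ?_
    simp only [Pi.div_apply]
    rw [div_div_eq_mul_div]
  have hsum := hat.add hinv
  have hθeq : ρ / drift b r z + κ / θ = θ := by
    rw [← eq_sub_iff_add_eq', div_eq_iff hθ.ne']; linarith [hroot]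
  rw [hθeq] at hsum
  have hr : Tendsto (fun y => deriv r (z + σ * y) - b) (𝓝[>] 0) (𝓝 (deriv r z - b)) :=
    (((S.rate.contDiffAt_deriv hz).continuousAt).tendsto.comp hpath).sub_const b
  refine ((hsum.sub (hp.mul hr)).div hgt hg.ne).congr' ?_
  filter_upwards [hI] with y hy
  rw [(hcurv y hy).deriv]
  simp only [Pi.div_apply]
  rw [← hident y hy, add_sub_cancel_right, mul_div_cancel_right₀ _ (hbd y hy).2.1.ne]

theorem exists_pos_root {a κ : ℝ} (hκ : 0 < κ) : ∃ θ > 0, θ ^ 2 = a * θ + κ := by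
  have h1 : 0 ≤ a ^ 2 + 4 * κ := by positivity
  have h2 : |a| < √(a ^ 2 + 4 * κ) := by
    rw [← Real.sqrt_sq_eq_abs]
    exact Real.sqrt_lt_sqrt (sq_nonneg a) (by linarith)
  refine ⟨(a + √(a ^ 2 + 4 * κ)) / 2, by linarith [neg_abs_le a], ?_⟩
  nlinarith [Real.sq_sqrt h1]

/-- V' is continuous at z and the one-sided limits of V'' coincide by `tendsto_near_rest`, so the
common limit is the derivative of V' at z. -/
theorem contDiffAt_of_isRest (S : Standing b c ρ r) {z δ κ : ℝ} (hz : 0 < z)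
    (h : IsRest b c ρ r z) (hκ : HasDerivAt (defect b c ρ r) κ z) (hκpos : 0 < κ) (hδ : 0 < δ)
    (hδz : δ ≤ z) (hR : ∀ x ∈ Ioo (z - δ) z, MovesRightAt b c ρ r x)
    (hL : ∀ x ∈ Ioo z (z + δ), MovesLeftAt b c ρ r x) : ContDiffAt ℝ 2 (valueReal b c ρ r) z := by
  obtain ⟨θ, hθ, hroot⟩ := exists_pos_root (a := ρ / drift b r z) hκpos
  set q := (θ - 1 / drift b r z * (deriv r z - b)) / drift b r z with hq
  have hpz : costate b c ρ r z = 1 / drift b r z := (S.hasDerivAt_of_isRest hz h).deriv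
  have hmR : ∀ x ∈ Ioo (z - δ) z, ∀ᶠ w in 𝓝 x, MovesAt b c ρ r w := fun x hx => by
    filter_upwards [Ioo_mem_nhds hx.1 hx.2] with w hw using (hR w hw).movesAt
  have hmL : ∀ x ∈ Ioo z (z + δ), ∀ᶠ w in 𝓝 x, MovesAt b c ρ r w := fun x hx => by
    filter_upwards [Ioo_mem_nhds hx.1 hx.2] with w hw using (hL w hw).movesAt
  have memL : ∀ y ∈ Ioo 0 δ, z + 1 * y ∈ Ioo z (z + δ) := fun y hy =>
    ⟨by linarith [hy.1], by linarith [hy.2]⟩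
  have memR : ∀ y ∈ Ioo 0 δ, z + -1 * y ∈ Ioo (z - δ) z := fun y hy =>
    ⟨by linarith [hy.2], by linarith [hy.1]⟩
  obtain ⟨hL1, hL2⟩ := S.tendsto_near_rest hz h (σ := 1) (by norm_num) hδ
    (fun y hy => hmL _ (memL y hy))
    (fun y hy => by rw [one_mul]; exact (hL _ (memL y hy)).speed_neg) hκ hκpos hθ hroot
  obtain ⟨hR1, hR2⟩ := S.tendsto_near_rest hz h (σ := -1) (by norm_num) hδ
    (fun y hy => hmR _ (memR y hy))
    (fun y hy => by rw [neg_one_mul]; exact neg_neg_of_pos (hR _ (memR y hy)).speed_pos)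
    hκ hκpos hθ hroot
  have hcR : Tendsto (fun x => x - z) (𝓝[>] z) (𝓝[>] 0) := by
    refine tendsto_nhdsWithin_iff.2 ⟨?_, ?_⟩
    · have : Continuous (fun x => x - z) := by fun_prop
      have := this.tendsto z
      rw [sub_self] at this
      exact this.mono_left nhdsWithin_le_nhds
    · filter_upwards [self_mem_nhdsWithin] with x hx using mem_Ioi.2 (sub_pos.2 hx)
  have hcL : Tendsto (fun x => z - x) (𝓝[<] z) (𝓝[>] 0) := by
    refine tendsto_nhdsWithin_iff.2 ⟨?_, ?_⟩
    · have : Continuous (fun x => z - x) := by fun_prop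
      have := this.tendsto z
      rw [sub_self] at this
      exact this.mono_left nhdsWithin_le_nhds
    · filter_upwards [self_mem_nhdsWithin] with x hx using mem_Ioi.2 (sub_pos.2 hx)
  have eR : ∀ x, z + 1 * (x - z) = x := fun x => by ring
  have eL : ∀ x, z + -1 * (z - x) = x := fun x => by ring
  have pR := hL1.comp hcR
  have pL := hR1.comp hcL
  have dR := hL2.comp hcR
  have dL := hR2.comp hcL
  simp only [Function.comp_def, eR] at pR dR
  simp only [Function.comp_def, eL] at pL dL
  rw [← hpz] at pR pL
  have hRmem : Ioo z (z + δ) ∈ 𝓝[>] z := Ioo_mem_nhdsGT (by linarith)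
  have hLmem : Ioo (z - δ) z ∈ 𝓝[<] z := Ioo_mem_nhdsLT (by linarith)
  have hdR : HasDerivWithinAt (costate b c ρ r) q (Ici z) z :=
    hasDerivWithinAt_Ici_of_tendsto_deriv
      (fun x hx => (S.hasDerivAt_costate (hz.trans hx.1)
        (hmL x hx)).differentiableAt.differentiableWithinAt)
      (ContinuousWithinAt.mono (t := Ioi z) pR fun x hx => hx.1) hRmem dR
  have hdL : HasDerivWithinAt (costate b c ρ r) q (Iic z) z :=
    hasDerivWithinAt_Iic_of_tendsto_deriv
      (fun x hx => (S.hasDerivAt_costate (by linarith [hx.1])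
        (hmR x hx)).differentiableAt.differentiableWithinAt)
      (ContinuousWithinAt.mono (t := Iio z) pL fun x hx => hx.2) hLmem dL
  have hd : HasDerivAt (costate b c ρ r) q z := by
    have := hdL.union hdR
    rwa [Iic_union_Ici, hasDerivWithinAt_univ] at this
  have hdc : ContinuousAt (deriv (costate b c ρ r)) z := by
    rw [continuousAt_iff_continuous_left'_right']
    have hdz := hd.deriv
    exact ⟨by rw [ContinuousWithinAt, hdz]; exact dL, by rw [ContinuousWithinAt, hdz]; exact dR⟩
  refine contDiffAt_two_of_eventually (f' := costate b c ρ r) (f'' := deriv (costate b c ρ r)) ?_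
  filter_upwards [Ioo_mem_nhds (show z - δ < z by linarith) (show z < z + δ by linarith)] with x hx
  rcases lt_trichotomy x z with hxz | rfl | hxz
  · exact S.eventually_twice_differentiable (by linarith [hx.1]) (hmR x ⟨hx.1, hxz⟩)
  · exact ⟨(S.isClassicalAt_of_isRest hz h).hasDerivAt, hd.deriv ▸ hd, hdc⟩
  · exact S.eventually_twice_differentiable (hz.trans hxz) (hmL x ⟨hxz, hx.2⟩)

/-! ### Steady states -/

/-- Confines rest points to the range between the extreme steady states. -/
theorem isSteadyState_of_isRest (S : Standing b c ρ r) {x : ℝ} (hx : 0 < x) (h : IsRest b c ρ r x) :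
    IsSteadyState b c ρ r (x, -drift b r x) := by
  have hk := S.defect_eq_zero_of_isRest hx h
  have hg := h.1
  refine ⟨hx.le, neg_pos.2 hg, ?_⟩
  have h1 : (ρ - (deriv r x - b)) = -(2 * c * x) * drift b r x := by
    rw [defect, ← eq_neg_iff_add_eq_zero, div_eq_iff hg.ne] at hk
    exact hk
  refine Prod.ext ?_ ?_
  · simp only [lakeField, drift, Prod.fst_zero]; ring
  · simp only [lakeField, Prod.snd_zero]
    linear_combination drift b r x * h1

end Standing

theorem IsSteadyState.properties (hr : IsRecyclingRate b ρ r) {z : ℝ × ℝ}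
    (h : IsSteadyState b c ρ r z) :
    0 < z.1 ∧ drift b r z.1 = -z.2 ∧ ρ - (deriv r z.1 - b) = 2 * c * z.1 * z.2 := by
  obtain ⟨h1, h2, h3⟩ := h
  have e1 : z.2 - b * z.1 + r z.1 = 0 := congrArg Prod.fst h3
  have e2 : -(ρ + b - deriv r z.1) * z.2 + 2 * c * z.1 * z.2 ^ 2 = 0 := congrArg Prod.snd h3
  refine ⟨lt_of_le_of_ne h1 fun h0 => ?_, by simp only [drift]; linarith, ?_⟩
  · rw [← h0, hr.map_zero] at e1; linarith
  · refine mul_right_cancel₀ h2.ne' ?_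
    linear_combination -e2

/-- The linearisation at a steady state has trace ρ, so an eigenvalue l has cofactor ρ - l, and the
slope of the defect is -det/u² = (l² - ρl)/u². This is positive for l < 0. -/
theorem IsSaddlePoint.exists_hasDerivAt_defect (hr : IsRecyclingRate b ρ r) (hρ : 0 < ρ)
    {z : ℝ × ℝ} (h : IsSaddlePoint b c ρ r z) :
    ∃ κ > 0, HasDerivAt (defect b c ρ r) κ z.1 := by
  obtain ⟨hz, l, -, hl, -, hev, -⟩ := h
  obtain ⟨hx, hg, hd⟩ := hz.properties hr
  have hu := hz.2.1
  obtain ⟨x, u⟩ := z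
  simp only at hx hg hd hu
  have hr2 : HasDerivAt (deriv r) (deriv (deriv r) x) x :=
    ((hr.contDiffAt_deriv hx).differentiableAt (by norm_num)).hasDerivAt
  set R := deriv (deriv r) x with hR
  have hr1 := hr.hasDerivAt hx
  set d := deriv r x with hddef
  obtain ⟨v, hv⟩ := hev.exists_hasEigenvector
  have hdiff : DifferentiableAt ℝ (lakeField b c ρ r) (x, u) := by
    have e1 : DifferentiableAt ℝ (fun w : ℝ × ℝ => r w.1) (x, u) :=
      DifferentiableAt.comp (g := r) (f := Prod.fst) _ hr1.differentiableAt differentiableAt_fst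
    have e2 : DifferentiableAt ℝ (fun w : ℝ × ℝ => deriv r w.1) (x, u) :=
      DifferentiableAt.comp (g := deriv r) (f := Prod.fst) _ hr2.differentiableAt
        differentiableAt_fst
    unfold lakeField
    exact (DifferentiableAt.fun_add (by fun_prop) e1).prodMk
      (((e2.const_sub _).fun_neg.fun_mul (by fun_prop)).fun_add (by fun_prop))
  -- Differentiating the field along the line through the steady state in the direction of an
  -- eigenvector gives the two scalar eigenvalue equations without writing out the Jacobian.
  have hpx : HasDerivAt (fun t : ℝ => x + t * v.1) v.1 0 := by
    simpa using ((hasDerivAt_id (0 : ℝ)).mul_const v.1).const_add x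
  have hpu : HasDerivAt (fun t : ℝ => u + t * v.2) v.2 0 := by
    simpa using ((hasDerivAt_id (0 : ℝ)).mul_const v.2).const_add u
  have hpath : HasDerivAt (fun t : ℝ => (x + t * v.1, u + t * v.2)) v 0 := hpx.prodMk hpu
  have hcomp := HasFDerivAt.comp_hasDerivAt (l := lakeField b c ρ r) (0 : ℝ)
    (by simpa using hdiff.hasFDerivAt) hpath
  have hve : fderiv ℝ (lakeField b c ρ r) (x, u) v = l • v := hv.apply_eq_smul
  rw [hve] at hcomp
  have h1 := (ContinuousLinearMap.fst ℝ ℝ ℝ).hasFDerivAt.comp_hasDerivAt 0 hcomp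
  have h2 := (ContinuousLinearMap.snd ℝ ℝ ℝ).hasFDerivAt.comp_hasDerivAt 0 hcomp
  have hrp : HasDerivAt (fun t : ℝ => r (x + t * v.1)) (d * v.1) 0 :=
    HasDerivAt.comp (h₂ := r) (0 : ℝ) (by simpa using hr1) hpx
  have hrp2 : HasDerivAt (fun t : ℝ => deriv r (x + t * v.1)) (R * v.1) 0 :=
    HasDerivAt.comp (h₂ := deriv r) (0 : ℝ) (by simpa using hr2) hpx
  have g1 := h1.unique ((hpu.fun_sub (hpx.const_mul b)).fun_add hrp)
  have g2 := h2.unique ((((hrp2.const_sub (ρ + b)).fun_neg).fun_mul hpu).fun_add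
    ((hpx.const_mul (2 * c)).fun_mul (hpu.fun_pow 2)))
  simp only [ContinuousLinearMap.coe_fst', Prod.smul_fst, smul_eq_mul] at g1
  simp only [ContinuousLinearMap.coe_snd', Prod.smul_snd, smul_eq_mul, zero_mul, add_zero] at g2
  push_cast at g2
  norm_num at g2
  rw [← hddef] at g2
  have hv1 : v.1 ≠ 0 := by
    intro h0
    refine hv.2 (Prod.ext h0 ?_)
    rw [h0] at g1
    simp only [Prod.snd_zero]
    linarith
  have hv2 : v.2 = (l - (d - b)) * v.1 := by linarith
  have hkey : R * u + 2 * c * u ^ 2 = (l - (ρ - (d - b))) * (l - (d - b)) := by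
    refine mul_right_cancel₀ hv1 ?_
    rw [hv2] at g2
    linear_combination -g2 + (2 * (l - (d - b)) * v.1) * hd
  have hgd := hr.hasDerivAt_drift (b := b) hx
  have hg0 : drift b r x ≠ 0 := by rw [hg]; exact (neg_neg_of_pos hu).ne
  have hder := (((hr2.sub_const b).const_sub ρ).fun_div hgd hg0).fun_add
    ((hasDerivAt_id x).const_mul (2 * c))
  refine ⟨_, ?_, hder⟩
  rw [hg, ← hddef]
  have : (-R * -u - (ρ - (d - b)) * (d - b)) / (-u) ^ 2 + 2 * c * 1 =
      (l ^ 2 - ρ * l) / u ^ 2 := by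
    rw [neg_sq, div_add' _ _ _ (pow_ne_zero 2 hu.ne')]
    congr 1
    linear_combination hkey
  rw [this]
  exact div_pos (by nlinarith) (by positivity)

theorem Standing.isRest_of_tendsto (S : Standing b c ρ r) {x₀ : ℝ} {z : ℝ × ℝ} {u x : ℝ → ℝ}
    (hz : IsSteadyState b c ρ r z) (h : Run b c ρ r x₀ u x)
    (hopt : gain c ρ u x = valueReal b c ρ r x₀) (hlim : Tendsto x atTop (𝓝 z.1)) :
    IsRest b c ρ r z.1 := by
  obtain ⟨hx, hg, -⟩ := hz.properties S.rate
  have hg0 : drift b r z.1 < 0 := by rw [hg]; exact neg_neg_of_pos hz.2.1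
  exact ⟨hg0, S.value_eq_of_tendsto hx hg0 h hopt hlim⟩

/-- The feedback moves right, left, right, left on the four intervals cut out by x_-, x_* and x_+.
Thus x_± attract from both sides, as `contDiffAt_of_isRest` requires, and only x_* repels. -/
theorem Standing.contDiffAt_of_isSkibaPoint (S : Standing b c ρ r) {xs : ℝ}
    (h : IsSkibaPoint b c ρ r xs) {x : ℝ} (hx : 0 < x) (hxs : x ≠ xs) :
    ContDiffAt ℝ 2 (valueReal b c ρ r) x := by
  obtain ⟨zm, zp, hm, hp, hext, hmx, hxp, ⟨um, xm, hom, hlm⟩, ⟨up, xp, hop, hlp⟩⟩ := h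
  obtain ⟨hm0, -, -⟩ := hm.1.properties S.rate
  have hxs0 : 0 ≤ xs := (hm0.trans hmx).le
  obtain ⟨hrm, hgm⟩ := hom.run_and_gain_eq S.b_pos S.c_pos S.rho_pos S.rate hxs0
  obtain ⟨hrp, hgp⟩ := hop.run_and_gain_eq S.b_pos S.c_pos S.rho_pos S.rate hxs0
  have hRm := S.isRest_of_tendsto hm.1 hrm hgm hlm
  have hRp := S.isRest_of_tendsto hp.1 hrp hgp hlp
  have r1 := S.movesRightAt_of_no_rest (e := zm.1) fun y hy hrest =>
    ((hext _ (S.isSteadyState_of_isRest hy.1 hrest)).1).not_gt hy.2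
  have r2 := S.movesLeftAt_of_tendsto hm0.le hrm hgm hlm
  have r3 := S.movesRightAt_of_tendsto hxs0 hrp hgp hlp
  have r4 := S.movesLeftAt_of_no_rest (e := zp.1) (hxs0.trans hxp.le) fun y hy hrest =>
    ((hext _ (S.isSteadyState_of_isRest (hxs0.trans_lt (hxp.trans hy)) hrest)).2).not_gt hy
  have mk : ∀ {α β : ℝ}, x ∈ Ioo α β → (∀ y ∈ Ioo α β, MovesAt b c ρ r y) →
      ContDiffAt ℝ 2 (valueReal b c ρ r) x := fun hxI hM =>
    S.contDiffAt_of_movesAt hx (eventually_of_mem (Ioo_mem_nhds hxI.1 hxI.2) hM)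
  rcases lt_trichotomy x zm.1 with h1 | h1 | h1
  · exact mk ⟨hx, h1⟩ fun y hy => (r1 y hy).movesAt
  · obtain ⟨κ, hκpos, hκ⟩ := hm.exists_hasDerivAt_defect S.rate S.rho_pos
    rw [h1]
    -- The two bounds keep the neighbourhood of x_- inside (0, x_*).
    have hδ : 0 < min zm.1 (xs - zm.1) := lt_min hm0 (by linarith)
    have h2 := min_le_left zm.1 (xs - zm.1)
    have h3 := min_le_right zm.1 (xs - zm.1)
    exact S.contDiffAt_of_isRest hm0 hRm hκ hκpos hδ h2
      (fun y hy => r1 y ⟨by linarith [hy.1], hy.2⟩)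
      (fun y hy => r2 y ⟨hy.1, by linarith [hy.2]⟩)
  rcases lt_or_gt_of_ne hxs with h2 | h2
  · exact mk ⟨h1, h2⟩ fun y hy => (r2 y hy).movesAt
  rcases lt_trichotomy x zp.1 with h3 | h3 | h3
  · exact mk ⟨h2, h3⟩ fun y hy => (r3 y hy).movesAt
  · obtain ⟨κ, hκpos, hκ⟩ := hp.exists_hasDerivAt_defect S.rate S.rho_pos
    rw [h3]
    exact S.contDiffAt_of_isRest (δ := zp.1 - xs) (by linarith) hRp hκ hκpos (by linarith)
      (by linarith) (fun y hy => r3 y ⟨by linarith [hy.1], hy.2⟩)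
      (fun y hy => r4 y hy.1)
  · exact mk (β := x + 1) ⟨h3, by linarith⟩ fun y hy => (r4 y hy.1).movesAt

end ShallowLake

end

theorem mainTheorem11 (b c ρ : ℝ) (hb : 0 < b) (hc : 0 < c) (hρ : 0 < ρ)
    (r : ℝ → ℝ) (hr : ShallowLake.IsRecyclingRate b ρ r)
    (xs : ℝ) (hxs : ShallowLake.IsSkibaPoint b c ρ r xs) :
    (∀ x : ℝ, 0 ≤ x → ShallowLake.value b c ρ r x ≠ ⊥ ∧ ShallowLake.value b c ρ r x ≠ ⊤) ∧
      ContDiffOn ℝ 2 (fun x => (ShallowLake.value b c ρ r x).toReal) (Set.Ioi 0 \ {xs}) := by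
  refine ⟨fun x hx => ⟨ShallowLake.value_ne_bot hb hρ hr hx, ShallowLake.value_ne_top hc hρ hr x⟩,
    fun x hx => ?_⟩
  exact (ShallowLake.Standing.contDiffAt_of_isSkibaPoint ⟨hb, hc, hρ, hr⟩ hxs hx.1
    hx.2).contDiffWithinAt
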